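/- **Setting.** Let $d\ge 1$, let $D\subset\mathbb R^d$ be a (bounded) Lipschitz domain, and let $C_{\rm u}>0$, $\eta>0$, $c_1>0$ and an integer $C_{\rm leaf}\ge 2$ be given. *Points.* Points $x_1,\dots,x_N\in D$ are quasi-uniform with constant $C_{\rm u}$ if $|x_i-x_j|\ge C_{\rm u}^{-1}N^{-1/d}$ for $i\ne j$ and $\min_i|y-x_i|\le C_{\rm u}N^{-1/d}$ for all $y\in D$. *Kernels.* For an open set $E\subseteq\mathbb R^d$ and $c_2>0$, a function $\varrho:E\times E\to\mathbb R$ is asymptotically smooth on $E$ with constants $c_1,c_2$ if it is $C^\infty$ on $\{(x,y)\in E\times E: x\ne y\}$ and $$|\partial_x^\alpha\partial_y^\beta\varrho(x,y)|\le c_1\,(c_2|x-y|)^{-|\alpha|_1-|\beta|_1}\,|\alpha+\beta|_1!\qquad (x\neq y\in E,\ |\alpha|_1+|\beta|_1\ge 1).$$ *Trees.* For a nonempty set $X$ of points let $B_X$ be the smallest axis-parallel box containing $X$. The cluster tree has root $\{x_1,\dots,x_N\}$. A cluster $X$ with $|X|>C_{\rm leaf}$ has two sons: its part in the (closed) lower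 half of $B_X$, halved along a longest edge (ties broken arbitrarily), and the rest of $X$. Other clusters are leaves. Two boxes $B,B'$ are admissible if $\max\{\operatorname{diam}B,\operatorname{diam}B'\}\le\eta\operatorname{dist}(B,B')$. The block-cluster tree has as root the pair (root, root). A block $(X,Y)$ is a leaf if $B_X,B_Y$ are admissible or if $X$ and $Y$ are both leaves; otherwise its sons are obtained by replacing each of $X,Y$ that is not a leaf by its sons. Admissible leaves form the far field, the other leaves the near field. *Interpolation and $\boldsymbol C_p$.* For $p\ge1$ let $q^X_n$, $L^X_n$ ($n\in\{1,\dots,p\}^d$) be the tensor Chebyshev nodes ($p$ zeros of the Chebyshev polynomial per direction, transformed to $B_X$) and their Lagrange basis functions; in a direction in which $B_X$ has width zero, interpolation is evaluation at the single coordinate value. Set $\boldsymbol C_{ij}=\varrho(x_i,x_j)$. The $H^2$-matrix $\boldsymbol C_p\in\mathbb R^{N\times N}$ agrees with $\boldsymbol C$ on near-field blocks, and on far-field blocks $(X,Y)$ it equals $\boldsymbol V^X\boldsymbol M^{XY}(\boldsymbol V^Y)^T$ with $\boldsymbol V^X_{in}=L^X_n(x_i)$ and $\boldsymbol M^{XY}_{nm}=\varrho(q^X_n,q^Y_m)$.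 It is stored through $\boldsymbol V^X$ for the leaf clusters $X$, the transfer matrices $(L^X_n(q^{X'}_m))_{mn}$ for the sons $X'$ of clusters $X$, the matrices $\boldsymbol M^{XY}$ for the far-field blocks, and the near-field blocks of $\boldsymbol C$, one memory unit per entry. **Proposition 3.2.** There is a constant $C_H>0$, depending only on $d$, $D$, $C_{\rm u}$, $C_{\rm leaf}$, $\eta$ and $c_1$, such that the following holds for all $N$, all quasi-uniform points $x_1,\dots,x_N\in D$ with constant $C_{\rm u}$, all integers $p\ge1$, and all $c_2>0$ and all symmetric kernels $\varrho$ (in particular covariance functions) that are asymptotically smooth with constants $c_1,c_2$ on an open set $E$ containing $D$ and the bounding box of $\{x_1,\dots,x_N\}$. 1. $\displaystyle \|\boldsymbol C-\boldsymbol C_p\|_2\le\|\boldsymbol C-\boldsymbol C_p\|_F\le C_H\,N\,(\log p+1)^{2d-1}\Big(\frac{\eta}{4c_2}\Big)^p .$ 2. $\boldsymbol C_p$ is symmetric, and it is stored in fewer than $C_H\,p^{2d}N$ memory units. 3. For every $z\in\mathbb R^N$ the product $\boldsymbol C_pz$ can be computed from $z$ and the stored numbers in fewer than $C_H\,p^{2d}N$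 arithmetic operations. More precisely, this is done by a straight-line program that depends only on the points, the trees and $p$, but not on $\varrho$ or $z$. 4. If $\displaystyle C_H N(\log p+1)^{2d-1}\Big(\frac{\eta}{4c_2}\Big)^p<\lambda_{\min}(\boldsymbol C)$, where $\lambda_{\min}(\boldsymbol C)=\inf_{z\ne0}\,(\boldsymbol Cz)^Tz/|z|^2$, then $\boldsymbol C_p$ is positive definite. -/

import Mathlib

open scoped ContDiff Matrix

namespace H2Matrix

/-- Euclidean space of dimension `d`. -/
abbrev Pt (d : ℕ) : Type := EuclideanSpace ℝ (Fin d)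

/-! ### Domains, kernels, point sets -/

/-- A (strongly) Lipschitz domain: bounded, open, connected and nonempty, and near every boundary
point `D` is the set of points below the graph of a Lipschitz function. The graph is taken in
direction of a unit vector `e`; the function `φ` depends only on the components orthogonal
to `e`. -/
structure IsLipschitzDomain {d : ℕ} (D : Set (Pt d)) : Prop where
  isOpen : IsOpen D
  isConnected : IsConnected D
  isBounded : Bornology.IsBounded D
  graph : ∀ z ∈ frontier D, ∃ (e : Pt d) (r : ℝ) (K : NNReal) (φ : Pt d → ℝ),
    ‖e‖ = 1 ∧ 0 < r ∧ LipschitzWith K φ ∧ (∀ (y : Pt d) (t : ℝ), φ (y + t • e) = φ y) ∧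
      ∀ y ∈ Metric.ball z r, y ∈ D ↔ inner ℝ y e < φ y

/-- The `2d` coordinate directions of `ℝᵈ × ℝᵈ`: `Sum.inl k` is the `k`-th coordinate of the first
variable, `Sum.inr k` the `k`-th coordinate of the second variable. -/
noncomputable def coordDir {d : ℕ} : Fin d ⊕ Fin d → Pt d × Pt d
  | Sum.inl k => (EuclideanSpace.single k 1, 0)
  | Sum.inr k => (0, EuclideanSpace.single k 1)

/-- Asymptotic smoothness on `E` with constants `c₁`, `c₂`. A word `w` of `k` coordinate directions
stands for the mixed partial derivative `∂ₓ^α ∂ᵧ^β`, where `α` and `β` count the occurrences of the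
directions of the first and of the second variable, so that `|α|₁ + |β|₁ = |α + β|₁ = k`; every
pair of multi-indices with `|α|₁ + |β|₁ = k` arises in this way. -/
structure AsympSmooth {d : ℕ} (E : Set (Pt d)) (c₁ c₂ : ℝ) (ρ : Pt d → Pt d → ℝ) : Prop where
  smooth : ContDiffOn ℝ ∞ (fun z : Pt d × Pt d => ρ z.1 z.2)
    {z : Pt d × Pt d | z.1 ∈ E ∧ z.2 ∈ E ∧ z.1 ≠ z.2}
  bound : ∀ x ∈ E, ∀ y ∈ E, x ≠ y → ∀ k : ℕ, 1 ≤ k → ∀ w : Fin k → Fin d ⊕ Fin d,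
    |iteratedFDeriv ℝ k (fun z : Pt d × Pt d => ρ z.1 z.2) (x, y) (fun j => coordDir (w j))| ≤
      c₁ * ((c₂ * ‖x - y‖) ^ k)⁻¹ * (Nat.factorial k : ℝ)

/-- Quasi-uniformly distributed points `x₁, …, x_N` in `D` with constant `Cu`. -/
structure QuasiUniform {d N : ℕ} (D : Set (Pt d)) (Cu : ℝ) (x : Fin N → Pt d) : Prop where
  mem : ∀ i, x i ∈ D
  separated : ∀ i j, i ≠ j → Cu⁻¹ * (N : ℝ) ^ (-(1 / (d : ℝ))) ≤ ‖x i - x j‖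
  fill : ∀ y ∈ D, ∃ i, ‖y - x i‖ ≤ Cu * (N : ℝ) ^ (-(1 / (d : ℝ)))

/-! ### Axis-parallel boxes -/

/-- An axis-parallel box, given by its lower and upper corner; edges may have length zero. -/
structure Box (d : ℕ) where
  lo : Fin d → ℝ
  hi : Fin d → ℝ

/-- The points of a box. -/
def Box.toSet {d : ℕ} (B : Box d) : Set (Pt d) := {y | ∀ k, B.lo k ≤ y k ∧ y k ≤ B.hi k}

/-- The length of the `k`-th edge. -/
def Box.edge {d : ℕ} (B : Box d) (k : Fin d) : ℝ := B.hi k - B.lo k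

/-- The Euclidean diameter of a box. -/
noncomputable def Box.diam {d : ℕ} (B : Box d) : ℝ := Metric.diam B.toSet

/-- The Euclidean distance of two boxes. -/
noncomputable def Box.dist {d : ℕ} (B B' : Box d) : ℝ :=
  ⨅ z : B.toSet × B'.toSet, ‖(z.1 : Pt d) - (z.2 : Pt d)‖

/-- The admissibility condition with parameter `η`. -/
def Admissible {d : ℕ} (η : ℝ) (B B' : Box d) : Prop := max B.diam B'.diam ≤ η * B.dist B'

/-- The smallest axis-parallel box `B_X` that contains the points with index in `X`
(for nonempty `X`). -/
noncomputable def bbox {d N : ℕ} (x : Fin N → Pt d) (X : Finset (Fin N)) : Box d where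
  lo k := ⨅ i : X, x i k
  hi k := ⨆ i : X, x i k

/-! ### Cluster tree and block-cluster tree

Clusters are represented by their index sets. The function `κ` selects, for each cluster, one of the
longest edges of its bounding box, see `LongestEdge`. -/

/-- `κ X` is the direction of a longest edge of `B_X`, for every `X`. -/
def LongestEdge {d N : ℕ} (x : Fin N → Pt d) (κ : Finset (Fin N) → Fin d) : Prop :=
  ∀ X k, (bbox x X).edge k ≤ (bbox x X).edge (κ X)

open Classical in
/-- `X₀`: the part of `X` in the lower half of `B_X`, split along the edge `κ X`. -/
noncomputable def lowerSon {d N : ℕ} (x : Fin N → Pt d) (κ : Finset (Fin N) → Fin d)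
    (X : Finset (Fin N)) : Finset (Fin N) :=
  X.filter fun i => x i (κ X) ≤ ((bbox x X).lo (κ X) + (bbox x X).hi (κ X)) / 2

/-- The sons of a cluster: `X₀` and `X₁ = X \ X₀` if `|X| > Cleaf`, none otherwise. -/
noncomputable def sons {d N : ℕ} (x : Fin N → Pt d) (κ : Finset (Fin N) → Fin d) (Cleaf : ℕ)
    (X : Finset (Fin N)) : Finset (Finset (Fin N)) :=
  if Cleaf < X.card then {lowerSon x κ X, X \ lowerSon x κ X} else ∅

/-- The nodes of the cluster tree. -/
inductive IsCluster {d N : ℕ} (x : Fin N → Pt d) (κ : Finset (Fin N) → Fin d) (Cleaf : ℕ) :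
    Finset (Fin N) → Prop
  | root : IsCluster x κ Cleaf Finset.univ
  | son {X X' : Finset (Fin N)} :
      IsCluster x κ Cleaf X → X' ∈ sons x κ Cleaf X → IsCluster x κ Cleaf X'

open Classical in
/-- The sons of a block `(X, Y)`. -/
noncomputable def blockSons {d N : ℕ} (x : Fin N → Pt d) (κ : Finset (Fin N) → Fin d) (Cleaf : ℕ)
    (η : ℝ) (b : Finset (Fin N) × Finset (Fin N)) : Finset (Finset (Fin N) × Finset (Fin N)) :=
  if Admissible η (bbox x b.1) (bbox x b.2) ∨ (sons x κ Cleaf b.1 = ∅ ∧ sons x κ Cleaf b.2 = ∅)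
  then ∅
  else if sons x κ Cleaf b.1 = ∅ then {b.1} ×ˢ sons x κ Cleaf b.2
  else if sons x κ Cleaf b.2 = ∅ then sons x κ Cleaf b.1 ×ˢ {b.2}
  else sons x κ Cleaf b.1 ×ˢ sons x κ Cleaf b.2

/-- The nodes of the block-cluster tree. -/
inductive IsBlock {d N : ℕ} (x : Fin N → Pt d) (κ : Finset (Fin N) → Fin d) (Cleaf : ℕ) (η : ℝ) :
    Finset (Fin N) × Finset (Fin N) → Prop
  | root : IsBlock x κ Cleaf η (Finset.univ, Finset.univ)
  | son {b b' : Finset (Fin N) × Finset (Fin N)} :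
      IsBlock x κ Cleaf η b → b' ∈ blockSons x κ Cleaf η b → IsBlock x κ Cleaf η b'

open Classical in
/-- The far field: the admissible leaves of the block-cluster tree. -/
noncomputable def far {d N : ℕ} (x : Fin N → Pt d) (κ : Finset (Fin N) → Fin d) (Cleaf : ℕ)
    (η : ℝ) : Finset (Finset (Fin N) × Finset (Fin N)) :=
  Finset.univ.filter fun b => IsBlock x κ Cleaf η b ∧ blockSons x κ Cleaf η b = ∅ ∧
    Admissible η (bbox x b.1) (bbox x b.2)

open Classical in
/-- The near field: the inadmissible leaves of the block-cluster tree. -/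
noncomputable def near {d N : ℕ} (x : Fin N → Pt d) (κ : Finset (Fin N) → Fin d) (Cleaf : ℕ)
    (η : ℝ) : Finset (Finset (Fin N) × Finset (Fin N)) :=
  Finset.univ.filter fun b => IsBlock x κ Cleaf η b ∧ blockSons x κ Cleaf η b = ∅ ∧
    ¬ Admissible η (bbox x b.1) (bbox x b.2)

/-! ### Tensor Chebyshev interpolation -/

/-- The Chebyshev nodes in `[-1, 1]`: the `p` zeros of the `p`-th Chebyshev polynomial. -/
noncomputable def chebNode (p : ℕ) (k : Fin p) : ℝ :=
  Real.cos ((2 * (k : ℝ) + 1) * Real.pi / (2 * p))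

/-- The one-dimensional Lagrange basis functions for the Chebyshev nodes in `[-1, 1]`. -/
noncomputable def chebBasis (p : ℕ) (k : Fin p) (t : ℝ) : ℝ :=
  (Lagrange.basis Finset.univ (chebNode p) k).eval t

/-- The transformed tensor Chebyshev nodes in a box; the `p ^ d` nodes are indexed
by `Fin d → Fin p`. -/
noncomputable def boxNode {d p : ℕ} (B : Box d) (n : Fin d → Fin p) : Pt d :=
  WithLp.toLp 2 fun k => (B.lo k + B.hi k) / 2 + B.edge k / 2 * chebNode p (n k)

/-- The tensor Lagrange basis functions for `boxNode`, as pull-backs of the basis functions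
on `[-1, 1]`. In a direction where the box has an edge of length zero, all nodes have the same
coordinate, and that edge is mapped to `0 ∈ [-1, 1]` (this is the value of the quotient below); since
the basis functions on `[-1, 1]` sum to one, interpolation in that direction is
then evaluation at the only coordinate value in the box. -/
noncomputable def boxBasis {d p : ℕ} (B : Box d) (n : Fin d → Fin p) (y : Pt d) : ℝ :=
  ∏ k, chebBasis p (n k) ((2 * y k - B.lo k - B.hi k) / B.edge k)

/-- The cluster basis `V^X`. -/
noncomputable def clusterBasis {d N : ℕ} (x : Fin N → Pt d) (p : ℕ) (X : Finset (Fin N))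
    (i : Fin N) (n : Fin d → Fin p) : ℝ :=
  boxBasis (bbox x X) n (x i)

/-- The transfer matrix `T^{X'X}`. -/
noncomputable def transferMatrix {d N : ℕ} (x : Fin N → Pt d) (p : ℕ) (X' X : Finset (Fin N)) :
    Matrix (Fin d → Fin p) (Fin d → Fin p) ℝ :=
  Matrix.of fun m n => boxBasis (bbox x X) n (boxNode (bbox x X') m)

/-- The coupling matrix `M^{XY}`. -/
noncomputable def couplingMatrix {d N : ℕ} (x : Fin N → Pt d) (ρ : Pt d → Pt d → ℝ) (p : ℕ)
    (X Y : Finset (Fin N)) : Matrix (Fin d → Fin p) (Fin d → Fin p) ℝ :=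
  Matrix.of fun n m => ρ (boxNode (bbox x X) n) (boxNode (bbox x Y) m)

/-! ### The covariance matrix and the `H²`-matrix -/

/-- The covariance matrix `C`. -/
def covMatrix {d N : ℕ} (x : Fin N → Pt d) (ρ : Pt d → Pt d → ℝ) : Matrix (Fin N) (Fin N) ℝ :=
  Matrix.of fun i j => ρ (x i) (x j)

/-- The `H²`-matrix `C_p`: it is `V^X M^{XY} (V^Y)ᵀ` on the far-field blocks and agrees with `C` on the
near-field blocks. Each pair of indices lies in exactly one of these blocks. -/
noncomputable def h2Matrix {d N : ℕ} (x : Fin N → Pt d) (κ : Finset (Fin N) → Fin d) (Cleaf : ℕ)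
    (η : ℝ) (ρ : Pt d → Pt d → ℝ) (p : ℕ) : Matrix (Fin N) (Fin N) ℝ :=
  Matrix.of fun i j =>
    (∑ b ∈ far x κ Cleaf η, if i ∈ b.1 ∧ j ∈ b.2 then
      ∑ n : Fin d → Fin p, ∑ m : Fin d → Fin p,
        clusterBasis x p b.1 i n * couplingMatrix x ρ p b.1 b.2 n m * clusterBasis x p b.2 j m
      else 0) +
    ∑ b ∈ near x κ Cleaf η, if i ∈ b.1 ∧ j ∈ b.2 then ρ (x i) (x j) else 0

/-- The Frobenius norm. -/
noncomputable def frobNorm {N : ℕ} (A : Matrix (Fin N) (Fin N) ℝ) : ℝ :=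
  Real.sqrt (∑ i, ∑ j, |A i j| ^ 2)

/-- The spectral norm. -/
noncomputable def specNorm {N : ℕ} (A : Matrix (Fin N) (Fin N) ℝ) : ℝ :=
  ‖Matrix.toEuclideanCLM (𝕜 := ℝ) A‖

/-- The minimal eigenvalue of a symmetric matrix, as the infimum of the Rayleigh quotient. -/
noncomputable def lambdaMin {N : ℕ} (A : Matrix (Fin N) (Fin N) ℝ) : ℝ :=
  ⨅ z : {z : Fin N → ℝ // z ≠ 0}, ((A *ᵥ z.1) ⬝ᵥ z.1) / (z.1 ⬝ᵥ z.1)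

/-! ### Storage -/

/-- The memory units that hold the `H²`-matrix, one real number each: the entries of `V^X` for the
leaves `X` of the cluster tree, of the transfer matrices between clusters and their sons, of
the coupling matrices of the far-field blocks, and of the near-field blocks of `C`. -/
inductive MemUnit {d N : ℕ} (x : Fin N → Pt d) (κ : Finset (Fin N) → Fin d) (Cleaf : ℕ) (η : ℝ)
    (p : ℕ) : Type
  | leaf (X : Finset (Fin N)) (hX : IsCluster x κ Cleaf X) (hl : sons x κ Cleaf X = ∅)
      (i : Fin N) (hi : i ∈ X) (n : Fin d → Fin p) : MemUnit x κ Cleaf η p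
  | transfer (X X' : Finset (Fin N)) (hX : IsCluster x κ Cleaf X) (hs : X' ∈ sons x κ Cleaf X)
      (m n : Fin d → Fin p) : MemUnit x κ Cleaf η p
  | coupling (X Y : Finset (Fin N)) (hf : (X, Y) ∈ far x κ Cleaf η)
      (n m : Fin d → Fin p) : MemUnit x κ Cleaf η p
  | nearfield (X Y : Finset (Fin N)) (hn : (X, Y) ∈ near x κ Cleaf η)
      (i j : Fin N) (hi : i ∈ X) (hj : j ∈ Y) : MemUnit x κ Cleaf η p

/-- The numbers that are stored in the memory units. -/
noncomputable def memory {d N : ℕ} (x : Fin N → Pt d) (κ : Finset (Fin N) → Fin d) (Cleaf : ℕ)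
    (η : ℝ) (ρ : Pt d → Pt d → ℝ) (p : ℕ) : MemUnit x κ Cleaf η p → ℝ
  | .leaf X _ _ i _ n => clusterBasis x p X i n
  | .transfer X X' _ _ m n => transferMatrix x p X' X m n
  | .coupling X Y _ n m => couplingMatrix x ρ p X Y n m
  | .nearfield _ _ _ i j _ _ => covMatrix x ρ i j

/-- There are finitely many memory units. -/
instance {d N : ℕ} (x : Fin N → Pt d) (κ : Finset (Fin N) → Fin d) (Cleaf : ℕ) (η : ℝ) (p : ℕ) :
    Finite (MemUnit x κ Cleaf η p) := by
  let f : MemUnit x κ Cleaf η p →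
      (Finset (Fin N) × Fin N × (Fin d → Fin p)) ⊕
      (Finset (Fin N) × Finset (Fin N) × (Fin d → Fin p) × (Fin d → Fin p)) ⊕
      (Finset (Fin N) × Finset (Fin N) × (Fin d → Fin p) × (Fin d → Fin p)) ⊕
      (Finset (Fin N) × Finset (Fin N) × Fin N × Fin N) := fun u => match u with
    | .leaf X _ _ i _ n => Sum.inl (X, i, n)
    | .transfer X X' _ _ m n => Sum.inr (Sum.inl (X, X', m, n))
    | .coupling X Y _ n m => Sum.inr (Sum.inr (Sum.inl (X, Y, n, m)))
    | .nearfield X Y _ i j _ _ => Sum.inr (Sum.inr (Sum.inr (X, Y, i, j)))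
  refine Finite.of_injective f ?_
  intro u v h
  cases u <;> cases v <;> simp_all [f]

/-- The number of memory units that the `H²`-matrix needs. -/
noncomputable def storage {d N : ℕ} (x : Fin N → Pt d) (κ : Finset (Fin N) → Fin d) (Cleaf : ℕ)
    (η : ℝ) (p : ℕ) : ℕ := Nat.card (MemUnit x κ Cleaf η p)

/-! ### Straight-line arithmetic programs -/

/-- The arithmetic operations. -/
inductive ArithOp : Type
  | add
  | sub
  | mul

/-- The value of an arithmetic operation. -/
def ArithOp.eval : ArithOp → ℝ → ℝ → ℝ
  | .add, a, b => a + b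
  | .sub, a, b => a - b
  | .mul, a, b => a * b

/-- An operand: an input, or the result of the operation number `k` (counted from `0`). -/
inductive Operand (ι : Type) : Type
  | input (a : ι)
  | result (k : ℕ)

/-- The value of an operand, given the inputs and the list of the results computed so far;
results that are not yet available read as zero. -/
def Operand.val {ι : Type} (inp : ι → ℝ) (res : List ℝ) : Operand ι → ℝ
  | .input a => inp a
  | .result k => res.getD k 0

/-- A single arithmetic operation on two operands. -/
structure Instr (ι : Type) where
  op : ArithOp
  fst : Operand ι
  snd : Operand ι

/-- A straight-line arithmetic program with inputs indexed by `ι` and outputs indexed by `o`. It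
contains no real constants: all numbers that it uses come from its inputs. -/
structure Program (ι o : Type) where
  code : List (Instr ι)
  out : o → Operand ι

/-- The results of all operations, in the order of execution. -/
def execute {ι : Type} (inp : ι → ℝ) (code : List (Instr ι)) : List ℝ :=
  code.foldl (fun res c => res ++ [c.op.eval (c.fst.val inp res) (c.snd.val inp res)]) []

/-- The output vector of a program. -/
def Program.run {ι o : Type} (P : Program ι o) (inp : ι → ℝ) : o → ℝ :=
  fun i => (P.out i).val inp (execute inp P.code)

/-- The number of arithmetic operations of a program. -/
def Program.cost {ι o : Type} (P : Program ι o) : ℕ := P.code.length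

end H2Matrix

open H2Matrix

/-! Accuracy. Near-field entries are exact, and every index pair lies in exactly one leaf block, so
only the interpolation error on far-field blocks counts. In one variable on `[-1, 1]` it is at most
`2 ^ (1 - p) / p!` times the sup of the `p`-th derivative, because the nodal polynomial is `2 ^ (1 -
p) T_p`. Along an edge of length `2h` of a box at distance `δ` from its partner, asymptotic
smoothness and `2h ≤ η δ` turn this into `2 c₁ (η / (4 c₂)) ^ p`. Interpolating the `2d` variables
one after the other multiplies the error by at most `2d - 1` Lebesgue constants, each of size `O(log
p + 1)`. The bound is uniform over the entries, and the Frobenius norm contributes the factor `N`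
(`sum_abs_chebBasis_le`, `AsympSmooth.abs_sub_boxInterp_le`, `frobNorm_covMatrix_sub_h2Matrix_le`).

Counting. Storage and work are bounded by the numbers of clusters and of blocks, and far-field
blocks are (apart from the root) sons of inadmissible blocks. It remains to show that there are
`O(N)` clusters and `O(N)` inadmissible blocks. Points have separation `s` of order `N ^ (-1/d)` in
a region of extent `A`, so `(A / s) ^ d` is of order `N`. Bounding boxes may be flat and have no
volume. Each cluster is therefore given a cell, cut along with the tree but not shrunk to the
points: all sides of a cell have at least half the length of the longest edge of the bounding box,
and cells of unrelated clusters have disjoint interiors. This gives the packing estimate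
`Geometry.sum_len_pow_le`. Clusters are sorted by dyadic size, not by depth, since sizes may vary
strongly within a level. In an inadmissible block both clusters lie within a multiple of the larger
size `L`. The larger cluster is either a leaf, and the leaves together satisfy the packing estimate,
or at least as deep as the other one; then the smaller cluster has few possible levels, because `d`
bisections halve the size (`Geometry.card_leafPairs_le`, `Geometry.card_levelPairs_le`).

Matrix-vector product. Interpolation reproduces polynomials, so the cluster bases are nested.
Coefficients of `z` are collected from the leaves upwards, multiplied by the coupling matrices and
distributed downwards; these steps and the near field make up a straight-line program
(`exists_program`).

Positive definiteness. By Cauchy-Schwarz the Rayleigh quotients of `C` and `C_p` differ by at most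
the Frobenius error. -/

namespace H2Matrix

/-! ### One-dimensional Chebyshev interpolation -/

/-- The angle of a Chebyshev node. -/
noncomputable def chebAngle (p : ℕ) (k : Fin p) : ℝ :=
  (2 * (k : ℝ) + 1) * Real.pi / (2 * p)

lemma chebNode_eq_cos (p : ℕ) (k : Fin p) : chebNode p k = Real.cos (chebAngle p k) := rfl

lemma chebAngle_mem (p : ℕ) (k : Fin p) :
    chebAngle p k ∈ Set.Ioo 0 Real.pi := by
  have hp : (0 : ℝ) < p := by exact_mod_cast k.pos
  have hk : (k : ℝ) + 1 ≤ p := by exact_mod_cast k.isLt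
  have := Real.pi_pos
  constructor
  · unfold chebAngle; positivity
  · unfold chebAngle
    rw [div_lt_iff₀ (by positivity)]
    nlinarith

lemma chebNode_injective (p : ℕ) : Function.Injective (chebNode p) := by
  intro a b hab
  have h := Real.injOn_cos (Set.Ioo_subset_Icc_self (chebAngle_mem p a))
    (Set.Ioo_subset_Icc_self (chebAngle_mem p b)) hab
  have hp : (0 : ℝ) < p := by exact_mod_cast a.pos
  have := Real.pi_pos
  unfold chebAngle at h
  have h2 : (a : ℝ) = b := by
    field_simp at h
    linarith
  exact Fin.ext (by exact_mod_cast h2)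

lemma chebNode_mem (p : ℕ) (k : Fin p) : chebNode p k ∈ Set.Icc (-1 : ℝ) 1 :=
  ⟨Real.neg_one_le_cos _, Real.cos_le_one _⟩

-- The nodes are all the roots of `T_p`, so `T_p` is its leading coefficient times the nodal
-- polynomial. For `p = 0` the truncated exponent gives the correct leading coefficient `1`.
open Polynomial in
lemma two_pow_mul_nodal_chebNode (p : ℕ) :
    C ((2 : ℝ) ^ (p - 1)) * Lagrange.nodal Finset.univ (chebNode p) = Chebyshev.T ℝ p := by
  have hr : (Chebyshev.T ℝ (p : ℤ)).roots = Finset.univ.val.map (chebNode p) := by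
    rw [Chebyshev.roots_T_real]
    have : (Finset.range p).image (fun k : ℕ => Real.cos ((2 * k + 1) * Real.pi / (2 * p))) =
        Finset.univ.map ⟨chebNode p, chebNode_injective p⟩ := by
      ext y
      simp only [Finset.mem_image, Finset.mem_range, Finset.mem_map, Finset.mem_univ, true_and,
        Function.Embedding.coeFn_mk]
      constructor
      · rintro ⟨k, hk, rfl⟩
        exact ⟨⟨k, hk⟩, rfl⟩
      · rintro ⟨k, rfl⟩
        exact ⟨k, k.isLt, rfl⟩
    rw [this]; rfl
  have h := C_leadingCoeff_mul_prod_multiset_X_sub_C (p := Chebyshev.T ℝ (p : ℤ)) (by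
    rw [hr]; simp)
  rw [hr, Chebyshev.leadingCoeff_T, Multiset.map_map] at h
  exact h

open Polynomial in
lemma abs_eval_nodal_chebNode_le {p : ℕ} {t : ℝ} (ht : t ∈ Set.Icc (-1 : ℝ) 1) :
    |eval t (Lagrange.nodal Finset.univ (chebNode p))| ≤ ((2 : ℝ) ^ (p - 1))⁻¹ := by
  have h := congrArg (eval t) (two_pow_mul_nodal_chebNode p)
  rw [eval_mul, eval_C] at h
  have h2 := Chebyshev.abs_eval_T_real_le_one p (abs_le.2 ht)
  rw [← h, abs_mul, abs_of_pos (by positivity : (0 : ℝ) < 2 ^ (p - 1))] at h2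
  rw [← one_div, le_div_iff₀ (by positivity)]
  linarith

lemma cos_mul_chebAngle (p : ℕ) (k : Fin p) : Real.cos (p * chebAngle p k) = 0 := by
  have hp : (p : ℝ) ≠ 0 := by exact_mod_cast k.pos.ne'
  rw [Real.cos_eq_zero_iff]
  refine ⟨k, ?_⟩
  unfold chebAngle
  push_cast
  field_simp

-- From `T_p' = p U_{p-1}` and `sin θ * U_{p-1}(cos θ) = sin (p θ)`, which is `±1` at a node because
-- `cos (p θ)` vanishes there. This is the denominator of the Lagrange basis functions.
open Polynomial in
lemma abs_eval_derivative_nodal (p : ℕ) (k : Fin p) :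
    2 ^ (p - 1) * |eval (chebNode p k) (derivative (Lagrange.nodal Finset.univ (chebNode p)))| *
      Real.sin (chebAngle p k) = p := by
  have h := congrArg (fun q => eval (chebNode p k) (derivative q)) (two_pow_mul_nodal_chebNode p)
  simp only [derivative_C_mul, eval_mul, eval_C] at h
  rw [Chebyshev.T_derivative_eq_U, eval_mul] at h
  have hs := Real.sin_pos_of_mem_Ioo (chebAngle_mem p k)
  have hU := Chebyshev.U_real_cos (chebAngle p k) (p - 1)
  have hc := cos_mul_chebAngle p k
  have hsq := Real.sin_sq_add_cos_sq (p * chebAngle p k)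
  rw [hc] at hsq
  have habs : |Real.sin (p * chebAngle p k)| = 1 := by
    rw [← sq_eq_sq₀ (abs_nonneg _) zero_le_one, sq_abs]; linarith
  rw [chebNode_eq_cos] at h ⊢
  push_cast at hU
  rw [sub_add_cancel] at hU
  rw [← abs_of_pos (show (0 : ℝ) < 2 ^ (p - 1) by positivity), ← abs_mul, h, abs_mul, mul_assoc,
    ← abs_of_pos hs, ← abs_mul, hU, habs]
  simp

/-- It cancels the factor `sin θ_k` of the Lagrange basis function against the factor `sin ((θ +
θ_k) / 2)` of `cos θ - cos θ_k`. With `m` and `δ` the half sum and half difference, `sin a * sin b =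
sin² m - sin² δ ≥ 0` gives `|sin δ| ≤ sin m`, and then `sin b = sin (m - δ)` is expanded. -/
lemma sin_le_two_mul_sin_half_add {a b : ℝ} (ha : a ∈ Set.Icc 0 Real.pi)
    (hb : b ∈ Set.Icc 0 Real.pi) : Real.sin b ≤ 2 * Real.sin ((a + b) / 2) := by
  have hs : 0 ≤ Real.sin ((a + b) / 2) :=
    Real.sin_nonneg_of_nonneg_of_le_pi (by linarith [ha.1, hb.1]) (by linarith [ha.2, hb.2])
  have e1 : b = (a + b) / 2 - (a - b) / 2 := by ring
  have hprod : 0 ≤ Real.sin a * Real.sin b :=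
    mul_nonneg (Real.sin_nonneg_of_nonneg_of_le_pi ha.1 ha.2)
      (Real.sin_nonneg_of_nonneg_of_le_pi hb.1 hb.2)
  have e2 : Real.sin a * Real.sin b =
      Real.sin ((a + b) / 2) ^ 2 - Real.sin ((a - b) / 2) ^ 2 := by
    have h1 : Real.sin a = Real.sin ((a + b) / 2 + (a - b) / 2) := by ring_nf
    have h2 : Real.sin b = Real.sin ((a + b) / 2 - (a - b) / 2) := by ring_nf
    rw [h1, h2, Real.sin_add, Real.sin_sub]
    have := Real.sin_sq_add_cos_sq ((a + b) / 2)
    have := Real.sin_sq_add_cos_sq ((a - b) / 2)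
    nlinarith
  have hd : |Real.sin ((a - b) / 2)| ≤ Real.sin ((a + b) / 2) := by
    apply abs_le_of_sq_le_sq _ hs
    linarith
  have h3 : Real.sin b = Real.sin ((a + b) / 2) * Real.cos ((a - b) / 2) -
      Real.cos ((a + b) / 2) * Real.sin ((a - b) / 2) := by
    rw [← Real.sin_sub]; ring_nf
  rw [h3]
  have h4 : Real.sin ((a + b) / 2) * Real.cos ((a - b) / 2) ≤ Real.sin ((a + b) / 2) :=
    mul_le_of_le_one_right hs (Real.cos_le_one _)
  have h5 : -(Real.cos ((a + b) / 2) * Real.sin ((a - b) / 2)) ≤ Real.sin ((a + b) / 2) := by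
    refine (neg_le_abs _).trans ?_
    rw [abs_mul]
    calc _ ≤ 1 * |Real.sin ((a - b) / 2)| :=
          mul_le_mul_of_nonneg_right (Real.abs_cos_le_one _) (abs_nonneg _)
      _ ≤ _ := by linarith
  linarith

open Polynomial in
/-- The Lagrange basis functions for Chebyshev nodes decay like the inverse angular distance. -/
lemma abs_chebBasis_mul_le {p : ℕ} (k : Fin p) {θ : ℝ} (hθ : θ ∈ Set.Icc 0 Real.pi) :
    |chebBasis p k (Real.cos θ)| * (p * |θ - chebAngle p k| / Real.pi) ≤
      |Real.cos (p * θ)| := by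
  have hk := chebAngle_mem p k
  have hk' := Set.Ioo_subset_Icc_self hk
  have hpi := Real.pi_pos
  have hp : (0 : ℝ) < p := by exact_mod_cast k.pos
  rcases eq_or_ne θ (chebAngle p k) with rfl | hne
  · simp
  have hne' : Real.cos θ ≠ chebNode p k := fun h => hne (Real.injOn_cos hθ hk' h)
  have hs : 0 < Real.sin ((θ + chebAngle p k) / 2) :=
    Real.sin_pos_of_pos_of_lt_pi (by linarith [hθ.1, hk.1]) (by linarith [hθ.2, hk.2])
  have hsk := Real.sin_pos_of_mem_Ioo hk
  have hd : 2 / Real.pi * |(θ - chebAngle p k) / 2| ≤ |Real.sin ((θ - chebAngle p k) / 2)| := by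
    apply Real.mul_abs_le_abs_sin
    rw [abs_le]
    constructor <;> linarith [hθ.1, hθ.2, hk.1, hk.2]
  have hN := congrArg (eval (Real.cos θ)) (two_pow_mul_nodal_chebNode p)
  rw [eval_mul, eval_C, Chebyshev.T_real_cos] at hN
  have hder := abs_eval_derivative_nodal p k
  have hL := Lagrange.eval_basis_not_at_node (s := Finset.univ) (v := chebNode p)
    (Finset.mem_univ k) hne'
  rw [Lagrange.nodalWeight_eq_eval_derivative_nodal (Finset.mem_univ k)] at hL
  have hcos : Real.cos θ - chebNode p k =
      -2 * Real.sin ((θ + chebAngle p k) / 2) * Real.sin ((θ - chebAngle p k) / 2) := by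
    rw [chebNode_eq_cos, Real.cos_sub_cos]
  set W := eval (chebNode p k) (derivative (Lagrange.nodal Finset.univ (chebNode p))) with hW
  set V := eval (Real.cos θ) (Lagrange.nodal Finset.univ (chebNode p)) with hV
  have hW0 : 0 < |W| := by
    rcases (abs_nonneg W).lt_or_eq with h | h
    · exact h
    · rw [← h] at hder; simp at hder; exact absurd hder.symm hp.ne'
  -- This is `L_k(t) = w(t) / (w'(t_k) (t - t_k))` for the nodal polynomial `w = 2 ^ (1 - p) T_p`;
  -- the powers of two cancel.
  have key : |chebBasis p k (Real.cos θ)| * (p * |Real.cos θ - chebNode p k|) =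
      |Real.cos (p * θ)| * Real.sin (chebAngle p k) := by
    have hx : |Real.cos θ - chebNode p k| ≠ 0 := abs_ne_zero.2 (sub_ne_zero.2 hne')
    have hN' : |Real.cos (p * θ)| = 2 ^ (p - 1) * |V| := by
      have : Real.cos (p * θ) = 2 ^ (p - 1) * V := by rw [hN]; norm_cast
      rw [this, abs_mul, abs_of_pos (by positivity : (0 : ℝ) < 2 ^ (p - 1))]
    rw [chebBasis, hL, abs_mul, abs_mul, abs_inv, abs_inv, hN', ← hder]
    field_simp
  rw [hcos, abs_mul, abs_mul, abs_of_pos hs] at key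
  norm_num at key
  have hle := sin_le_two_mul_sin_half_add hθ hk'
  set Lk := |chebBasis p k (Real.cos θ)| with hLk
  have h0 : 0 ≤ Lk := abs_nonneg _
  have h1 : Lk * (p * |Real.sin ((θ - chebAngle p k) / 2)|) ≤ |Real.cos (p * θ)| := by
    have : Lk * (p * |Real.sin ((θ - chebAngle p k) / 2)|) *
        (2 * Real.sin ((θ + chebAngle p k) / 2)) ≤
        |Real.cos (p * θ)| * (2 * Real.sin ((θ + chebAngle p k) / 2)) := by
      calc _ = |Real.cos (p * θ)| * Real.sin (chebAngle p k) := by rw [← key]; ring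
        _ ≤ _ := mul_le_mul_of_nonneg_left hle (abs_nonneg _)
    exact le_of_mul_le_mul_right this (by positivity)
  refine le_trans ?_ h1
  apply mul_le_mul_of_nonneg_left _ h0
  rw [mul_div_assoc]
  apply mul_le_mul_of_nonneg_left _ hp.le
  refine le_trans (le_of_eq ?_) hd
  rw [abs_div, abs_two]; ring

/-- This covers angles close to that of the node, where the decay estimate alone gives nothing:
there `|cos (p θ)| = |sin (p (θ - θ_k))| ≤ p |θ - θ_k|` compensates the small factor. -/
lemma abs_chebBasis_le_pi {p : ℕ} (k : Fin p) {θ : ℝ} (hθ : θ ∈ Set.Icc 0 Real.pi) :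
    |chebBasis p k (Real.cos θ)| ≤ Real.pi := by
  have hp : (0 : ℝ) < p := by exact_mod_cast k.pos
  rcases eq_or_ne θ (chebAngle p k) with rfl | hne
  · rw [chebBasis, ← chebNode_eq_cos,
      Lagrange.eval_basis_self (chebNode_injective p).injOn (Finset.mem_univ k), abs_one]
    linarith [Real.pi_gt_three]
  have h := abs_chebBasis_mul_le k hθ
  have h2 : |Real.cos (p * θ)| ≤ p * |θ - chebAngle p k| := by
    have hc := cos_mul_chebAngle p k
    have : Real.cos (p * θ) = -Real.sin (p * (θ - chebAngle p k)) *
        Real.sin (p * chebAngle p k) := by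
      have e : (p : ℝ) * θ = p * (θ - chebAngle p k) + p * chebAngle p k := by ring
      rw [e, Real.cos_add, hc]; ring
    rw [this, abs_mul, abs_neg]
    calc _ ≤ |p * (θ - chebAngle p k)| * 1 := by
          apply mul_le_mul _ (Real.abs_sin_le_one _) (abs_nonneg _) (abs_nonneg _)
          exact Real.abs_sin_le_abs
      _ = _ := by rw [mul_one, abs_mul, abs_of_pos hp]
  have hpos : 0 < p * |θ - chebAngle p k| :=
    mul_pos hp (abs_pos.2 (sub_ne_zero.2 hne))
  have h3 := h.trans h2
  rw [mul_div_assoc', div_le_iff₀ Real.pi_pos, mul_comm _ Real.pi] at h3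
  exact le_of_mul_le_mul_right h3 hpos

/-- On either side of `M` the terms are reciprocals of distinct positive integers, so both sides are
bounded by the harmonic sum. -/
lemma sum_inv_one_add_dist_le {p M : ℕ} (hM : M < p) :
    ∑ k ∈ Finset.range p, (1 : ℝ) / (1 + |(k : ℝ) - M|) ≤ 2 * (1 + Real.log p) := by
  have hH : ∀ q ≤ p, ∑ k ∈ Finset.range q, (1 : ℝ) / (1 + k) ≤ 1 + Real.log p := by
    intro q hq
    have h := harmonic_le_one_add_log p
    rw [harmonic] at h
    push_cast at h
    refine le_trans ?_ h
    refine (Finset.sum_le_sum_of_subset_of_nonneg (Finset.range_mono hq)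
      (fun _ _ _ => by positivity)).trans (le_of_eq ?_)
    refine Finset.sum_congr rfl fun k _ => ?_
    rw [one_div, add_comm]
  have h1 : ∑ k ∈ Finset.range (M + 1), (1 : ℝ) / (1 + |(k : ℝ) - M|) ≤ 1 + Real.log p := by
    rw [← Finset.sum_range_reflect]
    refine le_trans (le_of_eq ?_) (hH (M + 1) hM)
    refine Finset.sum_congr rfl fun k hk => ?_
    have hk' : k ≤ M := Nat.lt_succ_iff.1 (Finset.mem_range.1 hk)
    have : ((M + 1 - 1 - k : ℕ) : ℝ) = M - k := by
      rw [Nat.add_sub_cancel, Nat.cast_sub hk']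
    rw [this]
    congr 2
    rw [show (M : ℝ) - k - M = -k by ring, abs_neg, abs_of_nonneg (by positivity)]
  have h2 : ∑ k ∈ Finset.Ico (M + 1) p, (1 : ℝ) / (1 + |(k : ℝ) - M|) ≤ 1 + Real.log p := by
    rw [Finset.sum_Ico_eq_sum_range]
    refine le_trans (Finset.sum_le_sum fun k _ => ?_) (hH (p - (M + 1)) (Nat.sub_le _ _))
    have : ((M + 1 + k : ℕ) : ℝ) - M = k + 1 := by push_cast; ring
    rw [this, abs_of_nonneg (by positivity)]
    apply one_div_le_one_div_of_le (by positivity)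
    linarith
  rw [← Finset.sum_range_add_sum_Ico _ (show M + 1 ≤ p from hM)]
  linarith

/-- The Lebesgue constant of Chebyshev interpolation grows logarithmically. -/
lemma sum_abs_chebBasis_le {p : ℕ} (hp : 1 ≤ p) {t : ℝ} (ht : t ∈ Set.Icc (-1 : ℝ) 1) :
    ∑ k, |chebBasis p k t| ≤ 20 * (Real.log p + 1) := by
  have hpp : (0 : ℝ) < p := by exact_mod_cast hp
  have hpi := Real.pi_pos
  obtain ⟨θ, hθ, rfl⟩ : ∃ θ ∈ Set.Icc 0 Real.pi, Real.cos θ = t :=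
    ⟨Real.arccos t, ⟨Real.arccos_nonneg _, Real.arccos_le_pi _⟩, Real.cos_arccos ht.1 ht.2⟩
  -- In this rescaled angle the node number `k` sits at `k`.
  set τ : ℝ := p * θ / Real.pi - 1 / 2 with hτ
  have hτp : τ < p := by
    have : p * θ / Real.pi ≤ p := by
      rw [div_le_iff₀ hpi]; exact mul_le_mul_of_nonneg_left hθ.2 hpp.le
    linarith
  have hM : ⌊τ⌋₊ < p := by
    rw [Nat.floor_lt' (by omega)]; exact hτp
  have hlt := Nat.lt_floor_add_one τ
  set M := ⌊τ⌋₊ with hMdef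
  -- With `a ≤ π < 4` and `a |τ - k| ≤ 1`, replacing `τ` by its integer part costs at most one unit
  -- of distance, so `a (1 + |k - M|) ≤ 2a + 1 < 10`. The truncation of the floor at `0` is harmless
  -- because `k < M` forces `τ > 0`.
  have hb : ∀ k : Fin p, |chebBasis p k (Real.cos θ)| ≤ 10 * (1 / (1 + |((k : ℕ) : ℝ) - M|)) := by
    intro k
    have h1 := abs_chebBasis_le_pi k hθ
    have h2 := (abs_chebBasis_mul_le k hθ).trans (Real.abs_cos_le_one _)
    have e : p * |θ - chebAngle p k| / Real.pi = |τ - k| := by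
      have : τ - k = p * (θ - chebAngle p k) / Real.pi := by
        rw [hτ]; unfold chebAngle; field_simp; ring
      rw [this, abs_div, abs_mul, abs_of_pos hpp, abs_of_pos hpi]
    rw [e] at h2
    have h4 := Real.pi_lt_four
    set a := |chebBasis p k (Real.cos θ)|
    have ha : 0 ≤ a := abs_nonneg _
    rw [mul_one_div, le_div_iff₀ (by positivity)]
    rcases lt_trichotomy (k : ℕ) M with hk | hk | hk
    · have hMτ : (M : ℝ) ≤ τ := by
        apply Nat.floor_le
        by_contra hneg
        have : M = 0 := Nat.floor_of_nonpos (not_le.1 hneg).le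
        omega
      have hk' : ((k : ℕ) : ℝ) + 1 ≤ M := by exact_mod_cast hk
      rw [abs_of_nonneg (by linarith)] at h2
      rw [abs_of_nonpos (by linarith)]
      nlinarith
    · rw [hk]; simp; linarith
    · have hk' : (M : ℝ) + 1 ≤ ((k : ℕ) : ℝ) := by exact_mod_cast hk
      rw [abs_of_nonpos (by linarith)] at h2
      rw [abs_of_nonneg (by linarith)]
      nlinarith
  calc ∑ k, |chebBasis p k (Real.cos θ)|
      ≤ ∑ k : Fin p, 10 * (1 / (1 + |((k : ℕ) : ℝ) - M|)) := Finset.sum_le_sum fun k _ => hb k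
    _ = 10 * ∑ k ∈ Finset.range p, (1 : ℝ) / (1 + |(k : ℝ) - M|) := by
        rw [← Finset.mul_sum, Finset.sum_range]
    _ ≤ 10 * (2 * (1 + Real.log p)) := by
        apply mul_le_mul_of_nonneg_left (sum_inv_one_add_dist_le hM) (by norm_num)
    _ = _ := by ring

lemma sum_chebBasis_mul_eval {p : ℕ} {q : Polynomial ℝ} (hq : q.degree < p) (t : ℝ) :
    ∑ k, chebBasis p k t * q.eval (chebNode p k) = q.eval t := by
  have h := Lagrange.eq_interpolate (s := Finset.univ) (v := chebNode p) (f := q)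
    (chebNode_injective p).injOn (by simpa using hq)
  have h2 := congrArg (Polynomial.eval t) h
  rw [Lagrange.interpolate_apply, Polynomial.eval_finsetSum] at h2
  rw [h2]
  refine Finset.sum_congr rfl fun k _ => ?_
  rw [Polynomial.eval_mul, Polynomial.eval_C, chebBasis, mul_comm]

lemma sum_chebBasis {p : ℕ} (hp : 1 ≤ p) (t : ℝ) : ∑ k, chebBasis p k t = 1 := by
  have h := sum_chebBasis_mul_eval (p := p) (q := 1)
    (by rw [Polynomial.degree_one]; exact_mod_cast hp) t
  simpa using h

/-! ### The interpolation error -/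

/-- Rolle's theorem for `p + 1` zeros; `f n` is the `n`-th derivative. -/
lemma exists_zero_iterated_deriv {a b : ℝ} (p : ℕ) : ∀ (f : ℕ → ℝ → ℝ) (z : Fin (p + 1) → ℝ),
    (∀ n, ∀ s ∈ Set.Icc a b, HasDerivAt (f n) (f (n + 1) s) s) →
    StrictMono z → (∀ i, z i ∈ Set.Icc a b) → (∀ i, f 0 (z i) = 0) →
    ∃ ξ ∈ Set.Icc a b, f p ξ = 0 := by
  induction p with
  | zero => intro f z _ _ hz h0; exact ⟨z 0, hz 0, h0 0⟩
  | succ p ih =>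
    intro f z hf hmono hz h0
    have hR : ∀ i : Fin (p + 1), ∃ c ∈ Set.Ioo (z i.castSucc) (z i.succ), f 1 c = 0 := by
      intro i
      have hlt : z i.castSucc < z i.succ := hmono i.castSucc_lt_succ
      have hsub : Set.Icc (z i.castSucc) (z i.succ) ⊆ Set.Icc a b :=
        Set.Icc_subset_Icc (hz _).1 (hz _).2
      exact exists_hasDerivAt_eq_zero hlt
        (fun s hs => (hf 0 s (hsub hs)).continuousAt.continuousWithinAt)
        (by rw [h0, h0]) (fun s hs => hf 0 s (hsub (Set.Ioo_subset_Icc_self hs)))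
    choose c hc hc0 using hR
    refine ih (fun n => f (n + 1)) c (fun n s hs => hf (n + 1) s hs) ?_ ?_ hc0
    · rw [Fin.strictMono_iff_lt_succ]
      intro i
      have h1 := (hc i.castSucc).2
      have h2 := (hc i.succ).1
      rw [Fin.succ_castSucc] at h1
      exact h1.trans h2
    · intro i
      exact ⟨(hz _).1.trans (hc i).1.le, (hc i).2.le.trans (hz _).2⟩

open Polynomial in
/-- The error of Chebyshev interpolation in `[-1, 1]`. -/
lemma abs_sub_chebInterp_le {p : ℕ} (f : ℕ → ℝ → ℝ) {M : ℝ}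
    (hf : ∀ n, ∀ s ∈ Set.Icc (-1 : ℝ) 1, HasDerivAt (f n) (f (n + 1) s) s)
    (hM : ∀ s ∈ Set.Icc (-1 : ℝ) 1, |f p s| ≤ M) {t : ℝ} (ht : t ∈ Set.Icc (-1 : ℝ) 1) :
    |f 0 t - ∑ k, chebBasis p k t * f 0 (chebNode p k)| ≤
      M / p.factorial * ((2 : ℝ) ^ (p - 1))⁻¹ := by
  classical
  have hM0 : 0 ≤ M := (abs_nonneg _).trans (hM t ht)
  by_cases hnode : ∃ k, t = chebNode p k
  · obtain ⟨k, rfl⟩ := hnode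
    have : ∑ j, chebBasis p j (chebNode p k) * f 0 (chebNode p j) = f 0 (chebNode p k) := by
      rw [Finset.sum_eq_single k]
      · rw [chebBasis, Lagrange.eval_basis_self (chebNode_injective p).injOn (Finset.mem_univ k),
          one_mul]
      · intro j _ hj
        rw [chebBasis, Lagrange.eval_basis_of_ne hj (Finset.mem_univ k), zero_mul]
      · simp
    rw [this, sub_self, abs_zero]
    positivity
  push Not at hnode
  set w := Lagrange.nodal Finset.univ (chebNode p) with hw
  set q := Lagrange.interpolate Finset.univ (chebNode p) (fun k => f 0 (chebNode p k)) with hq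
  have hwt : eval t w ≠ 0 := Lagrange.eval_nodal_not_at_node (fun k _ => hnode k)
  have hqt : eval t q = ∑ k, chebBasis p k t * f 0 (chebNode p k) := by
    rw [hq, Lagrange.interpolate_apply, eval_finsetSum]
    refine Finset.sum_congr rfl fun k _ => ?_
    rw [eval_mul, eval_C, chebBasis, mul_comm]
  rw [← hqt]
  -- `K` is chosen such that `f - q - K w` vanishes at `t` too. It then has `p + 1` zeros, and
  -- Rolle's theorem yields `ξ` with `f^(p)(ξ) = K p!`, since `q` has degree below `p` and `w` is
  -- monic of degree `p`.
  set K := (f 0 t - eval t q) / eval t w with hK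
  set g : ℕ → ℝ → ℝ := fun n s => f n s - eval s (derivative^[n] (q + C K * w)) with hg
  have hgd : ∀ n, ∀ s ∈ Set.Icc (-1 : ℝ) 1, HasDerivAt (g n) (g (n + 1) s) s := by
    intro n s hs
    refine (hf n s hs).sub ?_
    rw [Function.iterate_succ_apply']
    exact Polynomial.hasDerivAt _ _
  have hinj := chebNode_injective p
  set Z : Finset ℝ := insert t (Finset.univ.image (chebNode p)) with hZ
  have hcard : Z.card = p + 1 := by
    rw [hZ, Finset.card_insert_of_notMem, Finset.card_image_of_injective _ hinj]
    · simp
    · simp only [Finset.mem_image, Finset.mem_univ, true_and, not_exists]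
      exact fun k h => hnode k h.symm
  have hZ0 : ∀ y ∈ Z, y ∈ Set.Icc (-1 : ℝ) 1 ∧ g 0 y = 0 := by
    intro y hy
    rcases Finset.mem_insert.1 hy with rfl | hy
    · refine ⟨ht, ?_⟩
      simp only [hg, Function.iterate_zero, id, eval_add, eval_mul, eval_C, hK]
      field_simp
      ring
    · obtain ⟨k, -, rfl⟩ := Finset.mem_image.1 hy
      refine ⟨chebNode_mem p k, ?_⟩
      simp only [hg, Function.iterate_zero, id, eval_add, eval_mul, eval_C]
      rw [hw, Lagrange.eval_nodal_at_node (Finset.mem_univ k), hq,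
        Lagrange.eval_interpolate_at_node _ hinj.injOn (Finset.mem_univ k)]
      ring
  obtain ⟨ξ, hξ, hξ0⟩ := exists_zero_iterated_deriv p g (Z.orderEmbOfFin hcard) hgd
    (Z.orderEmbOfFin hcard).strictMono
    (fun i => (hZ0 _ (Z.orderEmbOfFin_mem hcard i)).1)
    (fun i => (hZ0 _ (Z.orderEmbOfFin_mem hcard i)).2)
  have hdeg : q.degree < (p : ℕ) := by
    have := Lagrange.degree_interpolate_lt (s := Finset.univ) (v := chebNode p)
      (fun k => f 0 (chebNode p k)) hinj.injOn
    rw [← hq, Finset.card_univ, Fintype.card_fin] at this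
    exact this
  have hqp : derivative^[p] q = 0 := by
    by_cases hq0 : q = 0
    · rw [hq0]; simp
    · exact iterate_derivative_eq_zero ((natDegree_lt_iff_degree_lt hq0).2 hdeg)
  have hwp : derivative^[p] w = C (p.factorial : ℝ) := by
    have hdegw : w.natDegree = p := by rw [hw, Lagrange.natDegree_nodal]; simp
    have hle : (derivative^[p] w).natDegree ≤ 0 := by
      have := natDegree_iterate_derivative w p
      rwa [hdegw, Nat.sub_self] at this
    rw [eq_C_of_natDegree_le_zero hle, coeff_iterate_derivative, zero_add]
    have : w.coeff p = 1 := by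
      have h := Lagrange.nodal_monic (s := Finset.univ) (v := chebNode p)
      rw [Polynomial.Monic, leadingCoeff, ← hw, hdegw] at h
      exact h
    rw [this, Nat.descFactorial_self]
    simp
  have hfK : f p ξ = K * p.factorial := by
    simp only [hg] at hξ0
    rw [iterate_map_add, hqp, iterate_derivative_C_mul, hwp] at hξ0
    simp at hξ0
    linarith
  have hfac : (0 : ℝ) < p.factorial := by exact_mod_cast p.factorial_pos
  have hKb : |K| ≤ M / p.factorial := by
    rw [le_div_iff₀ hfac, ← abs_of_pos hfac, ← abs_mul, ← hfK]
    exact hM ξ hξ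
  have hfin : f 0 t - eval t q = K * eval t w := by
    rw [hK]; field_simp
  rw [hfin, abs_mul]
  exact mul_le_mul hKb (abs_eval_nodal_chebNode_le ht) (abs_nonneg _) (by positivity)

/-! ### Tensor Chebyshev interpolation -/

lemma sum_abs_prod_chebBasis_le {p d : ℕ} {Λ : ℝ}
    (hΛ : ∀ t ∈ Set.Icc (-1 : ℝ) 1, ∑ k : Fin p, |chebBasis p k t| ≤ Λ) {t : Fin d → ℝ}
    (ht : ∀ k, t k ∈ Set.Icc (-1 : ℝ) 1) :
    ∑ n : Fin d → Fin p, |∏ k, chebBasis p (n k) (t k)| ≤ Λ ^ d := by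
  calc ∑ n : Fin d → Fin p, |∏ k, chebBasis p (n k) (t k)|
      = ∏ k, ∑ m, |chebBasis p m (t k)| := by
        rw [Finset.prod_univ_sum, Fintype.piFinset_univ]
        simp_rw [Finset.abs_prod]
    _ ≤ ∏ _k : Fin d, Λ := Finset.prod_le_prod
        (fun _ _ => Finset.sum_nonneg fun _ _ => abs_nonneg _) (fun k _ => hΛ _ (ht k))
    _ = Λ ^ d := by simp

/-- Tensor interpolation error in terms of the one-dimensional errors. -/
lemma abs_sub_tensorInterp_le {p : ℕ} {Λ ε : ℝ}
    (hΛ : ∀ t ∈ Set.Icc (-1 : ℝ) 1, ∑ k : Fin p, |chebBasis p k t| ≤ Λ) :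
    ∀ (d : ℕ) (f : (Fin d → ℝ) → ℝ),
      (∀ (k : Fin d) (t : Fin d → ℝ), (∀ j, t j ∈ Set.Icc (-1 : ℝ) 1) →
        |f t - ∑ m, chebBasis p m (t k) * f (Function.update t k (chebNode p m))| ≤ ε) →
      ∀ t : Fin d → ℝ, (∀ j, t j ∈ Set.Icc (-1 : ℝ) 1) →
        |f t - ∑ n : Fin d → Fin p, (∏ k, chebBasis p (n k) (t k)) *
          f (fun k => chebNode p (n k))| ≤ (∑ r ∈ Finset.range d, Λ ^ r) * ε := by
  intro d
  induction d with
  | zero =>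
    intro f _ t _
    have : t = fun k => chebNode p ((default : Fin 0 → Fin p) k) := Subsingleton.elim _ _
    rw [Fintype.sum_unique, ← this]
    simp
  | succ d ih =>
    intro f hf t ht
    set t' : Fin d → ℝ := fun k => t k.succ with ht'
    have htc : t = Fin.cons (t 0) t' := (Fin.cons_self_tail t).symm
    have hcube' : ∀ j, t' j ∈ Set.Icc (-1 : ℝ) 1 := fun j => ht _
    have h0 := hf 0 t ht
    have hstep : ∀ m : Fin p, |f (Fin.cons (chebNode p m) t') -
        ∑ n : Fin d → Fin p, (∏ k, chebBasis p (n k) (t' k)) *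
          f (Fin.cons (chebNode p m) (fun k => chebNode p (n k)))| ≤
        (∑ r ∈ Finset.range d, Λ ^ r) * ε := by
      intro m
      refine ih (fun u => f (Fin.cons (chebNode p m) u)) (fun k u hu => ?_) t' hcube'
      have h := hf k.succ (Fin.cons (chebNode p m) u) (fun j => by
        refine Fin.cases ?_ (fun i => ?_) j
        · exact chebNode_mem p m
        · exact hu i)
      simpa only [Fin.cons_succ, ← Fin.cons_update] using h
    have hsum : ∑ n : Fin (d + 1) → Fin p, (∏ k, chebBasis p (n k) (t k)) *
          f (fun k => chebNode p (n k)) =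
        ∑ m, chebBasis p m (t 0) * ∑ n : Fin d → Fin p, (∏ k, chebBasis p (n k) (t' k)) *
          f (Fin.cons (chebNode p m) (fun k => chebNode p (n k))) := by
      rw [← (Fin.consEquiv fun _ : Fin (d + 1) => Fin p).sum_comp, Fintype.sum_prod_type]
      refine Finset.sum_congr rfl fun m _ => ?_
      rw [Finset.mul_sum]
      refine Finset.sum_congr rfl fun n _ => ?_
      rw [Fin.prod_univ_succ]
      have : (fun k => chebNode p ((Fin.consEquiv fun _ : Fin (d + 1) => Fin p) (m, n) k)) =
          Fin.cons (chebNode p m) (fun k => chebNode p (n k)) := by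
        ext k
        refine Fin.cases ?_ (fun i => ?_) k <;> simp [Fin.consEquiv]
      rw [this]
      simp [Fin.consEquiv, ht', mul_assoc]
    have hupd : ∀ m, Function.update t 0 (chebNode p m) = Fin.cons (chebNode p m) t' := by
      intro m
      rw [htc, Fin.update_cons_zero]
    simp only [hupd] at h0
    rw [hsum]
    -- The first coordinate is interpolated first. The error in the other coordinates is then
    -- averaged with weights of absolute sum at most `Λ`, whence the recursion `1 + Λ (1 + Λ + …)`.
    have hsplit : f t - ∑ m, chebBasis p m (t 0) * ∑ n : Fin d → Fin p,
          (∏ k, chebBasis p (n k) (t' k)) *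
          f (Fin.cons (chebNode p m) (fun k => chebNode p (n k))) =
        (f t - ∑ m, chebBasis p m (t 0) * f (Fin.cons (chebNode p m) t')) +
        ∑ m, chebBasis p m (t 0) * (f (Fin.cons (chebNode p m) t') -
          ∑ n : Fin d → Fin p, (∏ k, chebBasis p (n k) (t' k)) *
          f (Fin.cons (chebNode p m) (fun k => chebNode p (n k)))) := by
      simp_rw [mul_sub]
      rw [Finset.sum_sub_distrib]; ring
    rw [hsplit]
    have hε : 0 ≤ (∑ r ∈ Finset.range d, Λ ^ r) * ε := by
      rcases isEmpty_or_nonempty (Fin p) with he | ⟨⟨m⟩⟩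
      · have hΛ0 : 0 ≤ Λ := (Finset.sum_nonneg fun _ _ => abs_nonneg _).trans (hΛ _ (ht 0))
        have : 0 ≤ ε := (abs_nonneg _).trans h0
        positivity
      · exact (abs_nonneg _).trans (hstep m)
    have h2 : |∑ m, chebBasis p m (t 0) * (f (Fin.cons (chebNode p m) t') -
          ∑ n : Fin d → Fin p, (∏ k, chebBasis p (n k) (t' k)) *
          f (Fin.cons (chebNode p m) (fun k => chebNode p (n k))))| ≤
        Λ * ((∑ r ∈ Finset.range d, Λ ^ r) * ε) := by
      refine (Finset.abs_sum_le_sum_abs _ _).trans ?_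
      simp_rw [abs_mul]
      refine (Finset.sum_le_sum fun m _ =>
        mul_le_mul_of_nonneg_left (hstep m) (abs_nonneg _)).trans ?_
      rw [← Finset.sum_mul]
      exact mul_le_mul_of_nonneg_right (hΛ _ (ht 0)) hε
    refine (abs_add_le _ _).trans ((add_le_add h0 h2).trans (le_of_eq ?_))
    rw [geom_sum_succ]
    ring

/-! ### Affine coordinates of a box -/

/-- The reference coordinates of a point with respect to a box. -/
noncomputable def boxCoord {d : ℕ} (B : Box d) (y : Pt d) (k : Fin d) : ℝ :=
  (2 * y k - B.lo k - B.hi k) / B.edge k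

/-- The point of a box with given reference coordinates. -/
noncomputable def boxPoint {d : ℕ} (B : Box d) (t : Fin d → ℝ) : Pt d :=
  WithLp.toLp 2 fun k => (B.lo k + B.hi k) / 2 + B.edge k / 2 * t k

lemma boxBasis_eq_prod {d p : ℕ} (B : Box d) (n : Fin d → Fin p) (y : Pt d) :
    boxBasis B n y = ∏ k, chebBasis p (n k) (boxCoord B y k) := rfl

lemma boxCoord_mem {d : ℕ} {B : Box d} {y : Pt d} (hy : y ∈ B.toSet) (k : Fin d) :
    boxCoord B y k ∈ Set.Icc (-1 : ℝ) 1 := by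
  have h := hy k
  rcases (sub_nonneg.2 (h.1.trans h.2)).eq_or_lt with h0 | h0
  · rw [boxCoord, Box.edge, ← h0]; simp
  · rw [boxCoord, Box.edge, Set.mem_Icc, le_div_iff₀ h0, div_le_iff₀ h0]
    constructor <;> linarith

lemma boxPoint_boxCoord {d : ℕ} {B : Box d} {y : Pt d} (hy : y ∈ B.toSet) :
    boxPoint B (boxCoord B y) = y := by
  ext k
  have h := hy k
  simp only [boxPoint, boxCoord]
  rcases (sub_nonneg.2 (h.1.trans h.2)).eq_or_lt with h0 | h0
  · rw [Box.edge, ← h0]; simp; linarith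
  · have : B.edge k ≠ 0 := h0.ne'
    field_simp
    ring

lemma boxPoint_mem {d : ℕ} {B : Box d} (hB : ∀ k, B.lo k ≤ B.hi k) {t : Fin d → ℝ}
    (ht : ∀ k, t k ∈ Set.Icc (-1 : ℝ) 1) : boxPoint B t ∈ B.toSet := by
  intro k
  have h1 := (ht k).1
  have h2 := (ht k).2
  have h3 := hB k
  simp only [boxPoint, Box.edge]
  constructor <;> nlinarith

/-- Varying one reference coordinate moves along a line with velocity half an edge. This is the form
in which the directional estimate for the kernel is applied. -/
lemma boxPoint_update {d : ℕ} (B : Box d) (t : Fin d → ℝ) (k : Fin d) (s : ℝ) :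
    boxPoint B (Function.update t k s) = boxPoint B (Function.update t k 0) +
      s • (B.edge k / 2) • EuclideanSpace.single k 1 := by
  ext j
  rcases eq_or_ne j k with rfl | hj
  · simp [boxPoint]; ring
  · simp [boxPoint, hj]

/-- Interpolation in a box reproduces the basis functions of any other box. -/
lemma sum_boxBasis_mul_boxBasis_boxNode {d p : ℕ} (hp : 1 ≤ p) (B B' : Box d)
    (m : Fin d → Fin p) {y : Pt d}
    (hy : ∀ k, B'.edge k = 0 → y k = (B'.lo k + B'.hi k) / 2) :
    ∑ r : Fin d → Fin p, boxBasis B' r y * boxBasis B m (boxNode B' r) = boxBasis B m y := by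
  have h1 : ∀ k, ∑ r, chebBasis p r (boxCoord B' y k) * chebBasis p (m k)
      ((2 * ((B'.lo k + B'.hi k) / 2 + B'.edge k / 2 * chebNode p r) - B.lo k - B.hi k) /
        B.edge k) = chebBasis p (m k) (boxCoord B y k) := by
    intro k
    -- For a flat direction all nodes have the coordinate of `y`, and the basis functions sum to
    -- one.
    by_cases he : B'.edge k = 0
    · simp only [he, zero_div, zero_mul, add_zero]
      rw [← Finset.sum_mul, sum_chebBasis hp, one_mul, boxCoord, hy k he]
    -- A basis function of `B` in the reference coordinate of `B'` is still a polynomial of degree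
    -- below `p`, which interpolation reproduces. If `B.edge k = 0`, division by zero makes the
    -- affine map the constant `0`, as in `boxBasis`.
    · set q : Polynomial ℝ := (Lagrange.basis Finset.univ (chebNode p) (m k)).comp
        (Polynomial.C (B'.edge k / B.edge k) * Polynomial.X +
          Polynomial.C ((B'.lo k + B'.hi k - B.lo k - B.hi k) / B.edge k)) with hq
      have hdeg : q.degree < p := by
        have h2 : q.natDegree ≤ p - 1 := by
          refine Polynomial.natDegree_comp_le.trans ?_
          rw [Lagrange.natDegree_basis (chebNode_injective p).injOn (Finset.mem_univ _)]
          refine (Nat.mul_le_mul_left _ Polynomial.natDegree_linear_le).trans ?_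
          simp
        refine Polynomial.degree_le_natDegree.trans_lt ?_
        exact_mod_cast (by omega : q.natDegree < p)
      have hev : ∀ s, q.eval s = chebBasis p (m k)
          ((2 * ((B'.lo k + B'.hi k) / 2 + B'.edge k / 2 * s) - B.lo k - B.hi k) /
            B.edge k) := by
        intro s
        rw [hq, Polynomial.eval_comp, chebBasis]
        simp only [Polynomial.eval_add, Polynomial.eval_mul, Polynomial.eval_C, Polynomial.eval_X]
        congr 1
        ring
      have h3 := sum_chebBasis_mul_eval hdeg (boxCoord B' y k)
      simp only [hev] at h3
      rw [h3, boxCoord, boxCoord]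
      congr 2
      field_simp
      ring
  simp only [boxBasis_eq_prod, ← Finset.prod_mul_distrib]
  rw [← Finset.prod_congr rfl fun k _ => h1 k, Finset.prod_univ_sum, Fintype.piFinset_univ]
  rfl

lemma sum_boxBasis {d p : ℕ} (hp : 1 ≤ p) (B : Box d) (y : Pt d) :
    ∑ r : Fin d → Fin p, boxBasis B r y = 1 := by
  simp only [boxBasis_eq_prod]
  have := Finset.prod_univ_sum (fun _ : Fin d => (Finset.univ : Finset (Fin p)))
    (fun k r => chebBasis p r (boxCoord B y k))
  rw [Fintype.piFinset_univ] at this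
  rw [← this]
  simp [sum_chebBasis hp]

/-! ### Interpolation of asymptotically smooth kernels -/

/-- The iterated Fréchet derivatives, evaluated on copies of `v`, are the successive derivatives
along the line. They supply the sequence required by the one-dimensional error estimate. -/
lemma hasDerivAt_iteratedFDeriv_line {V : Type*} [NormedAddCommGroup V] [NormedSpace ℝ V]
    {F : V → ℝ} {U : Set V} (hU : IsOpen U) (hF : ContDiffOn ℝ ∞ F U) (z v : V) (n : ℕ) {s : ℝ}
    (hs : z + s • v ∈ U) :
    HasDerivAt (fun s : ℝ => iteratedFDeriv ℝ n F (z + s • v) (fun _ => v))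
      (iteratedFDeriv ℝ (n + 1) F (z + s • v) (fun _ => v)) s := by
  have hat : ContDiffAt ℝ ∞ F (z + s • v) := hF.contDiffAt (hU.mem_nhds hs)
  have hd : DifferentiableAt ℝ (iteratedFDeriv ℝ n F) (z + s • v) :=
    hat.differentiableAt_iteratedFDeriv (by exact_mod_cast WithTop.coe_lt_top n)
  have hl : HasDerivAt (fun s : ℝ => z + s • v) v s := by
    simpa using ((hasDerivAt_id s).smul_const v).const_add z
  have h1 := hd.hasFDerivAt.comp_hasDerivAt s hl
  have h2 := ((ContinuousMultilinearMap.apply ℝ (fun _ : Fin n => V) ℝ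
    (fun _ => v)).hasFDerivAt).comp_hasDerivAt s h1
  exact h2

/-- The interpolation error of an asymptotically smooth kernel in one coordinate direction. -/
lemma AsympSmooth.abs_sub_chebInterp_le {d p : ℕ} {E : Set (Pt d)} {c₁ c₂ η δ h : ℝ}
    {ρ : Pt d → Pt d → ℝ} (hp : 1 ≤ p) (hρ : AsympSmooth E c₁ c₂ ρ) (hE : IsOpen E)
    (hc₁ : 0 ≤ c₁) (hc₂ : 0 < c₂) (hδ : 0 < δ) (hh : 0 ≤ h) (hη : 2 * h ≤ η * δ)
    (z : Pt d × Pt d) (w : Fin d ⊕ Fin d)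
    (hz : ∀ s ∈ Set.Icc (-1 : ℝ) 1, (z + s • h • coordDir w).1 ∈ E ∧
      (z + s • h • coordDir w).2 ∈ E ∧
      δ ≤ ‖(z + s • h • coordDir w).1 - (z + s • h • coordDir w).2‖)
    {t : ℝ} (ht : t ∈ Set.Icc (-1 : ℝ) 1) :
    |ρ (z + t • h • coordDir w).1 (z + t • h • coordDir w).2 -
      ∑ k, chebBasis p k t * ρ (z + chebNode p k • h • coordDir w).1
        (z + chebNode p k • h • coordDir w).2| ≤ 2 * c₁ * (η / (4 * c₂)) ^ p := by
  set F : Pt d × Pt d → ℝ := fun z => ρ z.1 z.2 with hF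
  set U : Set (Pt d × Pt d) := {z | z.1 ∈ E ∧ z.2 ∈ E ∧ z.1 ≠ z.2} with hU
  have hUo : IsOpen U := (hE.preimage continuous_fst).inter ((hE.preimage continuous_snd).inter
    (isOpen_ne_fun continuous_fst continuous_snd))
  have hmem : ∀ s ∈ Set.Icc (-1 : ℝ) 1, z + s • h • coordDir w ∈ U := by
    intro s hs
    obtain ⟨h1, h2, h3⟩ := hz s hs
    refine ⟨h1, h2, fun h4 => ?_⟩
    rw [h4, sub_self, norm_zero] at h3
    linarith
  set f : ℕ → ℝ → ℝ := fun n s =>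
    iteratedFDeriv ℝ n F (z + s • h • coordDir w) (fun _ => h • coordDir w) with hf
  have hfd : ∀ n, ∀ s ∈ Set.Icc (-1 : ℝ) 1, HasDerivAt (f n) (f (n + 1) s) s := fun n s hs =>
    hasDerivAt_iteratedFDeriv_line hUo hρ.smooth z _ n (hmem s hs)
  have hM : ∀ s ∈ Set.Icc (-1 : ℝ) 1,
      |f p s| ≤ h ^ p * (c₁ * ((c₂ * δ) ^ p)⁻¹ * (p.factorial : ℝ)) := by
    intro s hs
    obtain ⟨h1, h2, h3⟩ := hz s hs
    have hb := hρ.bound _ h1 _ h2 (hmem s hs).2.2 p hp (fun _ => w)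
    have e : f p s = h ^ p * iteratedFDeriv ℝ p F (z + s • h • coordDir w)
        (fun _ => coordDir w) := by
      simp only [hf]
      rw [ContinuousMultilinearMap.map_smul_univ _ (fun _ => h) (fun _ => coordDir w)]
      simp
    rw [e, abs_mul, abs_of_nonneg (pow_nonneg hh p)]
    apply mul_le_mul_of_nonneg_left _ (pow_nonneg hh p)
    refine hb.trans ?_
    gcongr
  have key := H2Matrix.abs_sub_chebInterp_le (p := p) f hfd hM ht
  have hf0 : ∀ s, f 0 s = ρ (z + s • h • coordDir w).1 (z + s • h • coordDir w).2 := fun s => rfl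
  simp only [hf0] at key
  refine key.trans ?_
  have hfac : (0 : ℝ) < p.factorial := by exact_mod_cast p.factorial_pos
  have h2p : (2 : ℝ) ^ p = 2 ^ (p - 1) * 2 := by
    rw [← pow_succ, Nat.sub_add_cancel hp]
  -- The factorials cancel, and `2 ^ (1 - p) = 2 * 2 ^ (-p)` turns `h / 2` into `2h / 4`, to which
  -- `2h ≤ η δ` applies.
  have e : h ^ p * (c₁ * ((c₂ * δ) ^ p)⁻¹ * (p.factorial : ℝ)) / p.factorial * (2 ^ (p - 1))⁻¹ =
      2 * c₁ * (2 * h / (4 * c₂ * δ)) ^ p := by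
    have : (2 * h / (4 * c₂ * δ)) ^ p = h ^ p * ((c₂ * δ) ^ p)⁻¹ * (2 ^ p)⁻¹ := by
      rw [← inv_pow, ← inv_pow, ← mul_pow, ← mul_pow]
      congr 1
      field_simp
      ring
    rw [this, h2p]
    field_simp
  rw [e]
  have hle : 2 * h / (4 * c₂ * δ) ≤ η / (4 * c₂) := by
    rw [div_le_div_iff₀ (by positivity) (by positivity)]
    have : 0 < 4 * c₂ := by positivity
    nlinarith
  exact mul_le_mul_of_nonneg_left (pow_le_pow_left₀ (by positivity) hle p) (by positivity)

/-- The interpolation error on a pair of boxes with positive distance. -/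
lemma AsympSmooth.abs_sub_boxInterp_le {d p : ℕ} {E : Set (Pt d)} {c₁ c₂ η δ Λ : ℝ}
    {ρ : Pt d → Pt d → ℝ} (hp : 1 ≤ p) (hρ : AsympSmooth E c₁ c₂ ρ) (hE : IsOpen E)
    (hc₁ : 0 ≤ c₁) (hc₂ : 0 < c₂) (hδ : 0 < δ)
    (hΛ : ∀ t ∈ Set.Icc (-1 : ℝ) 1, ∑ k : Fin p, |chebBasis p k t| ≤ Λ) {B B' : Box d}
    (hB : ∀ k, B.lo k ≤ B.hi k) (hB' : ∀ k, B'.lo k ≤ B'.hi k)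
    (hBE : B.toSet ⊆ E) (hBE' : B'.toSet ⊆ E)
    (hdist : ∀ x ∈ B.toSet, ∀ y ∈ B'.toSet, δ ≤ ‖x - y‖)
    (hedge : ∀ k, B.edge k ≤ η * δ) (hedge' : ∀ k, B'.edge k ≤ η * δ)
    {x y : Pt d} (hx : x ∈ B.toSet) (hy : y ∈ B'.toSet) :
    |ρ x y - ∑ n : Fin d → Fin p, ∑ m : Fin d → Fin p,
      boxBasis B n x * ρ (boxNode B n) (boxNode B' m) * boxBasis B' m y| ≤
      ((∑ r ∈ Finset.range d, Λ ^ r) * (1 + Λ ^ d)) * (2 * c₁ * (η / (4 * c₂)) ^ p) := by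
  set ε := 2 * c₁ * (η / (4 * c₂)) ^ p with hε
  have hnode : ∀ n : Fin d → Fin p, boxNode B n ∈ B.toSet := fun n =>
    boxPoint_mem hB fun k => chebNode_mem p _
  have hupd : ∀ (t : Fin d → ℝ) (k : Fin d) (s : ℝ), (∀ j, t j ∈ Set.Icc (-1 : ℝ) 1) →
      s ∈ Set.Icc (-1 : ℝ) 1 → ∀ j, Function.update t k s j ∈ Set.Icc (-1 : ℝ) 1 := by
    intro t k s ht hs j
    rcases eq_or_ne j k with rfl | hj
    · simpa using hs
    · simpa [hj] using ht j
  have h1 : ∀ y ∈ B'.toSet, |ρ x y - ∑ n : Fin d → Fin p, boxBasis B n x * ρ (boxNode B n) y| ≤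
      (∑ r ∈ Finset.range d, Λ ^ r) * ε := by
    intro y hy
    have := abs_sub_tensorInterp_le hΛ (ε := ε) d (fun t => ρ (boxPoint B t) y) (fun k t ht => by
      have h := hρ.abs_sub_chebInterp_le hp hE hc₁ hc₂ hδ (h := B.edge k / 2) (η := η)
        (by have := sub_nonneg.2 (hB k); rw [Box.edge]; positivity) (by linarith [hedge k])
        (boxPoint B (Function.update t k 0), y) (Sum.inl k) (fun s hs => by
          have e : ((boxPoint B (Function.update t k 0), y) +
              s • (B.edge k / 2) • coordDir (Sum.inl k) : Pt d × Pt d) =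
              (boxPoint B (Function.update t k s), y) := by
            rw [boxPoint_update B t k s]; simp [coordDir]
          rw [e]
          have hm := boxPoint_mem hB (hupd t k s ht hs)
          exact ⟨hBE hm, hBE' hy, hdist _ hm _ hy⟩) (ht k)
      have e : ∀ s : ℝ, ((boxPoint B (Function.update t k 0), y) +
          s • (B.edge k / 2) • coordDir (Sum.inl k) : Pt d × Pt d) =
          (boxPoint B (Function.update t k s), y) := by
        intro s
        rw [boxPoint_update B t k s]; simp [coordDir]
      simp only [e, Function.update_eq_self] at h
      exact h) (boxCoord B x) (boxCoord_mem hx)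
    simp only [boxPoint_boxCoord hx] at this
    exact this
  have h2 : ∀ x ∈ B.toSet, |ρ x y - ∑ m : Fin d → Fin p, boxBasis B' m y * ρ x (boxNode B' m)| ≤
      (∑ r ∈ Finset.range d, Λ ^ r) * ε := by
    intro x hx
    have := abs_sub_tensorInterp_le hΛ (ε := ε) d (fun t => ρ x (boxPoint B' t)) (fun k t ht => by
      have e : ∀ s : ℝ, ((x, boxPoint B' (Function.update t k 0)) +
          s • (B'.edge k / 2) • coordDir (Sum.inr k) : Pt d × Pt d) =
          (x, boxPoint B' (Function.update t k s)) := by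
        intro s
        rw [boxPoint_update B' t k s]; simp [coordDir]
      have h := hρ.abs_sub_chebInterp_le hp hE hc₁ hc₂ hδ (h := B'.edge k / 2) (η := η)
        (by have := sub_nonneg.2 (hB' k); rw [Box.edge]; positivity) (by linarith [hedge' k])
        (x, boxPoint B' (Function.update t k 0)) (Sum.inr k) (fun s hs => by
          rw [e]
          have hm := boxPoint_mem hB' (hupd t k s ht hs)
          exact ⟨hBE hx, hBE' hm, hdist _ hx _ hm⟩) (ht k)
      simp only [e, Function.update_eq_self] at h
      exact h) (boxCoord B' y) (boxCoord_mem hy)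
    simp only [boxPoint_boxCoord hy] at this
    exact this
  have hΛd := sum_abs_prod_chebBasis_le hΛ (boxCoord_mem hx)
  have hS : 0 ≤ (∑ r ∈ Finset.range d, Λ ^ r) * ε := (abs_nonneg _).trans (h1 y hy)
  -- The first variable is interpolated first; interpolation at its nodes multiplies the error in
  -- the second variable by at most `Λ ^ d`.
  have hsplit : ρ x y - ∑ n : Fin d → Fin p, ∑ m : Fin d → Fin p,
      boxBasis B n x * ρ (boxNode B n) (boxNode B' m) * boxBasis B' m y =
      (ρ x y - ∑ n : Fin d → Fin p, boxBasis B n x * ρ (boxNode B n) y) +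
      ∑ n : Fin d → Fin p, boxBasis B n x * (ρ (boxNode B n) y -
        ∑ m : Fin d → Fin p, boxBasis B' m y * ρ (boxNode B n) (boxNode B' m)) := by
    simp_rw [mul_sub, Finset.mul_sum]
    rw [Finset.sum_sub_distrib]
    rw [sub_add_sub_cancel]
    congr 1
    refine Finset.sum_congr rfl fun n _ => Finset.sum_congr rfl fun m _ => by ring
  have h3 : |∑ n : Fin d → Fin p, boxBasis B n x * (ρ (boxNode B n) y -
        ∑ m : Fin d → Fin p, boxBasis B' m y * ρ (boxNode B n) (boxNode B' m))| ≤
      Λ ^ d * ((∑ r ∈ Finset.range d, Λ ^ r) * ε) := by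
    refine (Finset.abs_sum_le_sum_abs _ _).trans ?_
    simp_rw [abs_mul]
    refine (Finset.sum_le_sum fun n _ =>
      mul_le_mul_of_nonneg_left (h2 _ (hnode n)) (abs_nonneg _)).trans ?_
    rw [← Finset.sum_mul]
    exact mul_le_mul_of_nonneg_right hΛd hS
  rw [hsplit]
  refine (abs_add_le _ _).trans ((add_le_add (h1 y hy) h3).trans (le_of_eq ?_))
  ring

/-! ### Levels of a tree given by its sons -/

section Tree

variable {α β : Type*} [DecidableEq α]

/-- The nodes at depth `n` of the tree with given root. -/
def treeLevel (S : α → Finset α) (root : α) : ℕ → Finset α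
  | 0 => {root}
  | n + 1 => (treeLevel S root n).biUnion S

lemma mem_treeLevel_succ {S : α → Finset α} {root b : α} {n : ℕ} :
    b ∈ treeLevel S root (n + 1) ↔ ∃ a ∈ treeLevel S root n, b ∈ S a := by
  simp [treeLevel]

lemma mem_treeLevel_add {S : α → Finset α} {root b : α} {n k : ℕ} :
    b ∈ treeLevel S root (n + k) ↔ ∃ a ∈ treeLevel S root n, b ∈ treeLevel S a k := by
  induction k generalizing b with
  | zero => simp [treeLevel]
  | succ k ih =>
    rw [← add_assoc, mem_treeLevel_succ]
    simp_rw [ih, mem_treeLevel_succ]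
    constructor
    · rintro ⟨c, ⟨a, ha, hc⟩, hb⟩; exact ⟨a, ha, c, hc, hb⟩
    · rintro ⟨a, ha, c, hc, hb⟩; exact ⟨c, ⟨a, ha, hc⟩, hb⟩

lemma card_treeLevel_le {S : α → Finset α} (hS : ∀ a, (S a).card ≤ 2) (root : α) (n : ℕ) :
    (treeLevel S root n).card ≤ 2 ^ n := by
  induction n with
  | zero => simp [treeLevel]
  | succ n ih =>
    rw [treeLevel, pow_succ]
    exact (Finset.card_biUnion_le_card_mul _ _ 2 fun a _ => hS a).trans (Nat.mul_le_mul_right 2 ih)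

lemma treeLevel_subset {S : α → Finset α} {car : α → Set β}
    (hsub : ∀ a, ∀ b ∈ S a, car b ⊆ car a) {root b : α} {n : ℕ} (hb : b ∈ treeLevel S root n) :
    car b ⊆ car root := by
  induction n generalizing b with
  | zero => rw [Finset.mem_singleton.1 hb]
  | succ n ih =>
    obtain ⟨a, ha, hb⟩ := mem_treeLevel_succ.1 hb
    exact (hsub a b hb).trans (ih ha)

/-- By induction on the depth: parents sharing `i` coincide, and siblings are disjoint. The carrier
`car` is abstract so that the argument serves both clusters and blocks. -/
lemma treeLevel_eq_of_mem {S : α → Finset α} {car : α → Set β}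
    (hsub : ∀ a, ∀ b ∈ S a, car b ⊆ car a)
    (hdis : ∀ a, ∀ b ∈ S a, ∀ c ∈ S a, ∀ i, i ∈ car b → i ∈ car c → b = c)
    {root b c : α} {n : ℕ} (hb : b ∈ treeLevel S root n) (hc : c ∈ treeLevel S root n) {i : β}
    (hib : i ∈ car b) (hic : i ∈ car c) : b = c := by
  induction n generalizing b c with
  | zero => rw [Finset.mem_singleton.1 hb, Finset.mem_singleton.1 hc]
  | succ n ih =>
    obtain ⟨a, ha, hb⟩ := mem_treeLevel_succ.1 hb
    obtain ⟨a', ha', hc⟩ := mem_treeLevel_succ.1 hc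
    obtain rfl := ih ha ha' (hsub a b hb hib) (hsub a' c hc hic)
    exact hdis a b hb c hc i hib hic

/-- Nodes are nested or disjoint: the ancestor of `c` at the depth of `b` also contains `i`, hence
equals `b`. -/
lemma mem_treeLevel_of_mem {S : α → Finset α} {car : α → Set β}
    (hsub : ∀ a, ∀ b ∈ S a, car b ⊆ car a)
    (hdis : ∀ a, ∀ b ∈ S a, ∀ c ∈ S a, ∀ i, i ∈ car b → i ∈ car c → b = c)
    {root b c : α} {n k : ℕ} (hb : b ∈ treeLevel S root n) (hc : c ∈ treeLevel S root (n + k))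
    {i : β} (hib : i ∈ car b) (hic : i ∈ car c) : c ∈ treeLevel S b k := by
  obtain ⟨a, ha, hca⟩ := mem_treeLevel_add.1 hc
  obtain rfl := treeLevel_eq_of_mem hsub hdis hb ha hib (treeLevel_subset hsub hca hic)
  exact hca

lemma treeLevel_of_leaf {S : α → Finset α} {b c : α} (hb : S b = ∅) {k : ℕ}
    (hc : c ∈ treeLevel S b k) : c = b := by
  induction k generalizing c with
  | zero => exact Finset.mem_singleton.1 hc
  | succ k ih =>
    obtain ⟨a, ha, hc⟩ := mem_treeLevel_succ.1 hc
    rw [ih ha, hb] at hc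
    exact absurd hc (Finset.notMem_empty _)

end Tree

/-! ### Bounding boxes -/

section BBox

variable {d N : ℕ} (x : Fin N → Pt d)

lemma bbox_lo_le {X : Finset (Fin N)} {i : Fin N} (hi : i ∈ X) (k : Fin d) :
    (bbox x X).lo k ≤ x i k :=
  ciInf_le (f := fun i : X => x i k) (Set.finite_range _).bddBelow ⟨i, hi⟩

lemma le_bbox_hi {X : Finset (Fin N)} {i : Fin N} (hi : i ∈ X) (k : Fin d) :
    x i k ≤ (bbox x X).hi k :=
  le_ciSup (f := fun i : X => x i k) (Set.finite_range _).bddAbove ⟨i, hi⟩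

lemma mem_bbox {X : Finset (Fin N)} {i : Fin N} (hi : i ∈ X) : x i ∈ (bbox x X).toSet :=
  fun k => ⟨bbox_lo_le x hi k, le_bbox_hi x hi k⟩

lemma exists_bbox_lo_eq {X : Finset (Fin N)} (hX : X.Nonempty) (k : Fin d) :
    ∃ i ∈ X, x i k = (bbox x X).lo k := by
  have : Nonempty X := hX.to_subtype
  obtain ⟨i, hi⟩ := exists_eq_ciInf_of_finite (f := fun i : X => x i k)
  exact ⟨i, i.2, hi⟩

lemma exists_bbox_hi_eq {X : Finset (Fin N)} (hX : X.Nonempty) (k : Fin d) :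
    ∃ i ∈ X, x i k = (bbox x X).hi k := by
  have : Nonempty X := hX.to_subtype
  obtain ⟨i, hi⟩ := exists_eq_ciSup_of_finite (f := fun i : X => x i k)
  exact ⟨i, i.2, hi⟩

lemma bbox_lo_le_hi (X : Finset (Fin N)) (k : Fin d) : (bbox x X).lo k ≤ (bbox x X).hi k := by
  rcases X.eq_empty_or_nonempty with rfl | ⟨i, hi⟩
  · simp [bbox]
  · exact (bbox_lo_le x hi k).trans (le_bbox_hi x hi k)

lemma bbox_edge_nonneg (X : Finset (Fin N)) (k : Fin d) : 0 ≤ (bbox x X).edge k :=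
  sub_nonneg.2 (bbox_lo_le_hi x X k)

variable {x} in
lemma bbox_lo_anti {X Y : Finset (Fin N)} (hY : Y.Nonempty) (h : Y ⊆ X) (k : Fin d) :
    (bbox x X).lo k ≤ (bbox x Y).lo k := by
  obtain ⟨i, hi, he⟩ := exists_bbox_lo_eq x hY k
  rw [← he]; exact bbox_lo_le x (h hi) k

variable {x} in
lemma bbox_hi_mono {X Y : Finset (Fin N)} (hY : Y.Nonempty) (h : Y ⊆ X) (k : Fin d) :
    (bbox x Y).hi k ≤ (bbox x X).hi k := by
  obtain ⟨i, hi, he⟩ := exists_bbox_hi_eq x hY k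
  rw [← he]; exact le_bbox_hi x (h hi) k

variable {x} in
lemma bbox_edge_mono {X Y : Finset (Fin N)} (hY : Y.Nonempty) (h : Y ⊆ X) (k : Fin d) :
    (bbox x Y).edge k ≤ (bbox x X).edge k :=
  sub_le_sub (bbox_hi_mono hY h k) (bbox_lo_anti hY h k)

variable {x} in
lemma bbox_toSet_subset {X Y : Finset (Fin N)} (hY : Y.Nonempty) (h : Y ⊆ X) :
    (bbox x Y).toSet ⊆ (bbox x X).toSet :=
  fun _ hy k => ⟨(bbox_lo_anti hY h k).trans (hy k).1, (hy k).2.trans (bbox_hi_mono hY h k)⟩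

/-- The length of a longest edge of the bounding box. -/
noncomputable def len (κ : Finset (Fin N) → Fin d) (X : Finset (Fin N)) : ℝ :=
  (bbox x X).edge (κ X)

lemma len_nonneg (κ : Finset (Fin N) → Fin d) (X : Finset (Fin N)) : 0 ≤ len x κ X :=
  bbox_edge_nonneg x X _

variable {x}

lemma abs_sub_le_len {κ : Finset (Fin N) → Fin d} (hκ : LongestEdge x κ) {X : Finset (Fin N)}
    {y z : Pt d} (hy : y ∈ (bbox x X).toSet) (hz : z ∈ (bbox x X).toSet) (k : Fin d) :
    |y k - z k| ≤ len x κ X := by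
  refine le_trans ?_ (hκ X k)
  rw [Box.edge, abs_le]
  constructor <;> linarith [(hy k).1, (hy k).2, (hz k).1, (hz k).2]

lemma len_mono {κ : Finset (Fin N) → Fin d} (hκ : LongestEdge x κ) {X Y : Finset (Fin N)}
    (hY : Y.Nonempty) (h : Y ⊆ X) : len x κ Y ≤ len x κ X :=
  (bbox_edge_mono hY h _).trans (hκ X _)

lemma card_le_one_of_len_eq_zero {κ : Finset (Fin N) → Fin d} (hx : Function.Injective x)
    (hκ : LongestEdge x κ) {X : Finset (Fin N)} (h : len x κ X = 0) : X.card ≤ 1 := by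
  rw [Finset.card_le_one]
  intro i hi j hj
  apply hx
  ext k
  have := abs_sub_le_len hκ (mem_bbox x hi) (mem_bbox x hj) k
  rw [h] at this
  exact sub_eq_zero.1 (abs_nonpos_iff.1 this)

end BBox

/-! ### The cluster tree -/

section Clusters

variable {d N : ℕ} {x : Fin N → Pt d} {κ : Finset (Fin N) → Fin d} {Cleaf : ℕ}

lemma mem_sons {X S : Finset (Fin N)} : S ∈ sons x κ Cleaf X ↔
    Cleaf < X.card ∧ (S = lowerSon x κ X ∨ S = X \ lowerSon x κ X) := by
  unfold sons
  split_ifs with h <;> simp [h]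

lemma lowerSon_subset (X : Finset (Fin N)) : lowerSon x κ X ⊆ X := by
  unfold lowerSon; exact Finset.filter_subset _ _

lemma mem_lowerSon {X : Finset (Fin N)} {i : Fin N} : i ∈ lowerSon x κ X ↔
    i ∈ X ∧ x i (κ X) ≤ ((bbox x X).lo (κ X) + (bbox x X).hi (κ X)) / 2 := by
  simp [lowerSon]

lemma mem_upperSon {X : Finset (Fin N)} {i : Fin N} : i ∈ X \ lowerSon x κ X ↔
    i ∈ X ∧ ((bbox x X).lo (κ X) + (bbox x X).hi (κ X)) / 2 < x i (κ X) := by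
  rw [Finset.mem_sdiff, mem_lowerSon]
  constructor
  · rintro ⟨h1, h2⟩; exact ⟨h1, not_le.1 fun h => h2 ⟨h1, h⟩⟩
  · rintro ⟨h1, h2⟩; exact ⟨h1, fun h => absurd h.2 (not_le.2 h2)⟩

lemma sons_eq_empty {X : Finset (Fin N)} : sons x κ Cleaf X = ∅ ↔ X.card ≤ Cleaf := by
  unfold sons
  split_ifs with h
  · simp [h]
  · simpa using h

lemma card_sons_le (X : Finset (Fin N)) : (sons x κ Cleaf X).card ≤ 2 := by
  unfold sons
  split_ifs
  · exact Finset.card_le_two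
  · simp

lemma subset_of_mem_sons {X S : Finset (Fin N)} (h : S ∈ sons x κ Cleaf X) : S ⊆ X := by
  rcases (mem_sons.1 h).2 with rfl | rfl
  · exact lowerSon_subset X
  · exact Finset.sdiff_subset

lemma exists_mem_sons {X : Finset (Fin N)} (h : sons x κ Cleaf X ≠ ∅) {i : Fin N} (hi : i ∈ X) :
    ∃ S ∈ sons x κ Cleaf X, i ∈ S := by
  have hc : Cleaf < X.card := not_le.1 fun hle => h (sons_eq_empty.2 hle)
  by_cases hl : i ∈ lowerSon x κ X
  · exact ⟨_, mem_sons.2 ⟨hc, Or.inl rfl⟩, hl⟩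
  · exact ⟨_, mem_sons.2 ⟨hc, Or.inr rfl⟩, Finset.mem_sdiff.2 ⟨hi, hl⟩⟩

lemma sons_eq_of_mem {X S S' : Finset (Fin N)} (h : S ∈ sons x κ Cleaf X)
    (h' : S' ∈ sons x κ Cleaf X) {i : Fin N} (hi : i ∈ S) (hi' : i ∈ S') : S = S' := by
  rcases (mem_sons.1 h).2 with rfl | rfl <;> rcases (mem_sons.1 h').2 with rfl | rfl
  · rfl
  · exact absurd hi (Finset.mem_sdiff.1 hi').2
  · exact absurd hi' (Finset.mem_sdiff.1 hi).2
  · rfl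

lemma len_pos_of_one_lt_card (hx : Function.Injective x) (hκ : LongestEdge x κ)
    {X : Finset (Fin N)} (h : 1 < X.card) : 0 < len x κ X := by
  rcases (len_nonneg x κ X).eq_or_lt with h0 | h0
  · exact absurd (card_le_one_of_len_eq_zero hx hκ h0.symm) (not_le.2 h)
  · exact h0

/-- A cluster that is split has more than one point, hence a longest edge of positive length. The
points attaining its lower and upper end lie on different sides of the midpoint. -/
lemma nonempty_of_mem_sons (hx : Function.Injective x) (hκ : LongestEdge x κ) (hC : 2 ≤ Cleaf)
    {X S : Finset (Fin N)} (h : S ∈ sons x κ Cleaf X) : S.Nonempty := by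
  obtain ⟨hc, hS⟩ := mem_sons.1 h
  have hpos := len_pos_of_one_lt_card hx hκ (by omega : 1 < X.card)
  have hXne : X.Nonempty := Finset.card_pos.1 (by omega)
  rw [len, Box.edge] at hpos
  rcases hS with rfl | rfl
  · obtain ⟨i, hi, he⟩ := exists_bbox_lo_eq x hXne (κ X)
    exact ⟨i, mem_lowerSon.2 ⟨hi, by rw [he]; linarith⟩⟩
  · obtain ⟨i, hi, he⟩ := exists_bbox_hi_eq x hXne (κ X)
    exact ⟨i, mem_upperSon.2 ⟨hi, by rw [he]; linarith⟩⟩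

lemma card_lt_of_mem_sons (hx : Function.Injective x) (hκ : LongestEdge x κ) (hC : 2 ≤ Cleaf)
    {X S : Finset (Fin N)} (h : S ∈ sons x κ Cleaf X) : S.card < X.card := by
  obtain ⟨hc, hS⟩ := mem_sons.1 h
  apply Finset.card_lt_card
  refine ⟨subset_of_mem_sons h, fun hsub => ?_⟩
  have hl := mem_sons.2 ⟨hc, Or.inl (rfl : lowerSon x κ X = _)⟩
  have hu := mem_sons.2 ⟨hc, Or.inr (rfl : X \ lowerSon x κ X = _)⟩
  rcases hS with rfl | rfl
  · obtain ⟨i, hi⟩ := nonempty_of_mem_sons hx hκ hC hu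
    exact (Finset.mem_sdiff.1 hi).2 (hsub (Finset.mem_sdiff.1 hi).1)
  · obtain ⟨i, hi⟩ := nonempty_of_mem_sons hx hκ hC hl
    exact (Finset.mem_sdiff.1 (hsub (lowerSon_subset X hi))).2 hi

/-- Each son keeps one end of the parent's edge as a bound and has the midpoint as the other bound.
-/
lemma edge_son_le (hx : Function.Injective x) (hκ : LongestEdge x κ) (hC : 2 ≤ Cleaf)
    {X S : Finset (Fin N)} (h : S ∈ sons x κ Cleaf X) :
    (bbox x S).edge (κ X) ≤ len x κ X / 2 := by
  have hne := nonempty_of_mem_sons hx hκ hC h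
  obtain ⟨i, hi, hil⟩ := exists_bbox_lo_eq x hne (κ X)
  obtain ⟨j, hj, hjh⟩ := exists_bbox_hi_eq x hne (κ X)
  have hsub := subset_of_mem_sons h
  have h1 := bbox_lo_le x (hsub hi) (κ X)
  have h2 := le_bbox_hi x (hsub hj) (κ X)
  rw [len, Box.edge, Box.edge, ← hil, ← hjh]
  rcases (mem_sons.1 h).2 with rfl | rfl
  · have := (mem_lowerSon.1 hj).2
    linarith
  · have := (mem_upperSon.1 hi).2
    linarith

/-- The clusters at depth `n` of the cluster tree. -/
noncomputable def clusterLevel (x : Fin N → Pt d) (κ : Finset (Fin N) → Fin d) (Cleaf n : ℕ) :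
    Finset (Finset (Fin N)) :=
  treeLevel (sons x κ Cleaf) Finset.univ n

lemma isCluster_iff {X : Finset (Fin N)} :
    IsCluster x κ Cleaf X ↔ ∃ n, X ∈ clusterLevel x κ Cleaf n := by
  constructor
  · intro h
    induction h with
    | root => exact ⟨0, Finset.mem_singleton_self _⟩
    | son _ hs ih =>
      obtain ⟨n, hn⟩ := ih
      exact ⟨n + 1, mem_treeLevel_succ.2 ⟨_, hn, hs⟩⟩
  · rintro ⟨n, hn⟩
    induction n generalizing X with
    | zero => rw [Finset.mem_singleton.1 hn]; exact .root
    | succ n ih =>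
      obtain ⟨Y, hY, hX⟩ := mem_treeLevel_succ.1 hn
      exact .son (ih hY) hX

lemma IsCluster.nonempty (hN : 0 < N) (hx : Function.Injective x) (hκ : LongestEdge x κ)
    (hC : 2 ≤ Cleaf) {X : Finset (Fin N)} (h : IsCluster x κ Cleaf X) : X.Nonempty := by
  cases h with
  | root => exact ⟨⟨0, hN⟩, Finset.mem_univ _⟩
  | son _ hs => exact nonempty_of_mem_sons hx hκ hC hs

lemma mem_treeLevel_sons_of_mem {X Y R : Finset (Fin N)} {n k : ℕ}
    (hX : X ∈ treeLevel (sons x κ Cleaf) R n) (hY : Y ∈ treeLevel (sons x κ Cleaf) R (n + k))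
    {i : Fin N} (hi : i ∈ X) (hi' : i ∈ Y) : Y ∈ treeLevel (sons x κ Cleaf) X k :=
  mem_treeLevel_of_mem (car := fun X : Finset (Fin N) => (X : Set (Fin N)))
    (fun _ _ h => Finset.coe_subset.2 (subset_of_mem_sons h))
    (fun _ _ h _ h' _ hi hi' => sons_eq_of_mem h h' hi hi') hX hY hi hi'

lemma subset_of_mem_treeLevel_sons {X R : Finset (Fin N)} {n : ℕ}
    (hX : X ∈ treeLevel (sons x κ Cleaf) R n) : X ⊆ R :=
  Finset.coe_subset.1 (treeLevel_subset (car := fun X : Finset (Fin N) => (X : Set (Fin N)))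
    (fun _ _ h => Finset.coe_subset.2 (subset_of_mem_sons h)) hX)

lemma nonempty_of_mem_treeLevel_sons (hx : Function.Injective x) (hκ : LongestEdge x κ)
    (hC : 2 ≤ Cleaf) {X R : Finset (Fin N)} (hR : R.Nonempty) {n : ℕ}
    (hX : X ∈ treeLevel (sons x κ Cleaf) R n) : X.Nonempty := by
  cases n with
  | zero => rw [Finset.mem_singleton.1 hX]; exact hR
  | succ n =>
    obtain ⟨Y, hY, hX⟩ := mem_treeLevel_succ.1 hX
    exact nonempty_of_mem_sons hx hκ hC hX

/-- A leaf of the cluster tree is contained in every cluster with which it shares a point. -/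
lemma leaf_subset_of_mem {X P : Finset (Fin N)} (hX : IsCluster x κ Cleaf X)
    (hl : sons x κ Cleaf X = ∅) (hP : IsCluster x κ Cleaf P) {i : Fin N} (hi : i ∈ X)
    (hi' : i ∈ P) : X ⊆ P := by
  obtain ⟨m, hm⟩ := isCluster_iff.1 hX
  obtain ⟨n, hn⟩ := isCluster_iff.1 hP
  rcases le_total m n with h | h
  · obtain ⟨k, rfl⟩ := Nat.exists_eq_add_of_le h
    rw [treeLevel_of_leaf hl (mem_treeLevel_sons_of_mem hm hn hi hi')]
  · obtain ⟨k, rfl⟩ := Nat.exists_eq_add_of_le h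
    exact subset_of_mem_treeLevel_sons (mem_treeLevel_sons_of_mem hn hm hi' hi)

/-- A cluster that contains a point of a son `S` of `X` contains `X` or is contained in `S`. -/
lemma subset_or_subset_of_mem_sons {X S P : Finset (Fin N)} (hX : IsCluster x κ Cleaf X)
    (hS : S ∈ sons x κ Cleaf X) (hP : IsCluster x κ Cleaf P) {i : Fin N} (hi : i ∈ S)
    (hi' : i ∈ P) : X ⊆ P ∨ P ⊆ S := by
  obtain ⟨m, hm⟩ := isCluster_iff.1 hX
  obtain ⟨n, hn⟩ := isCluster_iff.1 hP
  have hSm : S ∈ clusterLevel x κ Cleaf (m + 1) := mem_treeLevel_succ.2 ⟨X, hm, hS⟩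
  rcases le_or_gt n m with h | h
  · obtain ⟨k, rfl⟩ := Nat.exists_eq_add_of_le h
    exact Or.inl (subset_of_mem_treeLevel_sons
      (mem_treeLevel_sons_of_mem hn hm hi' (subset_of_mem_sons hS hi)))
  · obtain ⟨k, rfl⟩ := Nat.exists_eq_add_of_le (Nat.succ_le_of_lt h)
    exact Or.inr (subset_of_mem_treeLevel_sons (mem_treeLevel_sons_of_mem hSm hn hi hi'))

lemma exists_leaf_mem (hx : Function.Injective x) (hκ : LongestEdge x κ) (hC : 2 ≤ Cleaf)
    (i : Fin N) : ∃ X, IsCluster x κ Cleaf X ∧ sons x κ Cleaf X = ∅ ∧ i ∈ X := by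
  suffices h : ∀ c, ∀ X : Finset (Fin N), X.card = c → IsCluster x κ Cleaf X → i ∈ X →
      ∃ X, IsCluster x κ Cleaf X ∧ sons x κ Cleaf X = ∅ ∧ i ∈ X from
    h _ Finset.univ rfl .root (Finset.mem_univ i)
  intro c
  induction c using Nat.strong_induction_on with
  | _ c ih =>
    intro X hc hX hi
    by_cases hs : sons x κ Cleaf X = ∅
    · exact ⟨X, hX, hs, hi⟩
    · obtain ⟨S, hS, hiS⟩ := exists_mem_sons hs hi
      exact ih _ (hc ▸ card_lt_of_mem_sons hx hκ hC hS) S rfl (.son hX hS) hiS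

/-- After `d` bisections the longest edge has been halved. -/
lemma len_le_half (hx : Function.Injective x) (hκ : LongestEdge x κ) (hC : 2 ≤ Cleaf)
    {X Y : Finset (Fin N)} (hX : X.Nonempty) (hY : Y ∈ treeLevel (sons x κ Cleaf) X d) :
    len x κ Y ≤ len x κ X / 2 := by
  classical
  -- The decreasing quantity is the number of edges longer than half the initial length. As long as
  -- there are any, the longest edge is one of them and the bisection removes it; initially there
  -- are at most `d`.
  suffices h : ∀ k, ∀ Y ∈ treeLevel (sons x κ Cleaf) X k, len x κ Y ≤ len x κ X / 2 ∨
      (Finset.univ.filter fun j => len x κ X / 2 < (bbox x Y).edge j).card + k ≤ d by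
    rcases h d Y hY with h | h
    · exact h
    · have h0 : (Finset.univ.filter fun j => len x κ X / 2 < (bbox x Y).edge j) = ∅ :=
        Finset.card_eq_zero.1 (by omega)
      by_contra hlt
      have : κ Y ∈ (Finset.univ.filter fun j => len x κ X / 2 < (bbox x Y).edge j) := by
        exact Finset.mem_filter.2 ⟨Finset.mem_univ _, not_le.1 hlt⟩
      rw [h0] at this
      exact absurd this (Finset.notMem_empty _)
  intro k
  induction k with
  | zero =>
    intro Y _
    right
    simpa using Finset.card_filter_le (Finset.univ : Finset (Fin d)) _
  | succ k ih =>
    intro Y hY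
    obtain ⟨Z, hZ, hYZ⟩ := mem_treeLevel_succ.1 hY
    have hYne := nonempty_of_mem_sons hx hκ hC hYZ
    have hYsub := subset_of_mem_sons hYZ
    by_cases hlen : len x κ Z ≤ len x κ X / 2
    · exact Or.inl ((len_mono hκ hYne hYsub).trans hlen)
    · right
      have hc := (ih Z hZ).resolve_left hlen
      have hss : (Finset.univ.filter fun j => len x κ X / 2 < (bbox x Y).edge j) ⊂
          (Finset.univ.filter fun j => len x κ X / 2 < (bbox x Z).edge j) := by
        rw [Finset.ssubset_iff_of_subset]
        · refine ⟨κ Z, ?_, ?_⟩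
          · exact Finset.mem_filter.2 ⟨Finset.mem_univ _, not_le.1 hlen⟩
          · have h1 := edge_son_le hx hκ hC hYZ
            have h2 := len_mono hκ (nonempty_of_mem_treeLevel_sons hx hκ hC hX hZ)
              (subset_of_mem_treeLevel_sons hZ)
            simp only [Finset.mem_filter, Finset.mem_univ, true_and, not_lt]
            linarith
        · intro j hj
          simp only [Finset.mem_filter, Finset.mem_univ, true_and] at hj ⊢
          exact hj.trans_le (bbox_edge_mono hYne hYsub j)
      have := Finset.card_lt_card hss
      omega

/-- Iterating `len_le_half` bounds the depth of a cluster in terms of its size. The remaining `n %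
d` levels are only used for monotonicity. -/
lemma len_le_div_two_pow (hN : 0 < N) (hx : Function.Injective x) (hκ : LongestEdge x κ)
    (hC : 2 ≤ Cleaf) {n : ℕ} {X : Finset (Fin N)} (hX : X ∈ clusterLevel x κ Cleaf n) :
    len x κ X ≤ len x κ Finset.univ / 2 ^ (n / d) := by
  have hu : (Finset.univ : Finset (Fin N)).Nonempty := ⟨⟨0, hN⟩, Finset.mem_univ _⟩
  have h : ∀ q, ∀ Y ∈ clusterLevel x κ Cleaf (d * q),
      len x κ Y ≤ len x κ Finset.univ / 2 ^ q := by
    intro q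
    induction q with
    | zero =>
      intro Y hY
      rw [mul_zero] at hY
      rw [Finset.mem_singleton.1 hY]; simp
    | succ q ih =>
      intro Y hY
      rw [Nat.mul_succ] at hY
      obtain ⟨Z, hZ, hYZ⟩ := mem_treeLevel_add.1 hY
      have h1 := ih Z hZ
      have h2 := len_le_half hx hκ hC (nonempty_of_mem_treeLevel_sons hx hκ hC hu hZ) hYZ
      rw [pow_succ, ← div_div]
      linarith
  rw [← Nat.div_add_mod n d] at hX
  obtain ⟨Z, hZ, hXZ⟩ := mem_treeLevel_add.1 hX
  have hZne := nonempty_of_mem_treeLevel_sons hx hκ hC hu hZ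
  exact (len_mono hκ (nonempty_of_mem_treeLevel_sons hx hκ hC hZne hXZ)
    (subset_of_mem_treeLevel_sons hXZ)).trans (h _ Z hZ)

/-! ### Cells of clusters -/

/-- The cell of a cluster: the cube of side `A` at the root is cut along with the clusters, without
being shrunk to the bounding box. -/
inductive HasCell (x : Fin N → Pt d) (κ : Finset (Fin N) → Fin d) (Cleaf : ℕ) (A : ℝ) :
    ℕ → Finset (Fin N) → (Fin d → ℝ) → (Fin d → ℝ) → Prop
  | root : HasCell x κ Cleaf A 0 Finset.univ (bbox x Finset.univ).lo
      (fun k => (bbox x Finset.univ).lo k + A)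
  | lower {n : ℕ} {X : Finset (Fin N)} {lo hi : Fin d → ℝ} :
      HasCell x κ Cleaf A n X lo hi → Cleaf < X.card →
      HasCell x κ Cleaf A (n + 1) (lowerSon x κ X) lo
        (Function.update hi (κ X) (((bbox x X).lo (κ X) + (bbox x X).hi (κ X)) / 2))
  | upper {n : ℕ} {X : Finset (Fin N)} {lo hi : Fin d → ℝ} :
      HasCell x κ Cleaf A n X lo hi → Cleaf < X.card →
      HasCell x κ Cleaf A (n + 1) (X \ lowerSon x κ X)
        (Function.update lo (κ X) (((bbox x X).lo (κ X) + (bbox x X).hi (κ X)) / 2)) hi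

variable {A : ℝ}

lemma exists_hasCell (A : ℝ) {n : ℕ} {X : Finset (Fin N)} (hX : X ∈ clusterLevel x κ Cleaf n) :
    ∃ lo hi, HasCell x κ Cleaf A n X lo hi := by
  induction n generalizing X with
  | zero => rw [Finset.mem_singleton.1 hX]; exact ⟨_, _, .root⟩
  | succ n ih =>
    obtain ⟨Y, hY, hXY⟩ := mem_treeLevel_succ.1 hX
    obtain ⟨lo, hi, h⟩ := ih hY
    obtain ⟨hc, rfl | rfl⟩ := mem_sons.1 hXY
    · exact ⟨_, _, .lower h hc⟩
    · exact ⟨_, _, .upper h hc⟩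

/-- A cell contains the bounding box, and all its sides have at least half the length of the longest
edge of the bounding box. -/
lemma HasCell.bounds (hx : Function.Injective x) (hκ : LongestEdge x κ) (hC : 2 ≤ Cleaf)
    (hA : len x κ Finset.univ ≤ A) {n : ℕ} {X : Finset (Fin N)} {lo hi : Fin d → ℝ}
    (h : HasCell x κ Cleaf A n X lo hi) (k : Fin d) :
    lo k ≤ (bbox x X).lo k ∧ (bbox x X).hi k ≤ hi k ∧ len x κ X / 2 ≤ hi k - lo k := by
  induction h generalizing k with
  | root =>
    have h1 := hκ Finset.univ k
    have h2 := len_nonneg x κ Finset.univ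
    rw [len] at hA h2 ⊢
    rw [Box.edge] at h1
    refine ⟨le_rfl, ?_, ?_⟩ <;> linarith
  | @lower n X lo hi h hc ih =>
    have hS := mem_sons.2 ⟨hc, Or.inl (rfl : lowerSon x κ X = _)⟩
    have hne := nonempty_of_mem_sons hx hκ hC hS
    have hsub := subset_of_mem_sons hS
    have hlen := len_mono hκ hne hsub
    have ihk := ih k
    have hlo := bbox_lo_anti (x := x) hne hsub k
    refine ⟨ihk.1.trans hlo, ?_, ?_⟩
    · rcases eq_or_ne k (κ X) with rfl | hk
      · rw [Function.update_self]
        obtain ⟨j, hj, hjh⟩ := exists_bbox_hi_eq x hne (κ X)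
        rw [← hjh]
        exact (mem_lowerSon.1 hj).2
      · rw [Function.update_of_ne hk]
        exact (bbox_hi_mono hne hsub k).trans ihk.2.1
    · rcases eq_or_ne k (κ X) with rfl | hk
      · rw [Function.update_self]
        -- The cut side still contains the lower half of the bounding box's edge, which has length
        -- `len x κ X / 2`.
        have e : len x κ X = (bbox x X).hi (κ X) - (bbox x X).lo (κ X) := rfl
        linarith [ihk.1]
      · rw [Function.update_of_ne hk]
        linarith [ihk.2.2]
  | @upper n X lo hi h hc ih =>
    have hS := mem_sons.2 ⟨hc, Or.inr (rfl : X \ lowerSon x κ X = _)⟩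
    have hne := nonempty_of_mem_sons hx hκ hC hS
    have hsub := subset_of_mem_sons hS
    have hlen := len_mono hκ hne hsub
    have ihk := ih k
    have hhi := bbox_hi_mono (x := x) hne hsub k
    refine ⟨?_, hhi.trans ihk.2.1, ?_⟩
    · rcases eq_or_ne k (κ X) with rfl | hk
      · rw [Function.update_self]
        obtain ⟨j, hj, hjh⟩ := exists_bbox_lo_eq x hne (κ X)
        rw [← hjh]
        exact (mem_upperSon.1 hj).2.le
      · rw [Function.update_of_ne hk]
        exact ihk.1.trans (bbox_lo_anti hne hsub k)
    · rcases eq_or_ne k (κ X) with rfl | hk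
      · rw [Function.update_self]
        have e : len x κ X = (bbox x X).hi (κ X) - (bbox x X).lo (κ X) := rfl
        linarith [ihk.2.1]
      · rw [Function.update_of_ne hk]
        linarith [ihk.2.2]

/-- The open cells at the same depth are disjoint. -/
lemma HasCell.eq_or_disjoint {n : ℕ} {X X' : Finset (Fin N)} {lo hi lo' hi' : Fin d → ℝ}
    (h : HasCell x κ Cleaf A n X lo hi) (h' : HasCell x κ Cleaf A n X' lo' hi')
    (hsub : ∀ {n X lo hi}, HasCell x κ Cleaf A n X lo hi → ∀ k, lo k ≤ (bbox x X).lo k ∧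
      (bbox x X).hi k ≤ hi k) :
    (X = X' ∧ lo = lo' ∧ hi = hi') ∨ ∃ k, hi k ≤ lo' k ∨ hi' k ≤ lo k := by
  have hmid : ∀ {n X lo hi}, HasCell x κ Cleaf A n X lo hi → ∀ j,
      lo j ≤ ((bbox x X).lo j + (bbox x X).hi j) / 2 ∧
      ((bbox x X).lo j + (bbox x X).hi j) / 2 ≤ hi j := by
    intro n X lo hi h j
    have h1 := hsub h j
    have h2 := bbox_lo_le_hi x X j
    constructor <;> linarith [h1.1, h1.2]
  have hup : ∀ {n X lo hi}, HasCell x κ Cleaf A n X lo hi → ∀ k,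
      Function.update hi (κ X) (((bbox x X).lo (κ X) + (bbox x X).hi (κ X)) / 2) k ≤ hi k ∧
      lo k ≤ Function.update lo (κ X) (((bbox x X).lo (κ X) + (bbox x X).hi (κ X)) / 2) k := by
    intro n X lo hi h k
    rcases eq_or_ne k (κ X) with rfl | hk
    · simp only [Function.update_self]
      exact ⟨(hmid h _).2, (hmid h _).1⟩
    · simp [hk]
  induction n generalizing X X' lo hi lo' hi' with
  | zero =>
    cases h; cases h'
    exact Or.inl ⟨rfl, rfl, rfl⟩
  | succ n ih =>
    cases h with
    | lower h hc =>
      cases h' with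
      | lower h' hc' =>
        rcases ih h h' with ⟨rfl, rfl, rfl⟩ | ⟨k, hk⟩
        · exact Or.inl ⟨rfl, rfl, rfl⟩
        · exact Or.inr ⟨k, hk.imp ((hup h k).1.trans) ((hup h' k).1.trans)⟩
      | upper h' hc' =>
        rcases ih h h' with ⟨rfl, rfl, rfl⟩ | ⟨k, hk⟩
        · exact Or.inr ⟨κ _, Or.inl
            (le_of_eq (by rw [Function.update_self, Function.update_self]))⟩
        · exact Or.inr ⟨k, hk.imp (fun e => (hup h k).1.trans (e.trans (hup h' k).2)) id⟩
    | upper h hc =>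
      cases h' with
      | lower h' hc' =>
        rcases ih h h' with ⟨rfl, rfl, rfl⟩ | ⟨k, hk⟩
        · exact Or.inr ⟨κ _, Or.inr
            (le_of_eq (by rw [Function.update_self, Function.update_self]))⟩
        · exact Or.inr ⟨k, hk.imp id (fun e => (hup h' k).1.trans (e.trans (hup h k).2))⟩
      | upper h' hc' =>
        rcases ih h h' with ⟨rfl, rfl, rfl⟩ | ⟨k, hk⟩
        · exact Or.inl ⟨rfl, rfl, rfl⟩
        · exact Or.inr ⟨k, hk.imp (fun e => e.trans (hup h' k).2) (fun e => e.trans (hup h k).2)⟩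

/-- Cells shrink on the way down, because the cut at the midpoint of the bounding box lies inside
the cell. Cells of different depths can thus be compared at the smaller depth. -/
lemma HasCell.exists_ancestor (hx : Function.Injective x) (hκ : LongestEdge x κ) (hC : 2 ≤ Cleaf)
    (hA : len x κ Finset.univ ≤ A) {n k : ℕ} {X : Finset (Fin N)} {lo hi : Fin d → ℝ}
    (h : HasCell x κ Cleaf A (n + k) X lo hi) :
    ∃ Y lo' hi', HasCell x κ Cleaf A n Y lo' hi' ∧ X ∈ treeLevel (sons x κ Cleaf) Y k ∧
      (∀ j, lo' j ≤ lo j) ∧ ∀ j, hi j ≤ hi' j := by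
  induction k generalizing X lo hi with
  | zero => exact ⟨X, lo, hi, h, Finset.mem_singleton_self _, fun _ => le_rfl, fun _ => le_rfl⟩
  | succ k ih =>
    rw [← add_assoc] at h
    cases h with
    | @lower _ Z lo hi h hc =>
      obtain ⟨Y, lo', hi', h1, h2, h3, h4⟩ := ih h
      refine ⟨Y, lo', hi', h1, mem_treeLevel_succ.2 ⟨_, h2, mem_sons.2 ⟨hc, Or.inl rfl⟩⟩, h3,
        fun j => ?_⟩
      rcases eq_or_ne j (κ Z) with rfl | hj
      · rw [Function.update_self]
        have := h.bounds hx hκ hC hA (κ Z)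
        have h5 := bbox_lo_le_hi x Z (κ Z)
        linarith [this.2.1, h4 (κ Z)]
      · rw [Function.update_of_ne hj]; exact h4 j
    | @upper _ Z lo hi h hc =>
      obtain ⟨Y, lo', hi', h1, h2, h3, h4⟩ := ih h
      refine ⟨Y, lo', hi', h1, mem_treeLevel_succ.2 ⟨_, h2, mem_sons.2 ⟨hc, Or.inr rfl⟩⟩,
        fun j => ?_, h4⟩
      rcases eq_or_ne j (κ Z) with rfl | hj
      · rw [Function.update_self]
        have := h.bounds hx hκ hC hA (κ Z)
        have h5 := bbox_lo_le_hi x Z (κ Z)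
        linarith [this.1, h3 (κ Z)]
      · rw [Function.update_of_ne hj]; exact h3 j

/-- The open cells of two clusters are disjoint, unless one cluster is a descendant of the other. -/
lemma HasCell.disjoint_or_descendant (hx : Function.Injective x) (hκ : LongestEdge x κ)
    (hC : 2 ≤ Cleaf) (hA : len x κ Finset.univ ≤ A) {n k : ℕ} {X X' : Finset (Fin N)}
    {lo hi lo' hi' : Fin d → ℝ} (h : HasCell x κ Cleaf A n X lo hi)
    (h' : HasCell x κ Cleaf A (n + k) X' lo' hi') :
    X' ∈ treeLevel (sons x κ Cleaf) X k ∨ ∃ j, hi j ≤ lo' j ∨ hi' j ≤ lo j := by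
  obtain ⟨Y, lo₁, hi₁, h1, h2, h3, h4⟩ := h'.exists_ancestor hx hκ hC hA
  rcases h.eq_or_disjoint h1 (fun h k => ⟨(h.bounds hx hκ hC hA k).1, (h.bounds hx hκ hC hA k).2.1⟩)
    with ⟨rfl, -, -⟩ | ⟨j, hj⟩
  · exact Or.inl h2
  · exact Or.inr ⟨j, hj.imp (fun e => e.trans (h3 j)) (fun e => (h4 j).trans e)⟩

end Clusters

/-! ### The block-cluster tree -/

section Blocks

variable {d N : ℕ} {x : Fin N → Pt d} {κ : Finset (Fin N) → Fin d} {Cleaf : ℕ} {η : ℝ}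

/-- The sons of a block that is not a leaf. -/
lemma mem_blockSons {b b' : Finset (Fin N) × Finset (Fin N)} :
    b' ∈ blockSons x κ Cleaf η b ↔
      ¬ Admissible η (bbox x b.1) (bbox x b.2) ∧
      ¬ (sons x κ Cleaf b.1 = ∅ ∧ sons x κ Cleaf b.2 = ∅) ∧
      (b'.1 ∈ sons x κ Cleaf b.1 ∨ sons x κ Cleaf b.1 = ∅ ∧ b'.1 = b.1) ∧
      (b'.2 ∈ sons x κ Cleaf b.2 ∨ sons x κ Cleaf b.2 = ∅ ∧ b'.2 = b.2) := by
  unfold blockSons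
  by_cases ha : Admissible η (bbox x b.1) (bbox x b.2)
  · simp [ha]
  by_cases h1 : sons x κ Cleaf b.1 = ∅ <;> by_cases h2 : sons x κ Cleaf b.2 = ∅ <;>
    simp [ha, h1, h2, Finset.mem_product, -Finset.singleton_product, -Finset.product_singleton]

lemma blockSons_eq_empty {b : Finset (Fin N) × Finset (Fin N)} :
    blockSons x κ Cleaf η b = ∅ ↔ Admissible η (bbox x b.1) (bbox x b.2) ∨
      (sons x κ Cleaf b.1 = ∅ ∧ sons x κ Cleaf b.2 = ∅) := by
  constructor
  · intro h
    by_contra hn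
    push Not at hn
    have hs : ∀ X : Finset (Fin N), ∃ S, S ∈ sons x κ Cleaf X ∨ sons x κ Cleaf X = ∅ ∧ S = X := by
      intro X
      rcases (sons x κ Cleaf X).eq_empty_or_nonempty with h | ⟨S, hS⟩
      · exact ⟨X, Or.inr ⟨h, rfl⟩⟩
      · exact ⟨S, Or.inl hS⟩
    obtain ⟨S, hS⟩ := hs b.1
    obtain ⟨S', hS'⟩ := hs b.2
    have : (S, S') ∈ blockSons x κ Cleaf η b :=
      mem_blockSons.2 ⟨hn.1, fun h => (hn.2 h.1).ne_empty h.2, hS, hS'⟩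
    rw [h] at this
    exact absurd this (Finset.notMem_empty _)
  · intro h
    unfold blockSons
    rw [if_pos h]

lemma card_blockSons_le (b : Finset (Fin N) × Finset (Fin N)) :
    (blockSons x κ Cleaf η b).card ≤ 4 := by
  have h1 := card_sons_le (x := x) (κ := κ) (Cleaf := Cleaf) b.1
  have h2 := card_sons_le (x := x) (κ := κ) (Cleaf := Cleaf) b.2
  unfold blockSons
  split_ifs
  · simp
  · rw [Finset.card_product, Finset.card_singleton]; omega
  · rw [Finset.card_product, Finset.card_singleton]; omega
  · rw [Finset.card_product]; exact Nat.mul_le_mul h1 h2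

/-- Both clusters descend together until one of them is a leaf; from then on only the other one
descends. Hence in a block of unequal depths the shallower cluster is a leaf. -/
lemma IsBlock.exists_level {b : Finset (Fin N) × Finset (Fin N)} (h : IsBlock x κ Cleaf η b) :
    ∃ n m, b.1 ∈ clusterLevel x κ Cleaf n ∧ b.2 ∈ clusterLevel x κ Cleaf m ∧
      (n = m ∨ (n < m ∧ sons x κ Cleaf b.1 = ∅) ∨ (m < n ∧ sons x κ Cleaf b.2 = ∅)) := by
  induction h with
  | root => exact ⟨0, 0, Finset.mem_singleton_self _, Finset.mem_singleton_self _, Or.inl rfl⟩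
  | @son b b' _ hs ih =>
    obtain ⟨n, m, hn, hm, hnm⟩ := ih
    obtain ⟨-, hnl, h1, h2⟩ := mem_blockSons.1 hs
    rcases h1 with h1 | ⟨h1, e1⟩ <;> rcases h2 with h2 | ⟨h2, e2⟩
    · refine ⟨n + 1, m + 1, mem_treeLevel_succ.2 ⟨_, hn, h1⟩, mem_treeLevel_succ.2 ⟨_, hm, h2⟩,
        Or.inl ?_⟩
      rcases hnm with rfl | ⟨-, h⟩ | ⟨-, h⟩
      · rfl
      · rw [h] at h1; exact absurd h1 (Finset.notMem_empty _)
      · rw [h] at h2; exact absurd h2 (Finset.notMem_empty _)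
    · refine ⟨n + 1, m, mem_treeLevel_succ.2 ⟨_, hn, h1⟩, by rwa [e2], Or.inr (Or.inr ⟨?_, ?_⟩)⟩
      · rcases hnm with rfl | ⟨-, h⟩ | ⟨h, -⟩
        · omega
        · rw [h] at h1; exact absurd h1 (Finset.notMem_empty _)
        · omega
      · rwa [e2]
    · refine ⟨n, m + 1, by rwa [e1], mem_treeLevel_succ.2 ⟨_, hm, h2⟩, Or.inr (Or.inl ⟨?_, ?_⟩)⟩
      · rcases hnm with rfl | ⟨h, -⟩ | ⟨-, h⟩
        · omega
        · omega
        · rw [h] at h2; exact absurd h2 (Finset.notMem_empty _)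
      · rwa [e1]
    · exact absurd ⟨h1, h2⟩ hnl

lemma IsBlock.isCluster {b : Finset (Fin N) × Finset (Fin N)} (h : IsBlock x κ Cleaf η b) :
    IsCluster x κ Cleaf b.1 ∧ IsCluster x κ Cleaf b.2 := by
  obtain ⟨n, m, hn, hm, -⟩ := h.exists_level
  exact ⟨isCluster_iff.2 ⟨n, hn⟩, isCluster_iff.2 ⟨m, hm⟩⟩

/-- The pairs of indices in a block. -/
def blockSet (b : Finset (Fin N) × Finset (Fin N)) : Set (Fin N × Fin N) :=
  {ij | ij.1 ∈ b.1 ∧ ij.2 ∈ b.2}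

lemma blockSons_subset {b b' : Finset (Fin N) × Finset (Fin N)}
    (h : b' ∈ blockSons x κ Cleaf η b) : b'.1 ⊆ b.1 ∧ b'.2 ⊆ b.2 := by
  obtain ⟨-, -, h1, h2⟩ := mem_blockSons.1 h
  refine ⟨?_, ?_⟩
  · rcases h1 with h | ⟨-, h⟩
    · exact subset_of_mem_sons h
    · rw [h]
  · rcases h2 with h | ⟨-, h⟩
    · exact subset_of_mem_sons h
    · rw [h]

lemma blockSons_eq_of_mem {b b' b'' : Finset (Fin N) × Finset (Fin N)}
    (h : b' ∈ blockSons x κ Cleaf η b) (h' : b'' ∈ blockSons x κ Cleaf η b) {ij : Fin N × Fin N}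
    (hi : ij ∈ blockSet b') (hj : ij ∈ blockSet b'') : b' = b'' := by
  obtain ⟨-, -, h1, h2⟩ := mem_blockSons.1 h
  obtain ⟨-, -, h1', h2'⟩ := mem_blockSons.1 h'
  have key : ∀ {X S S' : Finset (Fin N)} {i}, (S ∈ sons x κ Cleaf X ∨ sons x κ Cleaf X = ∅ ∧ S = X) →
      (S' ∈ sons x κ Cleaf X ∨ sons x κ Cleaf X = ∅ ∧ S' = X) → i ∈ S → i ∈ S' → S = S' := by
    intro X S S' i hS hS' hi hi'
    rcases hS with hS | ⟨e, hS⟩ <;> rcases hS' with hS' | ⟨e', hS'⟩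
    · exact sons_eq_of_mem hS hS' hi hi'
    · rw [e'] at hS; exact absurd hS (Finset.notMem_empty _)
    · rw [e] at hS'; exact absurd hS' (Finset.notMem_empty _)
    · rw [hS, hS']
  exact Prod.ext (key h1 h1' hi.1 hj.1) (key h2 h2' hi.2 hj.2)

lemma IsBlock.exists_treeLevel {b : Finset (Fin N) × Finset (Fin N)} (h : IsBlock x κ Cleaf η b) :
    ∃ n, b ∈ treeLevel (blockSons x κ Cleaf η) (Finset.univ, Finset.univ) n := by
  induction h with
  | root => exact ⟨0, Finset.mem_singleton_self _⟩
  | son _ hs ih =>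
    obtain ⟨n, hn⟩ := ih
    exact ⟨n + 1, mem_treeLevel_succ.2 ⟨_, hn, hs⟩⟩

/-- Two leaf blocks with a common pair of indices are equal. -/
lemma leafBlock_unique {b b' : Finset (Fin N) × Finset (Fin N)} (h : IsBlock x κ Cleaf η b)
    (hl : blockSons x κ Cleaf η b = ∅) (h' : IsBlock x κ Cleaf η b')
    (hl' : blockSons x κ Cleaf η b' = ∅) {ij : Fin N × Fin N} (hi : ij ∈ blockSet b)
    (hi' : ij ∈ blockSet b') : b = b' := by
  obtain ⟨n, hn⟩ := h.exists_treeLevel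
  obtain ⟨m, hm⟩ := h'.exists_treeLevel
  have hsub : ∀ b : Finset (Fin N) × Finset (Fin N), ∀ b' ∈ blockSons x κ Cleaf η b,
      blockSet b' ⊆ blockSet b := fun b b' hb ij hij =>
    ⟨(blockSons_subset hb).1 hij.1, (blockSons_subset hb).2 hij.2⟩
  have hdis : ∀ b : Finset (Fin N) × Finset (Fin N), ∀ b' ∈ blockSons x κ Cleaf η b,
      ∀ c ∈ blockSons x κ Cleaf η b, ∀ ij, ij ∈ blockSet b' → ij ∈ blockSet c → b' = c :=
    fun b b' hb c hc ij hij hij' => blockSons_eq_of_mem hb hc hij hij'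
  rcases le_total n m with hle | hle
  · obtain ⟨k, rfl⟩ := Nat.exists_eq_add_of_le hle
    exact (treeLevel_of_leaf hl (mem_treeLevel_of_mem hsub hdis hn hm hi hi')).symm
  · obtain ⟨k, rfl⟩ := Nat.exists_eq_add_of_le hle
    exact treeLevel_of_leaf hl' (mem_treeLevel_of_mem hsub hdis hm hn hi' hi)

/-- Descend to the son containing `(i, j)`; the sum of the two cardinalities drops. Together with
`leafBlock_unique` this makes the leaf blocks a partition of the index pairs. -/
lemma exists_leafBlock (hx : Function.Injective x) (hκ : LongestEdge x κ) (hC : 2 ≤ Cleaf)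
    (i j : Fin N) : ∃ b, IsBlock x κ Cleaf η b ∧ blockSons x κ Cleaf η b = ∅ ∧ i ∈ b.1 ∧ j ∈ b.2 := by
  suffices h : ∀ c, ∀ b : Finset (Fin N) × Finset (Fin N), b.1.card + b.2.card = c →
      IsBlock x κ Cleaf η b → i ∈ b.1 → j ∈ b.2 →
      ∃ b, IsBlock x κ Cleaf η b ∧ blockSons x κ Cleaf η b = ∅ ∧ i ∈ b.1 ∧ j ∈ b.2 from
    h _ (Finset.univ, Finset.univ) rfl .root (Finset.mem_univ i) (Finset.mem_univ j)
  have key : ∀ (X : Finset (Fin N)) (i), i ∈ X →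
      ∃ S, (S ∈ sons x κ Cleaf X ∨ sons x κ Cleaf X = ∅ ∧ S = X) ∧ i ∈ S ∧ S.card ≤ X.card ∧
        (sons x κ Cleaf X ≠ ∅ → S.card < X.card) := by
    intro X i hi
    by_cases hs : sons x κ Cleaf X = ∅
    · exact ⟨X, Or.inr ⟨hs, rfl⟩, hi, le_rfl, fun h => absurd hs h⟩
    · obtain ⟨S, hS, hiS⟩ := exists_mem_sons hs hi
      have := card_lt_of_mem_sons hx hκ hC hS
      exact ⟨S, Or.inl hS, hiS, this.le, fun _ => this⟩
  intro c
  induction c using Nat.strong_induction_on with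
  | _ c ih =>
    intro b hc hb hi hj
    by_cases hs : blockSons x κ Cleaf η b = ∅
    · exact ⟨b, hb, hs, hi, hj⟩
    · obtain ⟨S, hS, hiS, hle, hlt⟩ := key b.1 i hi
      obtain ⟨S', hS', hjS', hle', hlt'⟩ := key b.2 j hj
      rw [blockSons_eq_empty, not_or] at hs
      have hcard : S.card + S'.card < c := by
        by_cases h1 : sons x κ Cleaf b.1 = ∅
        · have := hlt' fun h2 => hs.2 ⟨h1, h2⟩
          omega
        · have := hlt h1
          omega
      exact ih _ hcard (S, S') rfl (.son hb (mem_blockSons.2 ⟨hs.1, hs.2, hS, hS'⟩)) hiS hjS'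

end Blocks

/-! ### Packing and counting -/

/-- The total volume of disjoint cubes in a cube. -/
lemma sum_pow_le_of_disjoint_cubes {d : ℕ} {ι : Type*} (I : Finset ι) (u : ι → Fin d → ℝ)
    (t : ι → ℝ) (ht : ∀ i ∈ I, 0 ≤ t i) (c : Fin d → ℝ) {R : ℝ} (hR : 0 ≤ R)
    (hsub : ∀ i ∈ I, ∀ k, c k - R ≤ u i k ∧ u i k + t i ≤ c k + R)
    (hdis : ∀ i ∈ I, ∀ j ∈ I, i ≠ j → ∃ k, u i k + t i ≤ u j k ∨ u j k + t j ≤ u i k) :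
    ∑ i ∈ I, t i ^ d ≤ (2 * R) ^ d := by
  have hpd : (I : Set ι).PairwiseDisjoint
      fun i => Set.pi Set.univ fun k => Set.Ioo (u i k) (u i k + t i) := by
    intro i hi j hj hij
    obtain ⟨k, hk⟩ := hdis i hi j hj hij
    refine Set.disjoint_left.2 fun y hy hy' => ?_
    have h1 := hy k (Set.mem_univ k)
    have h2 := hy' k (Set.mem_univ k)
    rcases hk with hk | hk
    · linarith [h1.2, h2.1]
    · linarith [h2.2, h1.1]
  have hvol := MeasureTheory.measure_biUnion_finset (μ := MeasureTheory.volume) hpd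
    (fun i _ => MeasurableSet.univ_pi fun k => measurableSet_Ioo)
  have hle : MeasureTheory.volume (⋃ i ∈ I, Set.pi Set.univ fun k => Set.Ioo (u i k) (u i k + t i)) ≤
      MeasureTheory.volume (Set.pi Set.univ fun k => Set.Icc (c k - R) (c k + R)) := by
    apply MeasureTheory.measure_mono
    refine Set.iUnion₂_subset fun i hi => Set.pi_mono fun k _ y hy => ?_
    have := hsub i hi k
    exact ⟨by linarith [hy.1], by linarith [hy.2]⟩
  have e1 : ∀ i ∈ I, MeasureTheory.volume
      (Set.pi Set.univ fun k => Set.Ioo (u i k) (u i k + t i)) = ENNReal.ofReal (t i ^ d) := by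
    intro i hi
    rw [Real.volume_pi_Ioo]
    simp [ENNReal.ofReal_pow (ht i hi)]
  have e2 : MeasureTheory.volume (Set.pi Set.univ fun k => Set.Icc (c k - R) (c k + R)) =
      ENNReal.ofReal ((2 * R) ^ d) := by
    have e : ∀ k, c k + R - (c k - R) = 2 * R := fun k => by ring
    rw [Set.pi_univ_Icc, Real.volume_Icc_pi]
    simp [e, ENNReal.ofReal_pow (by positivity : 0 ≤ 2 * R)]
  rw [hvol, Finset.sum_congr rfl e1, e2,
    ← ENNReal.ofReal_sum_of_nonneg (fun i hi => pow_nonneg (ht i hi) d)] at hle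
  exact (ENNReal.ofReal_le_ofReal_iff (by positivity)).1 hle

/-- The geometric situation in which clusters are counted: `A` bounds the extent of the point set,
and different points have distance at least `s` in some coordinate. -/
structure Geometry {d N : ℕ} (x : Fin N → Pt d) (κ : Finset (Fin N) → Fin d) (Cleaf : ℕ)
    (A s : ℝ) : Prop where
  d_pos : 0 < d
  N_pos : 0 < N
  longest : LongestEdge x κ
  leaf : 2 ≤ Cleaf
  len_le : len x κ Finset.univ ≤ A
  s_pos : 0 < s
  s_le : s ≤ A
  sep : ∀ i j, i ≠ j → ∃ k, s ≤ |x i k - x j k|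

section Counting

variable {d N : ℕ} {x : Fin N → Pt d} {κ : Finset (Fin N) → Fin d} {Cleaf : ℕ} {A s η : ℝ}

namespace Geometry

lemma A_pos (h : Geometry x κ Cleaf A s) : 0 < A := h.s_pos.trans_le h.s_le

lemma injective (h : Geometry x κ Cleaf A s) : Function.Injective x := by
  intro i j hij
  by_contra hne
  obtain ⟨k, hk⟩ := h.sep i j hne
  rw [hij, sub_self, abs_zero] at hk
  exact absurd h.s_pos (not_lt.2 hk)

lemma s_le_len (h : Geometry x κ Cleaf A s) {X : Finset (Fin N)} (hX : 0 < len x κ X) :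
    s ≤ len x κ X := by
  have hc : 1 < X.card := by
    by_contra hle
    have hsub := Finset.card_le_one.1 (not_lt.1 hle)
    rcases X.eq_empty_or_nonempty with rfl | hne
    · simp [len, Box.edge, bbox] at hX
    · obtain ⟨i, hi, hil⟩ := exists_bbox_lo_eq x hne (κ X)
      obtain ⟨j, hj, hjh⟩ := exists_bbox_hi_eq x hne (κ X)
      rw [len, Box.edge, ← hil, ← hjh, hsub i hi j hj, sub_self] at hX
      exact lt_irrefl _ hX
  obtain ⟨i, hi, j, hj, hij⟩ := Finset.one_lt_card.1 hc
  obtain ⟨k, hk⟩ := h.sep i j hij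
  exact hk.trans (abs_sub_le_len h.longest (mem_bbox x hi) (mem_bbox x hj) k)

lemma nonempty (h : Geometry x κ Cleaf A s) {X : Finset (Fin N)} (hX : IsCluster x κ Cleaf X) :
    X.Nonempty := hX.nonempty h.N_pos h.injective h.longest h.leaf

lemma len_le_A (h : Geometry x κ Cleaf A s) {X : Finset (Fin N)} (hX : IsCluster x κ Cleaf X) :
    len x κ X ≤ A :=
  (len_mono h.longest (h.nonempty hX) (Finset.subset_univ _)).trans h.len_le

lemma abs_sub_le_A (h : Geometry x κ Cleaf A s) (i j : Fin N) (k : Fin d) :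
    |x i k - x j k| ≤ A :=
  (abs_sub_le_len h.longest (mem_bbox x (Finset.mem_univ i)) (mem_bbox x (Finset.mem_univ j))
    k).trans h.len_le

/-- Packing estimate for clusters none of which is a descendant of another one. -/
lemma sum_len_pow_le (h : Geometry x κ Cleaf A s) (F : Finset (Finset (Fin N)))
    (lv : Finset (Fin N) → ℕ) (hlv : ∀ X ∈ F, X ∈ clusterLevel x κ Cleaf (lv X))
    (hanti : ∀ X ∈ F, ∀ X' ∈ F, X ≠ X' → ∀ k, lv X' = lv X + k →
      X' ∉ treeLevel (sons x κ Cleaf) X k)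
    (y : Fin d → ℝ) {R b : ℝ} (hR : 0 ≤ R) (hb : 0 ≤ b)
    (hnear : ∀ X ∈ F, ∃ i ∈ X, ∀ k, |x i k - y k| ≤ R) (hlen : ∀ X ∈ F, len x κ X ≤ b) :
    ∑ X ∈ F, (len x κ X / 2) ^ d ≤ (2 * R + b) ^ d := by
  have hcell : ∀ X : Finset (Fin N), ∃ lo hi : Fin d → ℝ, X ∈ F →
      HasCell x κ Cleaf A (lv X) X lo hi := by
    intro X
    by_cases hX : X ∈ F
    · obtain ⟨lo, hi, hc⟩ := exists_hasCell A (hlv X hX)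
      exact ⟨lo, hi, fun _ => hc⟩
    · exact ⟨0, 0, fun h => absurd h hX⟩
  choose lo hi hc using hcell
  have hpt : ∀ X : Finset (Fin N), ∃ i : Fin N, X ∈ F → i ∈ X ∧ ∀ k, |x i k - y k| ≤ R := by
    intro X
    by_cases hX : X ∈ F
    · obtain ⟨i, hi, hk⟩ := hnear X hX
      exact ⟨i, fun _ => ⟨hi, hk⟩⟩
    · exact ⟨⟨0, h.N_pos⟩, fun h => absurd h hX⟩
  choose pt hpt using hpt
  have hbd := fun X hX k => (hc X hX).bounds h.injective h.longest h.leaf h.len_le k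
  -- Lower corner of a cube of side `len / 2` that lies in the cell and has the chosen point in its
  -- closure. The maximum pushes the cube into the cell, whose sides are long enough.
  set u : Finset (Fin N) → Fin d → ℝ := fun X k => max (lo X k) (x (pt X) k - len x κ X / 2) with hu
  have hul : ∀ X ∈ F, ∀ k, lo X k ≤ u X k := fun X _ k => le_max_left _ _
  have huh : ∀ X ∈ F, ∀ k, u X k + len x κ X / 2 ≤ hi X k := by
    intro X hX k
    have h1 := hbd X hX k
    have h2 := le_bbox_hi x (hpt X hX).1 k
    rcases max_choice (lo X k) (x (pt X) k - len x κ X / 2) with e | e <;>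
      simp only [hu, e] <;> linarith [h1.1, h1.2.1, h1.2.2]
  have key := sum_pow_le_of_disjoint_cubes F u (fun X => len x κ X / 2)
    (fun X _ => by have := len_nonneg x κ X; positivity) y (R := R + b / 2) (by positivity) ?_ ?_
  · rw [show 2 * R + b = 2 * (R + b / 2) by ring]; exact key
  · intro X hX k
    have h1 := hbd X hX k
    have h2 := abs_le.1 ((hpt X hX).2 k)
    have h3 := hlen X hX
    have h4 := bbox_lo_le x (hpt X hX).1 k
    have h5 := len_nonneg x κ X
    constructor
    · exact le_trans (by linarith [h2.1]) (le_max_right _ _)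
    · have : u X k ≤ x (pt X) k := max_le (by linarith [h1.1]) (by linarith)
      linarith [h2.2]
  · intro X hX X' hX' hne
    have hcase : ∀ {Y Y' : Finset (Fin N)}, Y ∈ F → Y' ∈ F → Y ≠ Y' → lv Y ≤ lv Y' →
        ∃ j, hi Y j ≤ lo Y' j ∨ hi Y' j ≤ lo Y j := by
      intro Y Y' hY hY' hne hle
      obtain ⟨k, hk⟩ := Nat.exists_eq_add_of_le hle
      have h' := hc Y' hY'
      rw [hk] at h'
      exact ((hc Y hY).disjoint_or_descendant h.injective h.longest h.leaf h.len_le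
        h').resolve_left (hanti Y hY Y' hY' hne k hk)
    rcases le_total (lv X) (lv X') with hle | hle
    · obtain ⟨j, hj⟩ := hcase hX hX' hne hle
      exact ⟨j, hj.imp (fun e => ((huh X hX j).trans e).trans (hul X' hX' j))
        (fun e => ((huh X' hX' j).trans e).trans (hul X hX j))⟩
    · obtain ⟨j, hj⟩ := hcase hX' hX hne.symm hle
      exact ⟨j, hj.symm.imp (fun e => ((huh X hX j).trans e).trans (hul X' hX' j))
        (fun e => ((huh X' hX' j).trans e).trans (hul X hX j))⟩

open Classical in
/-- The number of clusters of a given size near a given point. -/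
lemma card_scale_le (h : Geometry x κ Cleaf A s) (y : Fin d → ℝ) {R b : ℝ} (hR : 0 ≤ R)
    (hb : 0 < b) :
    ((Finset.univ.filter fun X : Finset (Fin N) => IsCluster x κ Cleaf X ∧ b < len x κ X ∧
      len x κ X ≤ 2 * b ∧ ∃ i ∈ X, ∀ k, |x i k - y k| ≤ R).card : ℝ) ≤
      d * (4 * (R + b) / b) ^ d := by
  set F := Finset.univ.filter fun X : Finset (Fin N) => IsCluster x κ Cleaf X ∧ b < len x κ X ∧
      len x κ X ≤ 2 * b ∧ ∃ i ∈ X, ∀ k, |x i k - y k| ≤ R with hF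
  have hlv : ∀ X : Finset (Fin N), ∃ n, IsCluster x κ Cleaf X → X ∈ clusterLevel x κ Cleaf n := by
    intro X
    by_cases hX : IsCluster x κ Cleaf X
    · obtain ⟨n, hn⟩ := isCluster_iff.1 hX
      exact ⟨n, fun _ => hn⟩
    · exact ⟨0, fun h => absurd h hX⟩
  choose lv hlv using hlv
  have hmem : ∀ X ∈ F, IsCluster x κ Cleaf X ∧ b < len x κ X ∧ len x κ X ≤ 2 * b ∧
      ∃ i ∈ X, ∀ k, |x i k - y k| ≤ R := fun X hX => (Finset.mem_filter.1 hX).2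
  -- Among clusters whose depths agree modulo `d`, a proper descendant is at least `d` levels
  -- deeper, so its length is at most half. This is impossible for lengths in `(b, 2b]`, so each
  -- residue class satisfies the assumption of the packing estimate.
  have hr : ∀ r ∈ Finset.range d,
      ((F.filter fun X => lv X % d = r).card : ℝ) ≤ (4 * (R + b) / b) ^ d := by
    intro r _
    have key := h.sum_len_pow_le (F.filter fun X => lv X % d = r) lv
      (fun X hX => hlv X (hmem X (Finset.mem_filter.1 hX).1).1) ?_ y hR (b := 2 * b)
      (by positivity) (fun X hX => (hmem X (Finset.mem_filter.1 hX).1).2.2.2)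
      (fun X hX => (hmem X (Finset.mem_filter.1 hX).1).2.2.1)
    · have h1 : ((F.filter fun X => lv X % d = r).card : ℝ) * (b / 2) ^ d ≤
          (2 * R + 2 * b) ^ d := by
        refine le_trans ?_ key
        rw [← nsmul_eq_mul]
        refine Finset.card_nsmul_le_sum _ _ _ fun X hX => ?_
        have := (hmem X (Finset.mem_filter.1 hX).1).2.1
        exact pow_le_pow_left₀ (by positivity) (by linarith) d
      rw [← le_div_iff₀ (by positivity), ← div_pow] at h1
      refine h1.trans (le_of_eq ?_)
      congr 1
      field_simp
      ring
    · intro X hX X' hX' hne k hk hdesc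
      obtain ⟨hXF, hXr⟩ := Finset.mem_filter.1 hX
      obtain ⟨hXF', hXr'⟩ := Finset.mem_filter.1 hX'
      have hdk : d ∣ k := by
        rw [hk, ← hXr] at hXr'
        have : lv X ≡ lv X + k [MOD d] := hXr'.symm
        have := (Nat.modEq_iff_dvd' (Nat.le_add_right _ _)).1 this
        simpa using this
      have hk0 : k ≠ 0 := by
        rintro rfl
        exact hne (Finset.mem_singleton.1 hdesc).symm
      obtain ⟨l, rfl⟩ := Nat.exists_eq_add_of_le (Nat.le_of_dvd (Nat.pos_of_ne_zero hk0) hdk)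
      obtain ⟨Z, hZ, hXZ⟩ := mem_treeLevel_add.1 hdesc
      have hXc := (hmem X hXF).1
      have h1 := len_le_half h.injective h.longest h.leaf (h.nonempty hXc) hZ
      have h2 := len_mono h.longest (h.nonempty (hmem X' hXF').1) (subset_of_mem_treeLevel_sons hXZ)
      linarith [(hmem X hXF).2.2.1, (hmem X' hXF').2.1]
  have hsum : F.card = ∑ r ∈ Finset.range d, (F.filter fun X => lv X % d = r).card :=
    Finset.card_eq_sum_card_fiberwise fun X _ => by
      simpa using Nat.mod_lt _ h.d_pos
  rw [hsum]
  push_cast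
  refine (Finset.sum_le_sum hr).trans (le_of_eq ?_)
  simp

/-- The dyadic scale of a cluster. Positive lengths are at least `s`, which bounds the scales that
occur. -/
lemma exists_scale (h : Geometry x κ Cleaf A s) {X : Finset (Fin N)} (hX : IsCluster x κ Cleaf X)
    (hpos : 0 < len x κ X) : ∃ j : ℕ, A / 2 ^ (j + 1) < len x κ X ∧
      len x κ X ≤ 2 * (A / 2 ^ (j + 1)) ∧ (2 : ℝ) ^ j ≤ A / s := by
  obtain ⟨j, hj1, hj2⟩ := exists_nat_pow_near (x := A / len x κ X) (y := 2)
    ((one_le_div hpos).2 (h.len_le_A hX)) one_lt_two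
  refine ⟨j, ?_, ?_, ?_⟩
  · rw [div_lt_iff₀ hpos] at hj2
    rw [div_lt_iff₀ (by positivity)]
    linarith
  · rw [le_div_iff₀ hpos] at hj1
    rw [pow_succ, ← mul_div_assoc, le_div_iff₀ (by positivity)]
    linarith
  · exact hj1.trans (div_le_div_of_nonneg_left h.A_pos.le h.s_pos (h.s_le_len hpos))

lemma exists_max_scale (h : Geometry x κ Cleaf A s) : ∃ J : ℕ, (2 : ℝ) ^ J ≤ A / s ∧
    ∀ j : ℕ, (2 : ℝ) ^ j ≤ A / s → j < J + 1 := by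
  obtain ⟨J, h1, h2⟩ := exists_nat_pow_near (x := A / s) (y := 2)
    ((one_le_div h.s_pos).2 h.s_le) one_lt_two
  exact ⟨J, h1, fun j hj => (pow_lt_pow_iff_right₀ one_lt_two).1 (hj.trans_lt h2)⟩

/-- For `d ≥ 1` the geometric sum is comparable to its last term. The finest scale therefore
dominates, and no factor `log N` appears in the counts. -/
lemma sum_two_pow_le (h : Geometry x κ Cleaf A s) {J : ℕ} (hJ : (2 : ℝ) ^ J ≤ A / s) :
    ∑ j ∈ Finset.range (J + 1), ((2 : ℝ) ^ j) ^ d ≤ 2 * (A / s) ^ d := by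
  have hgeo : ∀ n : ℕ, ∑ j ∈ Finset.range (n + 1), ((2 : ℝ) ^ j) ^ d ≤ 2 * ((2 : ℝ) ^ n) ^ d := by
    intro n
    induction n with
    | zero => simp
    | succ n ih =>
      rw [Finset.sum_range_succ]
      have h2 : (2 : ℝ) ≤ 2 ^ d := by
        simpa using pow_le_pow_right₀ (one_le_two : (1 : ℝ) ≤ 2) h.d_pos
      have e : ((2 : ℝ) ^ (n + 1)) ^ d = 2 ^ d * ((2 : ℝ) ^ n) ^ d := by
        rw [pow_succ, mul_pow]; ring
      have h3 : 0 < ((2 : ℝ) ^ n) ^ d := by positivity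
      rw [e]
      nlinarith
  exact (hgeo J).trans (by gcongr)

open Classical in
/-- The number of points near a given point. -/
lemma card_points_le (h : Geometry x κ Cleaf A s) (y : Fin d → ℝ) {R : ℝ} (hR : s ≤ R) :
    ((Finset.univ.filter fun i : Fin N => ∀ k, |x i k - y k| ≤ R).card : ℝ) ≤ (3 * (R / s)) ^ d := by
  have hs := h.s_pos
  have key := sum_pow_le_of_disjoint_cubes (Finset.univ.filter fun i : Fin N =>
    ∀ k, |x i k - y k| ≤ R) (fun i k => x i k - s / 2) (fun _ => s) (fun _ _ => hs.le) y
    (R := R + s / 2) (by linarith) ?_ ?_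
  · rw [Finset.sum_const, nsmul_eq_mul, ← le_div_iff₀ (by positivity), ← div_pow] at key
    have hR0 : 0 < R := hs.trans_le hR
    refine key.trans (pow_le_pow_left₀ (by positivity) ?_ d)
    rw [← mul_div_assoc]
    exact div_le_div_of_nonneg_right (by linarith) hs.le
  · intro i hi k
    have := abs_le.1 ((Finset.mem_filter.1 hi).2 k)
    constructor <;> linarith [this.1, this.2]
  · intro i _ j _ hij
    obtain ⟨k, hk⟩ := h.sep i j hij
    refine ⟨k, ?_⟩
    rcases le_abs.1 hk with hk | hk
    · right; linarith
    · left; linarith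

open Classical in
/-- The number of clusters of size at most `R` near a given point. -/
lemma card_small_le (h : Geometry x κ Cleaf A s) (y : Fin d → ℝ) {R : ℝ} (hR : s ≤ R) :
    ((Finset.univ.filter fun X : Finset (Fin N) => IsCluster x κ Cleaf X ∧ len x κ X ≤ R ∧
      ∃ i ∈ X, ∀ k, |x i k - y k| ≤ R).card : ℝ) ≤
      (2 * d * 16 ^ d + 3 ^ d) * (R / s) ^ d := by
  have hs := h.s_pos
  have hA := h.A_pos
  have hR0 : 0 < R := hs.trans_le hR
  obtain ⟨J, hJ, hJmax⟩ := h.exists_max_scale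
  set G : ℕ → Finset (Finset (Fin N)) := fun j => Finset.univ.filter fun X : Finset (Fin N) =>
    (IsCluster x κ Cleaf X ∧ A / 2 ^ (j + 1) < len x κ X ∧ len x κ X ≤ 2 * (A / 2 ^ (j + 1)) ∧
      ∃ i ∈ X, ∀ k, |x i k - y k| ≤ R) ∧ len x κ X ≤ R with hG
  have hsub : (Finset.univ.filter fun X : Finset (Fin N) => IsCluster x κ Cleaf X ∧ len x κ X ≤ R ∧
      ∃ i ∈ X, ∀ k, |x i k - y k| ≤ R) ⊆ (Finset.range (J + 1)).biUnion G ∪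
      (Finset.univ.filter fun i : Fin N => ∀ k, |x i k - y k| ≤ R).image fun i => {i} := by
    intro X hX
    obtain ⟨hXc, hXR, i, hi, hk⟩ := (Finset.mem_filter.1 hX).2
    -- Clusters of length zero belong to no dyadic scale; they are singletons and are counted as
    -- points.
    rcases (len_nonneg x κ X).eq_or_lt with h0 | h0
    · refine Finset.mem_union_right _ (Finset.mem_image.2 ⟨i, by simpa using hk, ?_⟩)
      have := card_le_one_of_len_eq_zero h.injective h.longest h0.symm
      exact (Finset.eq_singleton_iff_unique_mem.2
        ⟨hi, fun j hj => Finset.card_le_one.1 this j hj i hi⟩).symm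
    · obtain ⟨j, h1, h2, h3⟩ := h.exists_scale hXc h0
      exact Finset.mem_union_left _ (Finset.mem_biUnion.2 ⟨j, Finset.mem_range.2 (hJmax j h3),
        Finset.mem_filter.2 ⟨Finset.mem_univ _, ⟨hXc, h1, h2, i, hi, hk⟩, hXR⟩⟩)
  have hGj : ∀ j ∈ Finset.range (J + 1), ((G j).card : ℝ) ≤ d * (16 * R / A) ^ d * (2 ^ j) ^ d := by
    intro j _
    rcases (G j).eq_empty_or_nonempty with he | ⟨X, hX⟩
    · rw [he]
      simp only [Finset.card_empty, Nat.cast_zero]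
      positivity
    · obtain ⟨⟨-, hb, -⟩, hXR⟩ := (Finset.mem_filter.1 hX).2
      -- A single member of `G j` shows `b ≤ R` for `b = A / 2 ^ (j + 1)`, whence `4 (R + b) / b ≤ 8
      -- R / b = (16 R / A) 2 ^ j`.
      have hbR : A / 2 ^ (j + 1) ≤ R := hb.le.trans hXR
      have hb0 : 0 < A / 2 ^ (j + 1) := by positivity
      have h1 := h.card_scale_le y hR0.le hb0
      have h2 : ((G j).card : ℝ) ≤ _ := le_trans (Nat.cast_le.2 (Finset.card_le_card fun X hX =>
        Finset.mem_filter.2 ⟨Finset.mem_univ _, (Finset.mem_filter.1 hX).2.1⟩)) h1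
      refine h2.trans ?_
      rw [mul_assoc, ← mul_pow]
      refine mul_le_mul_of_nonneg_left (pow_le_pow_left₀ (by positivity) ?_ d) (by positivity)
      rw [div_le_iff₀ hb0]
      have : 16 * R / A * 2 ^ j * (A / 2 ^ (j + 1)) = 8 * R := by
        rw [pow_succ]; field_simp; norm_num
      rw [this]
      linarith
  have h1 := (Finset.card_le_card hsub).trans (Finset.card_union_le _ _)
  have h2 : (((Finset.range (J + 1)).biUnion G).card : ℝ) ≤ 2 * d * 16 ^ d * (R / s) ^ d := by
    calc (((Finset.range (J + 1)).biUnion G).card : ℝ)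
        ≤ ∑ j ∈ Finset.range (J + 1), ((G j).card : ℝ) := by exact_mod_cast Finset.card_biUnion_le
      _ ≤ ∑ j ∈ Finset.range (J + 1), d * (16 * R / A) ^ d * (2 ^ j) ^ d := Finset.sum_le_sum hGj
      _ = d * (16 * R / A) ^ d * ∑ j ∈ Finset.range (J + 1), ((2 : ℝ) ^ j) ^ d := by
          rw [Finset.mul_sum]
      _ ≤ d * (16 * R / A) ^ d * (2 * (A / s) ^ d) :=
          mul_le_mul_of_nonneg_left (h.sum_two_pow_le hJ) (by positivity)
      _ = 2 * d * 16 ^ d * (R / s) ^ d := by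
          have : (16 * R / A) ^ d * (A / s) ^ d = 16 ^ d * (R / s) ^ d := by
            rw [← mul_pow, ← mul_pow]; congr 1; field_simp
          calc _ = 2 * d * ((16 * R / A) ^ d * (A / s) ^ d) := by ring
            _ = _ := by rw [this]; ring
  have h3 : (((Finset.univ.filter fun i : Fin N => ∀ k, |x i k - y k| ≤ R).image
      fun i => ({i} : Finset (Fin N))).card : ℝ) ≤ 3 ^ d * (R / s) ^ d := by
    rw [← mul_pow]
    exact le_trans (by exact_mod_cast Finset.card_image_le) (h.card_points_le y hR)
  calc _ ≤ (((Finset.range (J + 1)).biUnion G).card : ℝ) +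
        (((Finset.univ.filter fun i : Fin N => ∀ k, |x i k - y k| ≤ R).image
          fun i => ({i} : Finset (Fin N))).card : ℝ) := by exact_mod_cast h1
    _ ≤ _ := by rw [add_mul]; exact add_le_add h2 h3

-- With `R = A` every cluster is small and near any given point.
open Classical in
lemma card_clusters_le (h : Geometry x κ Cleaf A s) :
    ((Finset.univ.filter fun X : Finset (Fin N) => IsCluster x κ Cleaf X).card : ℝ) ≤
      (2 * d * 16 ^ d + 3 ^ d) * (A / s) ^ d := by
  refine le_trans ?_ (h.card_small_le (fun k => x ⟨0, h.N_pos⟩ k) h.s_le)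
  refine Nat.cast_le.2 (Finset.card_le_card fun X hX => ?_)
  have hXc := (Finset.mem_filter.1 hX).2
  obtain ⟨i, hi⟩ := h.nonempty hXc
  exact Finset.mem_filter.2 ⟨Finset.mem_univ _, hXc, h.len_le_A hXc, i, hi,
    fun k => h.abs_sub_le_A _ _ k⟩

open Classical in
/-- Pairs of a leaf and a smaller cluster near the leaf. -/
lemma card_leafPairs_le (h : Geometry x κ Cleaf A s) {K : ℝ} (hK : 1 ≤ K) :
    ((Finset.univ.filter fun b : Finset (Fin N) × Finset (Fin N) =>
      IsCluster x κ Cleaf b.1 ∧ (IsCluster x κ Cleaf b.2 ∧ sons x κ Cleaf b.2 = ∅) ∧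
      len x κ b.1 ≤ len x κ b.2 ∧ 0 < len x κ b.2 ∧
      ∀ i ∈ b.1, ∀ j ∈ b.2, ∀ k, |x i k - x j k| ≤ K * len x κ b.2).card : ℝ) ≤
      (2 * d * 16 ^ d + 3 ^ d) * (6 * K) ^ d * (A / s) ^ d := by
  have hs := h.s_pos
  have hA := h.A_pos
  set C2 : ℝ := 2 * d * 16 ^ d + 3 ^ d with hC2
  have hC20 : 0 ≤ C2 := by positivity
  set P := Finset.univ.filter fun b : Finset (Fin N) × Finset (Fin N) =>
      IsCluster x κ Cleaf b.1 ∧ (IsCluster x κ Cleaf b.2 ∧ sons x κ Cleaf b.2 = ∅) ∧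
      len x κ b.1 ≤ len x κ b.2 ∧ 0 < len x κ b.2 ∧
      ∀ i ∈ b.1, ∀ j ∈ b.2, ∀ k, |x i k - x j k| ≤ K * len x κ b.2 with hP
  set F := Finset.univ.filter fun Y : Finset (Fin N) =>
    IsCluster x κ Cleaf Y ∧ sons x κ Cleaf Y = ∅ with hF
  have hcard : P.card = ∑ Y ∈ F, (P.filter fun b => b.2 = Y).card :=
    Finset.card_eq_sum_card_fiberwise fun b hb =>
      Finset.mem_filter.2 ⟨Finset.mem_univ _, (Finset.mem_filter.1 hb).2.2.1⟩
  have hY : ∀ Y ∈ F, ((P.filter fun b => b.2 = Y).card : ℝ) ≤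
      C2 * (2 * K / s) ^ d * (len x κ Y / 2) ^ d := by
    intro Y hYF
    have hlen0 := len_nonneg x κ Y
    have hrhs : C2 * (2 * K / s) ^ d * (len x κ Y / 2) ^ d = C2 * (K * len x κ Y / s) ^ d := by
      rw [mul_assoc, ← mul_pow]; congr 2; field_simp
    rcases (P.filter fun b => b.2 = Y).eq_empty_or_nonempty with he | ⟨b, hb⟩
    · rw [he]
      simp only [Finset.card_empty, Nat.cast_zero]
      positivity
    · rw [hrhs]
      obtain ⟨hbP, rfl⟩ := Finset.mem_filter.1 hb
      have hpos := (Finset.mem_filter.1 hbP).2.2.2.2.1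
      have hle : s ≤ K * len x κ b.2 := (h.s_le_len hpos).trans (le_mul_of_one_le_left hlen0 hK)
      obtain ⟨j, hj⟩ := h.nonempty (Finset.mem_filter.1 hYF).2.1
      refine le_trans ?_ (h.card_small_le (fun k => x j k) hle)
      refine Nat.cast_le.2 (Finset.card_le_card_of_injOn Prod.fst ?_ ?_)
      · intro c hc
        obtain ⟨hcP, hc2⟩ := Finset.mem_filter.1 hc
        obtain ⟨h1, -, h3, -, h5⟩ := (Finset.mem_filter.1 hcP).2
        obtain ⟨i, hi⟩ := h.nonempty h1
        rw [hc2] at h3 h5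
        exact Finset.mem_filter.2 ⟨Finset.mem_univ _, h1,
          h3.trans (le_mul_of_one_le_left hlen0 hK), i, hi, fun k => h5 i hi j hj k⟩
      · intro c hc c' hc' he
        exact Prod.ext he ((Finset.mem_filter.1 hc).2.trans (Finset.mem_filter.1 hc').2.symm)
  have hlv : ∀ X : Finset (Fin N), ∃ n, IsCluster x κ Cleaf X → X ∈ clusterLevel x κ Cleaf n := by
    intro X
    by_cases hX : IsCluster x κ Cleaf X
    · obtain ⟨n, hn⟩ := isCluster_iff.1 hX
      exact ⟨n, fun _ => hn⟩
    · exact ⟨0, fun h => absurd h hX⟩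
  choose lv hlv using hlv
  -- No leaf descends from another one, so leaves of all sizes enter one packing estimate. The sum
  -- of the `d`-th powers of their lengths absorbs the number of partners, which is at most of order
  -- `(len Y / s) ^ d` for a leaf `Y`.
  have hsum := h.sum_len_pow_le F lv (fun X hX => hlv X (Finset.mem_filter.1 hX).2.1)
    (fun X hX X' _ hne k _ hd => hne (treeLevel_of_leaf (Finset.mem_filter.1 hX).2.2 hd).symm)
    (fun k => x ⟨0, h.N_pos⟩ k) hA.le hA.le
    (fun X hX => by
      obtain ⟨i, hi⟩ := h.nonempty (Finset.mem_filter.1 hX).2.1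
      exact ⟨i, hi, fun k => h.abs_sub_le_A _ _ k⟩)
    (fun X hX => h.len_le_A (Finset.mem_filter.1 hX).2.1)
  rw [hcard]
  push_cast
  calc ∑ Y ∈ F, ((P.filter fun b => b.2 = Y).card : ℝ)
      ≤ ∑ Y ∈ F, C2 * (2 * K / s) ^ d * (len x κ Y / 2) ^ d := Finset.sum_le_sum hY
    _ = C2 * (2 * K / s) ^ d * ∑ Y ∈ F, (len x κ Y / 2) ^ d := by rw [Finset.mul_sum]
    _ ≤ C2 * (2 * K / s) ^ d * (2 * A + A) ^ d :=
        mul_le_mul_of_nonneg_left hsum (by positivity)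
    _ = C2 * (6 * K) ^ d * (A / s) ^ d := by
        rw [mul_assoc, ← mul_pow, mul_assoc, ← mul_pow]; congr 2; field_simp; ring

open Classical in
/-- Pairs of a cluster and a nearby cluster that is smaller but not deeper in the tree. -/
lemma card_levelPairs_le (h : Geometry x κ Cleaf A s) {K : ℝ} (hK : 1 ≤ K) :
    ((Finset.univ.filter fun b : Finset (Fin N) × Finset (Fin N) =>
      (∃ n m, m ≤ n ∧ b.1 ∈ clusterLevel x κ Cleaf n ∧ b.2 ∈ clusterLevel x κ Cleaf m) ∧
      0 < len x κ b.1 ∧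
      ∀ i ∈ b.1, ∀ j ∈ b.2, ∀ k, |x i k - x j k| ≤ K * len x κ b.1).card : ℝ) ≤
      2 * d * (2 * (4 * (2 * K + 1))) ^ d * (A / s) ^ d := by
  have hs := h.s_pos
  have hA := h.A_pos
  obtain ⟨J, hJ, hJmax⟩ := h.exists_max_scale
  set P := Finset.univ.filter fun b : Finset (Fin N) × Finset (Fin N) =>
      (∃ n m, m ≤ n ∧ b.1 ∈ clusterLevel x κ Cleaf n ∧ b.2 ∈ clusterLevel x κ Cleaf m) ∧
      0 < len x κ b.1 ∧
      ∀ i ∈ b.1, ∀ j ∈ b.2, ∀ k, |x i k - x j k| ≤ K * len x κ b.1 with hP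
  -- Candidates for the second cluster when the first one has length above `A / 2 ^ (j + 1)`: the
  -- first has depth below `d (j + 1)` by `len_le_div_two_pow`, and the second is not deeper. In a
  -- binary tree there are fewer than `2 ^ (d (j + 1))` of them, and each has a bounded number of
  -- partners at scale `j`.
  set Q : ℕ → Finset (Finset (Fin N)) := fun j =>
    (Finset.range (d * (j + 1))).biUnion fun m => clusterLevel x κ Cleaf m with hQ
  have hQcard : ∀ j, ((Q j).card : ℝ) ≤ 2 ^ d * (2 ^ j) ^ d := by
    intro j
    have h1 : (Q j).card ≤ 2 ^ (d * (j + 1)) := by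
      calc (Q j).card ≤ ∑ m ∈ Finset.range (d * (j + 1)), (clusterLevel x κ Cleaf m).card :=
            Finset.card_biUnion_le
        _ ≤ ∑ m ∈ Finset.range (d * (j + 1)), 2 ^ m :=
            Finset.sum_le_sum fun m _ => card_treeLevel_le (fun X => card_sons_le X) _ m
        _ ≤ 2 ^ (d * (j + 1)) := (Nat.geomSum_lt le_rfl fun m hm => Finset.mem_range.1 hm).le
    calc ((Q j).card : ℝ) ≤ 2 ^ (d * (j + 1)) := by exact_mod_cast h1
      _ = 2 ^ d * (2 ^ j) ^ d := by rw [← mul_pow, ← pow_succ', mul_comm, pow_mul]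
  set G : ℕ → Finset (Finset (Fin N) × Finset (Fin N)) := fun j => P.filter fun b =>
    A / 2 ^ (j + 1) < len x κ b.1 ∧ len x κ b.1 ≤ 2 * (A / 2 ^ (j + 1)) with hG
  have hsub : P ⊆ (Finset.range (J + 1)).biUnion G := by
    intro b hb
    obtain ⟨⟨n, m, -, hn, -⟩, hpos, -⟩ := (Finset.mem_filter.1 hb).2
    obtain ⟨j, h1, h2, h3⟩ := h.exists_scale (isCluster_iff.2 ⟨n, hn⟩) hpos
    exact Finset.mem_biUnion.2 ⟨j, Finset.mem_range.2 (hJmax j h3),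
      Finset.mem_filter.2 ⟨hb, h1, h2⟩⟩
  have hGj : ∀ j ∈ Finset.range (J + 1),
      ((G j).card : ℝ) ≤ d * (2 * (4 * (2 * K + 1))) ^ d * (2 ^ j) ^ d := by
    intro j _
    set b : ℝ := A / 2 ^ (j + 1) with hb
    have hb0 : 0 < b := by positivity
    have hcard : (G j).card = ∑ Y ∈ Q j, ((G j).filter fun c => c.2 = Y).card := by
      refine Finset.card_eq_sum_card_fiberwise fun c hc => ?_
      obtain ⟨hcP, h1, -⟩ := Finset.mem_filter.1 hc
      obtain ⟨⟨n, m, hmn, hn, hm⟩, -, -⟩ := (Finset.mem_filter.1 hcP).2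
      refine Finset.mem_biUnion.2 ⟨m, Finset.mem_range.2 (hmn.trans_lt ?_), hm⟩
      have h2 := (len_le_div_two_pow h.N_pos h.injective h.longest h.leaf hn).trans
        (div_le_div_of_nonneg_right h.len_le (by positivity))
      have h3 := h1.trans_le h2
      rw [div_lt_div_iff_of_pos_left hA (by positivity) (by positivity),
        pow_lt_pow_iff_right₀ one_lt_two] at h3
      rw [mul_comm]
      exact (Nat.div_lt_iff_lt_mul h.d_pos).1 h3
    have hY : ∀ Y ∈ Q j, (((G j).filter fun c => c.2 = Y).card : ℝ) ≤
        d * (4 * (2 * K + 1)) ^ d := by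
      intro Y hYQ
      obtain ⟨m, -, hm⟩ := Finset.mem_biUnion.1 hYQ
      obtain ⟨l, hl⟩ := h.nonempty (isCluster_iff.2 ⟨m, hm⟩)
      have h1 := h.card_scale_le (fun k => x l k) (R := K * (2 * b)) (by positivity) hb0
      have e : 4 * (K * (2 * b) + b) / b = 4 * (2 * K + 1) := by field_simp
      rw [e] at h1
      refine le_trans (Nat.cast_le.2 (Finset.card_le_card_of_injOn Prod.fst ?_ ?_)) h1
      · intro c hc
        obtain ⟨hcG, rfl⟩ := Finset.mem_filter.1 hc
        obtain ⟨hcP, h1, h2⟩ := Finset.mem_filter.1 hcG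
        obtain ⟨⟨n, -, -, hn, -⟩, -, h3⟩ := (Finset.mem_filter.1 hcP).2
        have hc1 := isCluster_iff.2 ⟨n, hn⟩
        obtain ⟨i, hi⟩ := h.nonempty hc1
        exact Finset.mem_filter.2 ⟨Finset.mem_univ _, hc1, h1, h2, i, hi, fun k =>
          (h3 i hi l hl k).trans (mul_le_mul_of_nonneg_left h2 (by positivity))⟩
      · intro c hc c' hc' he
        exact Prod.ext he ((Finset.mem_filter.1 hc).2.trans (Finset.mem_filter.1 hc').2.symm)
    rw [hcard]
    push_cast
    calc ∑ Y ∈ Q j, (((G j).filter fun c => c.2 = Y).card : ℝ)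
        ≤ ∑ _Y ∈ Q j, d * (4 * (2 * K + 1)) ^ d := Finset.sum_le_sum hY
      _ = (Q j).card * (d * (4 * (2 * K + 1)) ^ d) := by rw [Finset.sum_const, nsmul_eq_mul]
      _ ≤ 2 ^ d * (2 ^ j) ^ d * (d * (4 * (2 * K + 1)) ^ d) :=
          mul_le_mul_of_nonneg_right (hQcard j) (by positivity)
      _ = _ := by rw [mul_pow 2 (4 * (2 * K + 1)) d]; ring
  calc (P.card : ℝ) ≤ (((Finset.range (J + 1)).biUnion G).card : ℝ) :=
        Nat.cast_le.2 (Finset.card_le_card hsub)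
    _ ≤ ∑ j ∈ Finset.range (J + 1), ((G j).card : ℝ) := by exact_mod_cast Finset.card_biUnion_le
    _ ≤ ∑ j ∈ Finset.range (J + 1), d * (2 * (4 * (2 * K + 1))) ^ d * (2 ^ j) ^ d :=
        Finset.sum_le_sum hGj
    _ = d * (2 * (4 * (2 * K + 1))) ^ d * ∑ j ∈ Finset.range (J + 1), ((2 : ℝ) ^ j) ^ d := by
        rw [Finset.mul_sum]
    _ ≤ d * (2 * (4 * (2 * K + 1))) ^ d * (2 * (A / s) ^ d) :=
        mul_le_mul_of_nonneg_left (h.sum_two_pow_le hJ) (by positivity)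
    _ = _ := by ring

end Geometry

/-! ### Counting blocks -/

lemma norm_sub_le_mul {y z : Pt d} {L : ℝ} (hL : 0 ≤ L) (h : ∀ k, |y k - z k| ≤ L) :
    ‖y - z‖ ≤ d * L := by
  rw [EuclideanSpace.norm_eq]
  apply Real.sqrt_le_iff.2 ⟨by positivity, ?_⟩
  calc ∑ k, ‖(y - z) k‖ ^ 2 ≤ ∑ _k : Fin d, L ^ 2 := by
        refine Finset.sum_le_sum fun k _ => pow_le_pow_left₀ (norm_nonneg _) ?_ 2
        simpa using h k
    _ = d * L ^ 2 := by simp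
    _ ≤ (d * L) ^ 2 := by
        rw [mul_pow]
        refine mul_le_mul_of_nonneg_right ?_ (by positivity)
        exact_mod_cast Nat.le_self_pow two_ne_zero d

lemma abs_coord_le_norm (v : Pt d) (k : Fin d) : |v k| ≤ ‖v‖ := by
  simpa using PiLp.norm_apply_le v k

lemma diam_bbox_le (hκ : LongestEdge x κ) (X : Finset (Fin N)) :
    (bbox x X).diam ≤ d * len x κ X := by
  have := len_nonneg x κ X
  refine Metric.diam_le_of_forall_dist_le (by positivity) fun y hy z hz => ?_
  rw [dist_eq_norm]
  exact norm_sub_le_mul this fun k => abs_sub_le_len hκ hy hz k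

lemma Box.dist_nonneg (B B' : Box d) : 0 ≤ B.dist B' :=
  Real.iInf_nonneg fun _ => norm_nonneg _

lemma Box.dist_le {B B' : Box d} {y z : Pt d} (hy : y ∈ B.toSet) (hz : z ∈ B'.toSet) :
    B.dist B' ≤ ‖y - z‖ :=
  ciInf_le (f := fun z : B.toSet × B'.toSet => ‖(z.1 : Pt d) - (z.2 : Pt d)‖)
    ⟨0, by rintro _ ⟨z, rfl⟩; exact norm_nonneg _⟩ (⟨y, hy⟩, ⟨z, hz⟩)

lemma Box.dist_comm (B B' : Box d) : B.dist B' = B'.dist B := by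
  unfold Box.dist
  rw [← (Equiv.prodComm B.toSet B'.toSet).symm.iInf_comp]
  refine iInf_congr fun z => ?_
  rw [norm_sub_rev]
  rfl

lemma admissible_comm {B B' : Box d} : Admissible η B B' ↔ Admissible η B' B := by
  unfold Admissible
  rw [max_comm, Box.dist_comm]

/-- Inadmissible blocks consist of clusters that are close compared to their size. -/
lemma close_of_not_admissible (hκ : LongestEdge x κ) (hη : 0 < η) {X Y : Finset (Fin N)}
    (hX : X.Nonempty) (hY : Y.Nonempty) (h : ¬ Admissible η (bbox x X) (bbox x Y)) :
    0 < max (len x κ X) (len x κ Y) ∧ ∀ i ∈ X, ∀ j ∈ Y, ∀ k,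
      |x i k - x j k| ≤ (2 + d / η) * max (len x κ X) (len x κ Y) := by
  set L := max (len x κ X) (len x κ Y) with hL
  have hL0 : 0 ≤ L := (len_nonneg x κ X).trans (le_max_left _ _)
  have hdiam : max (bbox x X).diam (bbox x Y).diam ≤ d * L :=
    max_le ((diam_bbox_le hκ X).trans (mul_le_mul_of_nonneg_left (le_max_left _ _) (by positivity)))
      ((diam_bbox_le hκ Y).trans (mul_le_mul_of_nonneg_left (le_max_right _ _) (by positivity)))
  have hlt : η * (bbox x X).dist (bbox x Y) < d * L := (not_le.1 h).trans_le hdiam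
  have hd0 := Box.dist_nonneg (bbox x X) (bbox x Y)
  refine ⟨hL0.lt_of_ne fun h0 => ?_, ?_⟩
  · rw [← h0, mul_zero] at hlt
    exact absurd hlt (not_lt.2 (by positivity))
  obtain ⟨i₀, hi₀⟩ := hX
  obtain ⟨j₀, hj₀⟩ := hY
  have : Nonempty ((bbox x X).toSet × (bbox x Y).toSet) :=
    ⟨⟨⟨_, mem_bbox x hi₀⟩, ⟨_, mem_bbox x hj₀⟩⟩⟩
  have hlt' : (bbox x X).dist (bbox x Y) < d * L / η := by
    rw [lt_div_iff₀ hη]; linarith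
  -- Two points of the boxes at distance below `d L / η`. The triangle inequality through them costs
  -- one edge length in each box, which gives the constant `2 + d / η`.
  obtain ⟨⟨z, w⟩, hzw⟩ := exists_lt_of_ciInf_lt hlt'
  intro i hi j hj k
  have h1 := abs_sub_le_len hκ (mem_bbox x hi) z.2 k
  have h2 := abs_sub_le_len hκ w.2 (mem_bbox x hj) k
  have h3 := abs_coord_le_norm ((z : Pt d) - (w : Pt d)) k
  have e : x i k - x j k = (x i k - (z : Pt d) k) + ((z : Pt d) - (w : Pt d)) k +
      ((w : Pt d) k - x j k) := by
    simp
  rw [e]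
  have h4 : len x κ X ≤ L := le_max_left _ _
  have h5 : len x κ Y ≤ L := le_max_right _ _
  calc _ ≤ |x i k - (z : Pt d) k| + |((z : Pt d) - (w : Pt d)) k| + |(w : Pt d) k - x j k| :=
        abs_add_three _ _ _
    _ ≤ L + d * L / η + L := by
        simp only at hzw
        linarith
    _ = _ := by ring

open Classical in
/-- The blocks that are not admissible. -/
noncomputable def inadmissibleBlocks (x : Fin N → Pt d) (κ : Finset (Fin N) → Fin d) (Cleaf : ℕ)
    (η : ℝ) : Finset (Finset (Fin N) × Finset (Fin N)) :=
  Finset.univ.filter fun b => IsBlock x κ Cleaf η b ∧ ¬ Admissible η (bbox x b.1) (bbox x b.2)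

/-- The constant in the estimate for the number of inadmissible blocks. -/
noncomputable def blockConst (d : ℕ) (η : ℝ) : ℝ :=
  2 * ((2 * d * 16 ^ d + 3 ^ d) * (6 * (2 + d / η)) ^ d) +
    2 * (2 * d * (2 * (4 * (2 * (2 + d / η) + 1))) ^ d)

/-- Compare the longer cluster with the other one. If it is at least as deep, the pair is counted in
`Q`; otherwise it is the shallower one, hence a leaf, and the pair is counted in `P`. Exchanging the
roles of the two clusters explains the factors `2` in `blockConst`. -/
lemma Geometry.card_inadmissibleBlocks_le (h : Geometry x κ Cleaf A s) (hη : 0 < η) :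
    ((inadmissibleBlocks x κ Cleaf η).card : ℝ) ≤ blockConst d η * (A / s) ^ d := by
  classical
  set K : ℝ := 2 + d / η with hKdef
  have hK : 1 ≤ K := by
    have : 0 ≤ (d : ℝ) / η := by positivity
    linarith
  have hP := h.card_leafPairs_le hK
  have hQ := h.card_levelPairs_le hK
  set P := Finset.univ.filter fun b : Finset (Fin N) × Finset (Fin N) =>
      IsCluster x κ Cleaf b.1 ∧ (IsCluster x κ Cleaf b.2 ∧ sons x κ Cleaf b.2 = ∅) ∧
      len x κ b.1 ≤ len x κ b.2 ∧ 0 < len x κ b.2 ∧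
      ∀ i ∈ b.1, ∀ j ∈ b.2, ∀ k, |x i k - x j k| ≤ K * len x κ b.2
  set Q := Finset.univ.filter fun b : Finset (Fin N) × Finset (Fin N) =>
      (∃ n m, m ≤ n ∧ b.1 ∈ clusterLevel x κ Cleaf n ∧ b.2 ∈ clusterLevel x κ Cleaf m) ∧
      0 < len x κ b.1 ∧
      ∀ i ∈ b.1, ∀ j ∈ b.2, ∀ k, |x i k - x j k| ≤ K * len x κ b.1
  have hsub : inadmissibleBlocks x κ Cleaf η ⊆
      (P ∪ P.image Prod.swap) ∪ (Q ∪ Q.image Prod.swap) := by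
    rintro ⟨X, Y⟩ hb
    obtain ⟨hbl, hna⟩ := (Finset.mem_filter.1 hb).2
    obtain ⟨hX, hY⟩ := hbl.isCluster
    obtain ⟨n, m, hn, hm, hnm⟩ := hbl.exists_level
    simp only at hX hY hn hm hnm hna
    obtain ⟨hpos, hclose⟩ := close_of_not_admissible h.longest hη (h.nonempty hX) (h.nonempty hY) hna
    have hclose' : ∀ j ∈ Y, ∀ i ∈ X, ∀ k, |x j k - x i k| ≤ K * max (len x κ X) (len x κ Y) :=
      fun j hj i hi k => by rw [abs_sub_comm]; exact hclose i hi j hj k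
    rcases le_total (len x κ Y) (len x κ X) with hle | hle
    · rw [max_eq_left hle] at hpos hclose hclose'
      rcases hnm with hnm | ⟨-, hl⟩ | ⟨hlt, -⟩
      · exact Finset.mem_union_right _ (Finset.mem_union_left _ (Finset.mem_filter.2
          ⟨Finset.mem_univ _, ⟨n, m, hnm.ge, hn, hm⟩, hpos, hclose⟩))
      · exact Finset.mem_union_left _ (Finset.mem_union_right _ (Finset.mem_image.2
          ⟨(Y, X), Finset.mem_filter.2 ⟨Finset.mem_univ _, hY, ⟨hX, hl⟩, hle, hpos, hclose'⟩, rfl⟩))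
      · exact Finset.mem_union_right _ (Finset.mem_union_left _ (Finset.mem_filter.2
          ⟨Finset.mem_univ _, ⟨n, m, hlt.le, hn, hm⟩, hpos, hclose⟩))
    · rw [max_eq_right hle] at hpos hclose hclose'
      rcases hnm with hnm | ⟨hlt, -⟩ | ⟨-, hl⟩
      · exact Finset.mem_union_right _ (Finset.mem_union_right _ (Finset.mem_image.2
          ⟨(Y, X), Finset.mem_filter.2 ⟨Finset.mem_univ _, ⟨m, n, hnm.le, hm, hn⟩, hpos, hclose'⟩,
            rfl⟩))
      · exact Finset.mem_union_right _ (Finset.mem_union_right _ (Finset.mem_image.2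
          ⟨(Y, X), Finset.mem_filter.2 ⟨Finset.mem_univ _, ⟨m, n, hlt.le, hm, hn⟩, hpos, hclose'⟩,
            rfl⟩))
      · exact Finset.mem_union_left _ (Finset.mem_union_left _ (Finset.mem_filter.2
          ⟨Finset.mem_univ _, hX, ⟨hY, hl⟩, hle, hpos, hclose⟩))
  have hcard : (inadmissibleBlocks x κ Cleaf η).card ≤ (P.card + P.card) + (Q.card + Q.card) := by
    refine (Finset.card_le_card hsub).trans ((Finset.card_union_le _ _).trans ?_)
    exact Nat.add_le_add
      ((Finset.card_union_le _ _).trans (Nat.add_le_add_left Finset.card_image_le _))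
      ((Finset.card_union_le _ _).trans (Nat.add_le_add_left Finset.card_image_le _))
  calc ((inadmissibleBlocks x κ Cleaf η).card : ℝ)
      ≤ ((P.card : ℝ) + P.card) + (Q.card + Q.card) := by exact_mod_cast hcard
    _ ≤ _ := by rw [blockConst, ← hKdef]; linarith

lemma mem_near {b : Finset (Fin N) × Finset (Fin N)} : b ∈ near x κ Cleaf η ↔
    IsBlock x κ Cleaf η b ∧ blockSons x κ Cleaf η b = ∅ ∧
      ¬ Admissible η (bbox x b.1) (bbox x b.2) := by
  simp [near]

lemma mem_far {b : Finset (Fin N) × Finset (Fin N)} : b ∈ far x κ Cleaf η ↔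
    IsBlock x κ Cleaf η b ∧ blockSons x κ Cleaf η b = ∅ ∧
      Admissible η (bbox x b.1) (bbox x b.2) := by
  simp [far]

lemma mem_inadmissibleBlocks {b : Finset (Fin N) × Finset (Fin N)} :
    b ∈ inadmissibleBlocks x κ Cleaf η ↔
      IsBlock x κ Cleaf η b ∧ ¬ Admissible η (bbox x b.1) (bbox x b.2) := by
  simp [inadmissibleBlocks]

lemma near_subset : near x κ Cleaf η ⊆ inadmissibleBlocks x κ Cleaf η := by
  intro b hb
  obtain ⟨h1, -, h3⟩ := mem_near.1 hb
  exact mem_inadmissibleBlocks.2 ⟨h1, h3⟩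

/-- A far-field block other than the root is one of at most four sons of a block that was
subdivided, hence inadmissible. -/
lemma card_far_le :
    (far x κ Cleaf η).card ≤ 1 + 4 * (inadmissibleBlocks x κ Cleaf η).card := by
  classical
  have hsub : far x κ Cleaf η ⊆ {(Finset.univ, Finset.univ)} ∪
      (inadmissibleBlocks x κ Cleaf η).biUnion (blockSons x κ Cleaf η) := by
    intro b hb
    obtain ⟨h1, -, -⟩ := mem_far.1 hb
    cases h1 with
    | root => exact Finset.mem_union_left _ (Finset.mem_singleton_self _)
    | son h hs =>
      refine Finset.mem_union_right _ (Finset.mem_biUnion.2 ⟨_, ?_, hs⟩)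
      exact mem_inadmissibleBlocks.2 ⟨h, (mem_blockSons.1 hs).1⟩
  refine (Finset.card_le_card hsub).trans ((Finset.card_union_le _ _).trans ?_)
  rw [Finset.card_singleton, mul_comm]
  exact Nat.add_le_add_left (Finset.card_biUnion_le_card_mul _ _ _ fun b _ => card_blockSons_le b) _

end Counting

/-! ### Construction of straight-line programs -/

section Programs

lemma execute_append_singleton {ι : Type} (inp : ι → ℝ) (code : List (Instr ι)) (c : Instr ι) :
    execute inp (code ++ [c]) = execute inp code ++
      [c.op.eval (c.fst.val inp (execute inp code)) (c.snd.val inp (execute inp code))] := by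
  simp [execute, List.foldl_append]

lemma length_execute {ι : Type} (inp : ι → ℝ) (code : List (Instr ι)) :
    (execute inp code).length = code.length := by
  induction code using List.reverseRecOn with
  | nil => rfl
  | append_singleton code c ih => rw [execute_append_singleton]; simp [ih]

/-- The function `f` is computed by one of the inputs or by one of the operations of the code;
`env` assigns the inputs to the parameters. -/
def Avail {ι : Type} {Θ : Type*} (env : Θ → ι → ℝ) (code : List (Instr ι)) (f : Θ → ℝ) : Prop :=
  ∃ o : Operand ι, (∀ k, o = .result k → k < code.length) ∧
    ∀ θ, o.val (env θ) (execute (env θ) code) = f θ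

variable {ι : Type} {Θ : Type*} {env : Θ → ι → ℝ} {code code' : List (Instr ι)}

lemma avail_input (a : ι) : Avail env code fun θ => env θ a :=
  ⟨.input a, fun _ h => Operand.noConfusion rfl (heq_of_eq h), fun _ => rfl⟩

lemma Avail.append_singleton {f : Θ → ℝ} (h : Avail env code f) (c : Instr ι) :
    Avail env (code ++ [c]) f := by
  obtain ⟨o, ho, hv⟩ := h
  refine ⟨o, fun k hk => by simpa using (ho k hk).le, fun θ => ?_⟩
  rw [← hv θ, execute_append_singleton]
  cases o with
  | input a => rfl
  | result k =>
    simp only [Operand.val]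
    exact List.getD_append _ _ _ _ (by rw [length_execute]; exact ho k rfl)

lemma Avail.mono {f : Θ → ℝ} (h : Avail env code f) (hp : code <+: code') : Avail env code' f := by
  obtain ⟨l, rfl⟩ := hp
  induction l using List.reverseRecOn with
  | nil => simpa using h
  | append_singleton l c ih => rw [← List.append_assoc]; exact ih.append_singleton c

lemma Avail.op {f g : Θ → ℝ} (hf : Avail env code f) (hg : Avail env code g) (op : ArithOp) :
    ∃ code', code <+: code' ∧ code'.length ≤ code.length + 1 ∧
      Avail env code' fun θ => op.eval (f θ) (g θ) := by
  obtain ⟨o, ho, hv⟩ := hf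
  obtain ⟨o', ho', hv'⟩ := hg
  refine ⟨code ++ [⟨op, o, o'⟩], List.prefix_append _ _, by simp, .result code.length,
    fun k hk => ?_, fun θ => ?_⟩
  · cases hk; simp
  · rw [execute_append_singleton, hv θ, hv' θ]
    simp only [Operand.val]
    rw [List.getD_append_right _ _ _ _ (length_execute _ _).le, length_execute]
    simp

/-- Scalar products are computed with two operations per term. -/
lemma exists_avail_sum {α : Type*} (S : Finset α) {f g : α → Θ → ℝ}
    (h0 : Avail env code fun _ => 0) (hf : ∀ a ∈ S, Avail env code (f a))
    (hg : ∀ a ∈ S, Avail env code (g a)) :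
    ∃ code', code <+: code' ∧ code'.length ≤ code.length + 2 * S.card ∧
      Avail env code' fun θ => ∑ a ∈ S, f a θ * g a θ := by
  classical
  induction S using Finset.induction_on with
  -- Programs contain no constants, so the empty sum has to be available beforehand.
  | empty => exact ⟨code, List.prefix_rfl, by simp, by simpa using h0⟩
  | insert a S ha ih =>
    obtain ⟨c₁, hp₁, hl₁, h₁⟩ := ih (fun b hb => hf b (Finset.mem_insert_of_mem hb))
      (fun b hb => hg b (Finset.mem_insert_of_mem hb))
    obtain ⟨c₂, hp₂, hl₂, h₂⟩ := ((hf a (Finset.mem_insert_self _ _)).mono hp₁).op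
      ((hg a (Finset.mem_insert_self _ _)).mono hp₁) .mul
    obtain ⟨c₃, hp₃, hl₃, h₃⟩ := h₂.op (h₁.mono hp₂) .add
    refine ⟨c₃, hp₁.trans (hp₂.trans hp₃), ?_, ?_⟩
    · rw [Finset.card_insert_of_notMem ha]; omega
    · simp only [Finset.sum_insert ha]
      exact h₃

/-- Tasks are executed one after the other, in an order in which their ranks increase. -/
lemma exists_code_of_tasks {α : Type*} (S : Finset α) (rank : α → ℕ) (cost : α → ℕ)
    {P : α → List (Instr ι) → Prop}
    (hmono : ∀ a code code', code <+: code' → P a code → P a code')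
    (h : ∀ a ∈ S, ∀ code₁, code <+: code₁ → (∀ b ∈ S, rank b < rank a → P b code₁) →
      ∃ code₂, code₁ <+: code₂ ∧ code₂.length ≤ code₁.length + cost a ∧ P a code₂) :
    ∃ code', code <+: code' ∧ code'.length ≤ code.length + ∑ a ∈ S, cost a ∧
      ∀ a ∈ S, P a code' := by
  classical
  induction S using Finset.induction_on_max_value rank with
  | empty => exact ⟨code, List.prefix_rfl, by simp, by simp⟩
  | insert a S ha hmax ih =>
    obtain ⟨c₁, hp₁, hl₁, h₁⟩ := ih fun a' ha' code₁ hp hb =>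
      h a' (Finset.mem_insert_of_mem ha') code₁ hp fun b hbS hlt => by
        rcases Finset.mem_insert.1 hbS with rfl | hbS
        · exact absurd hlt (not_lt.2 (hmax a' ha'))
        · exact hb b hbS hlt
    obtain ⟨c₂, hp₂, hl₂, h₂⟩ := h a (Finset.mem_insert_self _ _) c₁ hp₁ fun b hbS hlt => by
      rcases Finset.mem_insert.1 hbS with rfl | hbS
      · exact absurd hlt (lt_irrefl _)
      · exact h₁ b hbS
    refine ⟨c₂, hp₁.trans hp₂, ?_, fun b hb => ?_⟩
    · rw [Finset.sum_insert ha]; omega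
    · rcases Finset.mem_insert.1 hb with rfl | hb
      · exact h₂
      · exact hmono b _ _ hp₂ (h₁ b hb)

/-- Independent functions are computed one after the other. -/
lemma exists_code_of_avail {α : Type*} [Fintype α] (c : ℕ) {F : α → Θ → ℝ}
    (h : ∀ a, ∀ code₁, code <+: code₁ →
      ∃ code₂, code₁ <+: code₂ ∧ code₂.length ≤ code₁.length + c ∧ Avail env code₂ (F a)) :
    ∃ code', code <+: code' ∧ code'.length ≤ code.length + Fintype.card α * c ∧
      ∀ a, Avail env code' (F a) := by
  obtain ⟨c', h1, h2, h3⟩ := exists_code_of_tasks (code := code) Finset.univ (fun _ : α => 0)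
    (fun _ => c) (P := fun a code => Avail env code (F a)) (fun a _ _ hp ha => ha.mono hp)
    (fun a _ c₁ hp _ => h a c₁ hp)
  exact ⟨c', h1, by simpa using h2, fun a => h3 a (Finset.mem_univ a)⟩

end Programs

/-! ### The fast matrix-vector product -/

section MatVec

variable {d N p Cleaf : ℕ} {x : Fin N → Pt d} {κ : Finset (Fin N) → Fin d} {η : ℝ}

lemma Box.coord_eq_of_edge_eq_zero {B : Box d} {y : Pt d} (hy : y ∈ B.toSet) (k : Fin d)
    (h : B.edge k = 0) : y k = (B.lo k + B.hi k) / 2 := by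
  have := hy k
  rw [Box.edge] at h
  linarith [this.1, this.2]

lemma boxNode_bbox_mem (X : Finset (Fin N)) (n : Fin d → Fin p) :
    boxNode (bbox x X) n ∈ (bbox x X).toSet :=
  boxPoint_mem (bbox_lo_le_hi x X) fun _ => chebNode_mem p _

/-- Nestedness of the cluster bases: interpolation in `B_X` reproduces the polynomials of `P`. -/
lemma sum_clusterBasis_mul_transfer (hp : 1 ≤ p) {X : Finset (Fin N)} (P : Finset (Fin N))
    {i : Fin N} (hi : i ∈ X) (m : Fin d → Fin p) :
    ∑ n, clusterBasis x p X i n * transferMatrix x p X P n m = clusterBasis x p P i m :=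
  sum_boxBasis_mul_boxBasis_boxNode hp _ _ _ (Box.coord_eq_of_edge_eq_zero (mem_bbox x hi))

/-- The transfer to a distant ancestor factors through the clusters in between. The inclusion places
the nodes of `X` in the box of `P`, as needed for flat directions. -/
lemma sum_transfer_mul_transfer (hp : 1 ≤ p) {X P : Finset (Fin N)} (hX : X.Nonempty) (h : X ⊆ P)
    (Q : Finset (Fin N)) (n m : Fin d → Fin p) :
    ∑ r, transferMatrix x p X P n r * transferMatrix x p P Q r m = transferMatrix x p X Q n m :=
  sum_boxBasis_mul_boxBasis_boxNode hp _ _ _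
    (Box.coord_eq_of_edge_eq_zero (bbox_toSet_subset hX h (boxNode_bbox_mem X n)))

/-- The coefficients of a vector with respect to a cluster basis. -/
noncomputable def forwardCoeff (x : Fin N → Pt d) (z : Fin N → ℝ) (X : Finset (Fin N))
    (m : Fin d → Fin p) : ℝ :=
  ∑ j ∈ X, clusterBasis x p X j m * z j

open Classical in
/-- The contributions of the far-field blocks in the block row of a cluster. -/
noncomputable def couplingCoeff (x : Fin N → Pt d) (κ : Finset (Fin N) → Fin d) (Cleaf : ℕ) (η : ℝ)
    (ρ : Pt d → Pt d → ℝ) (z : Fin N → ℝ) (X : Finset (Fin N)) (n : Fin d → Fin p) : ℝ :=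
  ∑ bm ∈ ((far x κ Cleaf η).filter fun b => b.1 = X) ×ˢ (Finset.univ : Finset (Fin d → Fin p)),
    couplingMatrix x ρ p X bm.1.2 n bm.2 * forwardCoeff x z bm.1.2 bm.2

open Classical in
/-- The contributions of a cluster and of all larger clusters. -/
noncomputable def backwardCoeff (x : Fin N → Pt d) (κ : Finset (Fin N) → Fin d) (Cleaf : ℕ) (η : ℝ)
    (ρ : Pt d → Pt d → ℝ) (z : Fin N → ℝ) (X : Finset (Fin N)) (n : Fin d → Fin p) : ℝ :=
  couplingCoeff x κ Cleaf η ρ z X n +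
    ∑ P ∈ Finset.univ.filter fun P : Finset (Fin N) => IsCluster x κ Cleaf P ∧ X ⊂ P,
      ∑ m, transferMatrix x p X P n m * couplingCoeff x κ Cleaf η ρ z P m

/-- The sum over `X` splits into sums over the disjoint sons, where nestedness applies. This
recursion avoids the basis matrices of clusters that are not leaves. -/
lemma forwardCoeff_eq_sum_sons (hp : 1 ≤ p) {X : Finset (Fin N)} (hs : sons x κ Cleaf X ≠ ∅)
    (z : Fin N → ℝ) (n : Fin d → Fin p) :
    forwardCoeff x z X n = ∑ Sm ∈ sons x κ Cleaf X ×ˢ (Finset.univ : Finset (Fin d → Fin p)),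
      transferMatrix x p Sm.1 X Sm.2 n * forwardCoeff x z Sm.1 Sm.2 := by
  classical
  have hX : X = (sons x κ Cleaf X).biUnion id := by
    ext i
    constructor
    · intro hi
      obtain ⟨S, hS, hiS⟩ := exists_mem_sons hs hi
      exact Finset.mem_biUnion.2 ⟨S, hS, hiS⟩
    · intro hi
      obtain ⟨S, hS, hiS⟩ := Finset.mem_biUnion.1 hi
      exact subset_of_mem_sons hS hiS
  have hdis : Set.PairwiseDisjoint (sons x κ Cleaf X : Set (Finset (Fin N))) id := by
    intro S hS S' hS' hne
    exact Finset.disjoint_left.2 fun i hi hi' => hne (sons_eq_of_mem hS hS' hi hi')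
  have h1 : forwardCoeff x z X n =
      ∑ S ∈ sons x κ Cleaf X, ∑ j ∈ S, clusterBasis x p X j n * z j := by
    rw [forwardCoeff]
    nth_rw 1 [hX]
    exact Finset.sum_biUnion hdis
  rw [h1, Finset.sum_product]
  refine Finset.sum_congr rfl fun S hS => ?_
  simp only [forwardCoeff, Finset.mul_sum]
  rw [Finset.sum_comm]
  refine Finset.sum_congr rfl fun j hj => ?_
  rw [← sum_clusterBasis_mul_transfer hp X hj n, Finset.sum_mul]
  exact Finset.sum_congr rfl fun m _ => by ring

lemma backwardCoeff_univ (ρ : Pt d → Pt d → ℝ) (z : Fin N → ℝ) (n : Fin d → Fin p) :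
    backwardCoeff x κ Cleaf η ρ z Finset.univ n =
      couplingCoeff x κ Cleaf η ρ z Finset.univ n := by
  classical
  rw [backwardCoeff, Finset.filter_false_of_mem, Finset.sum_empty, add_zero]
  intro P _ h
  exact h.2.2 (Finset.subset_univ _)

/-- The proper ancestors of `X` are `Q` and the proper ancestors of `Q`, and the transfers to the
latter factor through `Q`. One multiplication per level thus passes on all their contributions. -/
lemma backwardCoeff_son (hp : 1 ≤ p) (hx : Function.Injective x)
    (hκ : LongestEdge x κ) (hC : 2 ≤ Cleaf) {X Q : Finset (Fin N)} (hQ : IsCluster x κ Cleaf Q)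
    (hX : X ∈ sons x κ Cleaf Q) (ρ : Pt d → Pt d → ℝ) (z : Fin N → ℝ) (n : Fin d → Fin p) :
    backwardCoeff x κ Cleaf η ρ z X n = couplingCoeff x κ Cleaf η ρ z X n +
      ∑ r, transferMatrix x p X Q n r * backwardCoeff x κ Cleaf η ρ z Q r := by
  classical
  have hXne := nonempty_of_mem_sons hx hκ hC hX
  have hXQ := subset_of_mem_sons hX
  have hcard := card_lt_of_mem_sons hx hκ hC hX
  have hset : (Finset.univ.filter fun P : Finset (Fin N) => IsCluster x κ Cleaf P ∧ X ⊂ P) =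
      insert Q (Finset.univ.filter fun P : Finset (Fin N) => IsCluster x κ Cleaf P ∧ Q ⊂ P) := by
    ext P
    simp only [Finset.mem_filter, Finset.mem_univ, true_and, Finset.mem_insert]
    constructor
    · rintro ⟨hP, hXP⟩
      obtain ⟨i, hi⟩ := hXne
      rcases subset_or_subset_of_mem_sons hQ hX hP hi (hXP.1 hi) with h | h
      · rcases h.eq_or_ssubset with e | h
        · exact Or.inl e.symm
        · exact Or.inr ⟨hP, h⟩
      · exact absurd h hXP.2
    · rintro (rfl | ⟨hP, h⟩)
      · exact ⟨hQ, hXQ, fun h => absurd (Finset.card_le_card h) (not_le.2 hcard)⟩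
      · exact ⟨hP, Finset.ssubset_of_subset_of_ssubset hXQ h⟩
  rw [backwardCoeff, hset, Finset.sum_insert (by simp)]
  congr 1
  simp only [backwardCoeff, mul_add, Finset.sum_add_distrib, Finset.mul_sum]
  congr 1
  symm
  rw [Finset.sum_comm]
  refine Finset.sum_congr rfl fun P _ => ?_
  rw [Finset.sum_comm]
  refine Finset.sum_congr rfl fun m _ => ?_
  rw [← sum_transfer_mul_transfer hp hXne hXQ P n m, Finset.sum_mul]
  exact Finset.sum_congr rfl fun r _ => by ring

open Classical in
/-- The matrix-vector product in terms of the coefficients of the leaf clusters. -/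
lemma h2Matrix_mulVec (hp : 1 ≤ p) {X : Finset (Fin N)}
    (hX : IsCluster x κ Cleaf X) (hl : sons x κ Cleaf X = ∅) {i : Fin N} (hi : i ∈ X)
    (ρ : Pt d → Pt d → ℝ) (z : Fin N → ℝ) :
    (h2Matrix x κ Cleaf η ρ p *ᵥ z) i =
      ∑ n : Fin d → Fin p, clusterBasis x p X i n * backwardCoeff x κ Cleaf η ρ z X n +
      ∑ bj ∈ ((near x κ Cleaf η).filter fun b => i ∈ b.1).sigma fun b => b.2,
        covMatrix x ρ i bj.2 * z bj.2 := by
  have hback : ∑ n : Fin d → Fin p, clusterBasis x p X i n * backwardCoeff x κ Cleaf η ρ z X n =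
      ∑ P ∈ Finset.univ.filter fun P : Finset (Fin N) => IsCluster x κ Cleaf P ∧ i ∈ P,
        ∑ m : Fin d → Fin p, clusterBasis x p P i m * couplingCoeff x κ Cleaf η ρ z P m := by
    -- The clusters containing `i` are its leaf `X` and the proper ancestors of `X`; nestedness
    -- rewrites their bases through that of `X`.
    have hset : (Finset.univ.filter fun P : Finset (Fin N) => IsCluster x κ Cleaf P ∧ i ∈ P) =
        insert X (Finset.univ.filter fun P : Finset (Fin N) => IsCluster x κ Cleaf P ∧ X ⊂ P) := by
      ext P
      simp only [Finset.mem_filter, Finset.mem_univ, true_and, Finset.mem_insert]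
      constructor
      · rintro ⟨hP, hiP⟩
        rcases (leaf_subset_of_mem hX hl hP hi hiP).eq_or_ssubset with e | h
        · exact Or.inl e.symm
        · exact Or.inr ⟨hP, h⟩
      · rintro (rfl | ⟨hP, h⟩)
        · exact ⟨hX, hi⟩
        · exact ⟨hP, h.1 hi⟩
    rw [hset, Finset.sum_insert (by simp)]
    simp only [backwardCoeff, mul_add, Finset.sum_add_distrib, Finset.mul_sum]
    congr 1
    rw [Finset.sum_comm]
    refine Finset.sum_congr rfl fun P _ => ?_
    rw [Finset.sum_comm]
    refine Finset.sum_congr rfl fun m _ => ?_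
    rw [← sum_clusterBasis_mul_transfer hp P hi m, Finset.sum_mul]
    exact Finset.sum_congr rfl fun r _ => by ring
  have hfar : ∑ j, (∑ b ∈ far x κ Cleaf η, if i ∈ b.1 ∧ j ∈ b.2 then
      ∑ n : Fin d → Fin p, ∑ m : Fin d → Fin p,
        clusterBasis x p b.1 i n * couplingMatrix x ρ p b.1 b.2 n m * clusterBasis x p b.2 j m
      else 0) * z j =
      ∑ P ∈ Finset.univ.filter fun P : Finset (Fin N) => IsCluster x κ Cleaf P ∧ i ∈ P,
        ∑ m : Fin d → Fin p, clusterBasis x p P i m * couplingCoeff x κ Cleaf η ρ z P m := by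
    have hb : ∀ b ∈ far x κ Cleaf η, ∑ j, (if i ∈ b.1 ∧ j ∈ b.2 then
        ∑ n : Fin d → Fin p, ∑ m : Fin d → Fin p,
          clusterBasis x p b.1 i n * couplingMatrix x ρ p b.1 b.2 n m * clusterBasis x p b.2 j m
        else 0) * z j = if i ∈ b.1 then ∑ n : Fin d → Fin p, clusterBasis x p b.1 i n *
          ∑ m : Fin d → Fin p, couplingMatrix x ρ p b.1 b.2 n m * forwardCoeff x z b.2 m
        else 0 := by
      intro b _
      by_cases hib : i ∈ b.1
      · simp only [hib, true_and, if_true, forwardCoeff, ite_mul, zero_mul]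
        rw [← Finset.sum_filter, Finset.filter_mem_eq_inter, Finset.univ_inter]
        simp only [Finset.sum_mul, Finset.mul_sum]
        rw [Finset.sum_comm]
        refine Finset.sum_congr rfl fun n _ => ?_
        rw [Finset.sum_comm]
        exact Finset.sum_congr rfl fun m _ => Finset.sum_congr rfl fun j _ => by ring
      · simp [hib]
    simp only [Finset.sum_mul]
    rw [Finset.sum_comm, Finset.sum_congr rfl hb, ← Finset.sum_filter]
    -- The far-field blocks meeting row `i` are grouped by their row cluster.
    rw [← Finset.sum_fiberwise_of_maps_to (g := Prod.fst)
      (t := Finset.univ.filter fun P : Finset (Fin N) => IsCluster x κ Cleaf P ∧ i ∈ P)]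
    · refine Finset.sum_congr rfl fun P hP => ?_
      have hiP := (Finset.mem_filter.1 hP).2.2
      have hset : (((far x κ Cleaf η).filter fun b => i ∈ b.1).filter fun b => b.1 = P) =
          (far x κ Cleaf η).filter fun b => b.1 = P := by
        rw [Finset.filter_filter]
        refine Finset.filter_congr fun b _ => ⟨fun h => h.2, fun h => ⟨h ▸ hiP, h⟩⟩
      rw [hset]
      simp only [couplingCoeff, Finset.sum_product]
      simp only [Finset.mul_sum]
      rw [Finset.sum_comm]
      refine Finset.sum_congr rfl fun n _ => Finset.sum_congr rfl fun b hb => ?_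
      rw [(Finset.mem_filter.1 hb).2]
    · intro b hb
      obtain ⟨hbf, hib⟩ := Finset.mem_filter.1 hb
      exact Finset.mem_filter.2 ⟨Finset.mem_univ _, (mem_far.1 hbf).1.isCluster.1, hib⟩
  have hnear : ∑ j, (∑ b ∈ near x κ Cleaf η, if i ∈ b.1 ∧ j ∈ b.2 then ρ (x i) (x j) else 0) * z j =
      ∑ bj ∈ ((near x κ Cleaf η).filter fun b => i ∈ b.1).sigma fun b => b.2,
        covMatrix x ρ i bj.2 * z bj.2 := by
    rw [Finset.sum_sigma, Finset.sum_filter]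
    simp only [Finset.sum_mul]
    rw [Finset.sum_comm]
    refine Finset.sum_congr rfl fun b _ => ?_
    by_cases hib : i ∈ b.1
    · simp only [hib, true_and, if_true, ite_mul, zero_mul]
      rw [← Finset.sum_filter, Finset.filter_mem_eq_inter, Finset.univ_inter]
      rfl
    · simp [hib]
  rw [hback, ← hfar, ← hnear, ← Finset.sum_add_distrib]
  simp only [Matrix.mulVec, dotProduct, h2Matrix, Matrix.of_apply, add_mul]

open Classical in
/-- The matrix-vector product is computed by a straight-line program. -/
lemma exists_program (hp : 1 ≤ p) (hN : 0 < N) (hx : Function.Injective x)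
    (hκ : LongestEdge x κ) (hC : 2 ≤ Cleaf) :
    ∃ P : Program (Fin N ⊕ MemUnit x κ Cleaf η p) (Fin N),
      P.cost ≤ 1 +
        (Finset.univ.filter fun X : Finset (Fin N) => IsCluster x κ Cleaf X).card *
          (p ^ d * (2 * Cleaf + 4 * p ^ d)) +
        2 * (p ^ d * p ^ d) * (far x κ Cleaf η).card +
        (Finset.univ.filter fun X : Finset (Fin N) => IsCluster x κ Cleaf X).card *
          (p ^ d * (2 * p ^ d + 1)) +
        (N * (2 * p ^ d + 1) + 2 * (Cleaf * Cleaf * (near x κ Cleaf η).card)) ∧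
      ∀ (ρ : Pt d → Pt d → ℝ) (z : Fin N → ℝ),
        P.run (Sum.elim z (memory x κ Cleaf η ρ p)) = h2Matrix x κ Cleaf η ρ p *ᵥ z := by
  set env : (Pt d → Pt d → ℝ) × (Fin N → ℝ) → Fin N ⊕ MemUnit x κ Cleaf η p → ℝ :=
    fun θ => Sum.elim θ.2 (memory x κ Cleaf η θ.1 p) with henv
  set 𝒞 := Finset.univ.filter fun X : Finset (Fin N) => IsCluster x κ Cleaf X with h𝒞
  have hcl : ∀ {X}, X ∈ 𝒞 ↔ IsCluster x κ Cleaf X := by simp [h𝒞]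
  have hcardn : Fintype.card (Fin d → Fin p) = p ^ d := by simp
  have hz : ∀ (code) (j : Fin N), Avail env code fun θ => θ.2 j := fun code j =>
    avail_input (Sum.inl j)
  -- a zero
  obtain ⟨c₀, -, hl₀, h₀⟩ : ∃ code', ([] : List (Instr (Fin N ⊕ MemUnit x κ Cleaf η p))) <+: code' ∧
      code'.length ≤ 0 + 1 ∧ Avail env code' fun _ => 0 := by
    obtain ⟨c, h1, h2, h3⟩ := (hz [] ⟨0, hN⟩).op (hz [] ⟨0, hN⟩) .sub
    exact ⟨c, h1, h2, by simpa [ArithOp.eval] using h3⟩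
  -- forward transformation
  obtain ⟨c₁, hp₁, hl₁, h₁⟩ := exists_code_of_tasks (code := c₀) 𝒞 Finset.card
    (fun _ => p ^ d * (2 * Cleaf + 4 * p ^ d))
    (P := fun X code => ∀ m : Fin d → Fin p, Avail env code fun θ => forwardCoeff x θ.2 X m)
    (fun X _ _ hp h m => (h m).mono hp) (by
      intro X hX code hpre hsm
      rw [← hcardn]
      refine exists_code_of_avail _ fun n code₁ hpre₁ => ?_
      by_cases hs : sons x κ Cleaf X = ∅
      · obtain ⟨code₂, h1, h2, h3⟩ := exists_avail_sum (code := code₁) (env := env) X.attach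
          (f := fun j _ => clusterBasis x p X j.1 n) (g := fun j θ => θ.2 j.1)
          (h₀.mono (hpre.trans hpre₁))
          (fun j _ => avail_input (Sum.inr (MemUnit.leaf X (hcl.1 hX) hs j.1 j.2 n)))
          (fun j _ => hz _ _)
        refine ⟨code₂, h1, h2.trans ?_, ?_⟩
        · have := sons_eq_empty.1 hs
          rw [Finset.card_attach]
          omega
        · simp only [forwardCoeff]
          convert h3 using 2 with θ
          exact (Finset.sum_attach X fun j => clusterBasis x p X j n * θ.2 j).symm
      · obtain ⟨code₂, h1, h2, h3⟩ := exists_avail_sum (code := code₁) (env := env)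
          (sons x κ Cleaf X ×ˢ (Finset.univ : Finset (Fin d → Fin p)))
          (f := fun Sm _ => transferMatrix x p Sm.1 X Sm.2 n)
          (g := fun Sm θ => forwardCoeff x θ.2 Sm.1 Sm.2)
          (h₀.mono (hpre.trans hpre₁))
          (fun Sm hSm => avail_input (Sum.inr (MemUnit.transfer X Sm.1 (hcl.1 hX)
            (Finset.mem_product.1 hSm).1 Sm.2 n)))
          (fun Sm hSm => by
            have hS := (Finset.mem_product.1 hSm).1
            -- Sons have fewer points, so ranking by cardinality treats them before their parent.
            exact (hsm Sm.1 (hcl.2 (.son (hcl.1 hX) hS)) (card_lt_of_mem_sons hx hκ hC hS)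
              Sm.2).mono hpre₁)
        refine ⟨code₂, h1, h2.trans ?_, ?_⟩
        · have h4 := card_sons_le (x := x) (κ := κ) (Cleaf := Cleaf) X
          rw [Finset.card_product, Finset.card_univ]
          nlinarith
        · simp only [forwardCoeff_eq_sum_sons hp hs]
          exact h3)
  -- multiplication by the coupling matrices
  obtain ⟨c₂, hp₂, hl₂, h₂⟩ := exists_code_of_tasks (code := c₁) 𝒞 (fun _ => 0)
    (fun X => p ^ d * (2 * (((far x κ Cleaf η).filter fun b => b.1 = X).card * p ^ d)))
    (P := fun X code => ∀ m : Fin d → Fin p,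
      Avail env code fun θ => couplingCoeff x κ Cleaf η θ.1 θ.2 X m)
    (fun X _ _ hp h m => (h m).mono hp) (by
      intro X hX code hpre _
      rw [← hcardn]
      refine exists_code_of_avail _ fun n code₁ hpre₁ => ?_
      obtain ⟨code₂, h1, h2, h3⟩ := exists_avail_sum (code := code₁) (env := env)
          (((far x κ Cleaf η).filter fun b => b.1 = X) ×ˢ (Finset.univ : Finset (Fin d → Fin p)))
          (f := fun bm θ => couplingMatrix x θ.1 p X bm.1.2 n bm.2)
          (g := fun bm θ => forwardCoeff x θ.2 bm.1.2 bm.2)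
          (h₀.mono (hp₁.trans (hpre.trans hpre₁)))
          (fun bm hbm => by
            obtain ⟨hb, hX⟩ := Finset.mem_filter.1 (Finset.mem_product.1 hbm).1
            exact avail_input (Sum.inr (MemUnit.coupling X bm.1.2 (by rw [← hX]; exact hb) n bm.2)))
          (fun bm hbm => by
            have hb := (Finset.mem_filter.1 (Finset.mem_product.1 hbm).1).1
            exact (h₁ _ (hcl.2 (mem_far.1 hb).1.isCluster.2) bm.2).mono (hpre.trans hpre₁))
      refine ⟨code₂, h1, h2.trans ?_, h3⟩
      rw [Finset.card_product, Finset.card_univ])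
  -- backward transformation
  obtain ⟨c₃, hp₃, hl₃, h₃⟩ := exists_code_of_tasks (code := c₂) 𝒞 (fun X => N - X.card)
    (fun _ => p ^ d * (2 * p ^ d + 1))
    (P := fun X code => ∀ m : Fin d → Fin p,
      Avail env code fun θ => backwardCoeff x κ Cleaf η θ.1 θ.2 X m)
    (fun X _ _ hp h m => (h m).mono hp) (by
      intro X hX code hpre hlg
      rw [← hcardn]
      refine exists_code_of_avail _ fun n code₁ hpre₁ => ?_
      cases hcl.1 hX with
      | root =>
        refine ⟨code₁, List.prefix_rfl, by omega, ?_⟩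
        simp only [backwardCoeff_univ]
        exact (h₂ _ hX n).mono (hpre.trans hpre₁)
      | @son Q _ hQ hXQ =>
        have hlt := card_lt_of_mem_sons hx hκ hC hXQ
        have hQN : Q.card ≤ N := by simpa using Finset.card_le_univ Q
        obtain ⟨code₂, h1, h2, h3⟩ := exists_avail_sum (code := code₁) (env := env)
          (Finset.univ : Finset (Fin d → Fin p))
          (f := fun r _ => transferMatrix x p X Q n r)
          (g := fun r θ => backwardCoeff x κ Cleaf η θ.1 θ.2 Q r)
          (h₀.mono (hp₁.trans (hp₂.trans (hpre.trans hpre₁))))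
          (fun r _ => avail_input (Sum.inr (MemUnit.transfer Q X hQ hXQ n r)))
          -- The rank `N - card` reverses the order: a parent is treated before its sons.
          (fun r _ => (hlg Q (hcl.2 hQ) (by omega) r).mono hpre₁)
        obtain ⟨code₃, h4, h5, h6⟩ := ((h₂ X hX n).mono (hpre.trans (hpre₁.trans h1))).op h3 .add
        refine ⟨code₃, h1.trans h4, ?_, ?_⟩
        · rw [Finset.card_univ] at h2
          omega
        · simp only [backwardCoeff_son hp hx hκ hC hQ hXQ]
          exact h6)
  -- output
  obtain ⟨c₄, hp₄, hl₄, h₄⟩ := exists_code_of_tasks (code := c₃) (Finset.univ : Finset (Fin N))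
    (fun _ => 0) (fun i => 2 * p ^ d + 1 +
      2 * (((near x κ Cleaf η).filter fun b => i ∈ b.1).card * Cleaf))
    (P := fun i code => Avail env code fun θ => (h2Matrix x κ Cleaf η θ.1 p *ᵥ θ.2) i)
    (fun i _ _ hp h => h.mono hp) (by
      intro i _ code hpre _
      obtain ⟨X, hX, hl, hi⟩ := exists_leaf_mem hx hκ hC i
      have h0 := h₀.mono (hp₁.trans (hp₂.trans (hp₃.trans hpre)))
      obtain ⟨code₁, h1, h2, h3⟩ := exists_avail_sum (code := code) (env := env)
        (Finset.univ : Finset (Fin d → Fin p))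
        (f := fun n _ => clusterBasis x p X i n)
        (g := fun n θ => backwardCoeff x κ Cleaf η θ.1 θ.2 X n) h0
        (fun n _ => avail_input (Sum.inr (MemUnit.leaf X hX hl i hi n)))
        (fun n _ => (h₃ X (hcl.2 hX) n).mono hpre)
      obtain ⟨code₂, h4, h5, h6⟩ := exists_avail_sum (code := code₁) (env := env)
        (((near x κ Cleaf η).filter fun b => i ∈ b.1).sigma fun b => b.2)
        (f := fun bj θ => covMatrix x θ.1 i bj.2) (g := fun bj θ => θ.2 bj.2) (h0.mono h1)
        (fun bj hbj => by
          obtain ⟨hb, hj⟩ := Finset.mem_sigma.1 hbj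
          obtain ⟨hb, hi⟩ := Finset.mem_filter.1 hb
          exact avail_input (Sum.inr (MemUnit.nearfield bj.1.1 bj.1.2 hb i bj.2 hi hj)))
        (fun bj _ => hz _ _)
      obtain ⟨code₃, h7, h8, h9⟩ := (h3.mono h4).op h6 .add
      refine ⟨code₃, h1.trans (h4.trans h7), ?_, ?_⟩
      -- An inadmissible leaf block consists of two leaf clusters, so it has at most `Cleaf`
      -- columns.
      · have hsig : (((near x κ Cleaf η).filter fun b => i ∈ b.1).sigma fun b => b.2).card ≤
            ((near x κ Cleaf η).filter fun b => i ∈ b.1).card * Cleaf := by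
          rw [Finset.card_sigma]
          refine Finset.sum_le_card_nsmul _ _ _ fun b hb => ?_
          obtain ⟨-, hl, hna⟩ := mem_near.1 (Finset.mem_filter.1 hb).1
          exact sons_eq_empty.1 ((blockSons_eq_empty.1 hl).resolve_left hna).2
        rw [Finset.card_univ, hcardn] at h2
        omega
      · simp only [h2Matrix_mulVec hp hX hl hi]
        exact h9)
  choose o _ ho using fun i => h₄ i (Finset.mem_univ i)
  refine ⟨⟨c₄, o⟩, ?_, fun ρ z => funext fun i => ho i (ρ, z)⟩
  change c₄.length ≤ _
  have hfar : ∑ X ∈ 𝒞, p ^ d * (2 * (((far x κ Cleaf η).filter fun b => b.1 = X).card * p ^ d)) =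
      2 * (p ^ d * p ^ d) * (far x κ Cleaf η).card := by
    rw [Finset.card_eq_sum_card_fiberwise (f := Prod.fst) (s := far x κ Cleaf η) (t := 𝒞)
      fun b hb => hcl.2 (mem_far.1 hb).1.isCluster.1, Finset.mul_sum]
    exact Finset.sum_congr rfl fun X _ => by ring
  have hnear : ∑ i : Fin N, (2 * p ^ d + 1 +
      2 * (((near x κ Cleaf η).filter fun b => i ∈ b.1).card * Cleaf)) ≤
      N * (2 * p ^ d + 1) + 2 * (Cleaf * Cleaf * (near x κ Cleaf η).card) := by
    rw [Finset.sum_add_distrib, ← Finset.mul_sum, ← Finset.sum_mul]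
    have h1 : ∑ i : Fin N, ((near x κ Cleaf η).filter fun b => i ∈ b.1).card =
        ∑ b ∈ near x κ Cleaf η, b.1.card := by
      simp only [Finset.card_filter]
      rw [Finset.sum_comm]
      exact Finset.sum_congr rfl fun b _ => by simp
    have h2 : ∑ b ∈ near x κ Cleaf η, b.1.card ≤ (near x κ Cleaf η).card * Cleaf := by
      refine Finset.sum_le_card_nsmul _ _ _ fun b hb => ?_
      obtain ⟨-, hl, hna⟩ := mem_near.1 hb
      exact sons_eq_empty.1 ((blockSons_eq_empty.1 hl).resolve_left hna).1
    have h3 := Nat.mul_le_mul_right Cleaf h2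
    rw [h1]
    simp only [Finset.sum_const, Finset.card_univ, Fintype.card_fin, smul_eq_mul]
    nlinarith
  simp only [Finset.sum_const, smul_eq_mul] at hl₁ hl₃
  rw [hfar] at hl₂
  omega

end MatVec

/-! ### Matrix norms -/

section Norms

variable {N : ℕ}

lemma frobNorm_nonneg (A : Matrix (Fin N) (Fin N) ℝ) : 0 ≤ frobNorm A := Real.sqrt_nonneg _

/-- Cauchy-Schwarz in each row. -/
lemma sum_mulVec_sq_le (A : Matrix (Fin N) (Fin N) ℝ) (v : Fin N → ℝ) :
    ∑ i, (A *ᵥ v) i ^ 2 ≤ frobNorm A ^ 2 * ∑ i, v i ^ 2 := by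
  rw [frobNorm, Real.sq_sqrt (Finset.sum_nonneg fun _ _ => Finset.sum_nonneg fun _ _ =>
    by positivity), Finset.sum_mul]
  refine Finset.sum_le_sum fun i _ => ?_
  simp only [sq_abs]
  exact Finset.sum_mul_sq_le_sq_mul_sq Finset.univ (A i) v

lemma specNorm_le_frobNorm (A : Matrix (Fin N) (Fin N) ℝ) : specNorm A ≤ frobNorm A := by
  refine ContinuousLinearMap.opNorm_le_bound _ (frobNorm_nonneg A) fun v => ?_
  rw [EuclideanSpace.norm_eq, EuclideanSpace.norm_eq]
  refine Real.sqrt_le_iff.2 ⟨mul_nonneg (frobNorm_nonneg A) (Real.sqrt_nonneg _), ?_⟩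
  rw [mul_pow, Real.sq_sqrt (Finset.sum_nonneg fun _ _ => by positivity)]
  have := sum_mulVec_sq_le A v.ofLp
  simpa using this

lemma abs_mulVec_dotProduct_le (A : Matrix (Fin N) (Fin N) ℝ) (v : Fin N → ℝ) :
    |(A *ᵥ v) ⬝ᵥ v| ≤ frobNorm A * (v ⬝ᵥ v) := by
  have hv : v ⬝ᵥ v = ∑ i, v i ^ 2 := by simp [dotProduct, sq]
  have hv0 : 0 ≤ v ⬝ᵥ v := by rw [hv]; positivity
  refine abs_le_of_sq_le_sq ?_ (mul_nonneg (frobNorm_nonneg A) hv0)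
  calc ((A *ᵥ v) ⬝ᵥ v) ^ 2 ≤ (∑ i, (A *ᵥ v) i ^ 2) * ∑ i, v i ^ 2 :=
        Finset.sum_mul_sq_le_sq_mul_sq _ _ _
    _ ≤ (frobNorm A ^ 2 * ∑ i, v i ^ 2) * ∑ i, v i ^ 2 :=
        mul_le_mul_of_nonneg_right (sum_mulVec_sq_le A v) (by positivity)
    _ = _ := by rw [hv]; ring

lemma frobNorm_le_of_forall_abs_le {A : Matrix (Fin N) (Fin N) ℝ} {e : ℝ} (he : 0 ≤ e)
    (h : ∀ i j, |A i j| ≤ e) : frobNorm A ≤ N * e := by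
  refine Real.sqrt_le_iff.2 ⟨by positivity, ?_⟩
  calc ∑ i, ∑ j, |A i j| ^ 2 ≤ ∑ _i : Fin N, ∑ _j : Fin N, e ^ 2 :=
        Finset.sum_le_sum fun i _ => Finset.sum_le_sum fun j _ =>
          pow_le_pow_left₀ (abs_nonneg _) (h i j) 2
    _ = (N * e) ^ 2 := by simp; ring

/-- A symmetric matrix is positive definite if its distance to a matrix `A` is smaller than the
smallest eigenvalue of `A`. -/
lemma posDef_of_frobNorm_sub_lt {A B : Matrix (Fin N) (Fin N) ℝ} (hB : B.IsSymm)
    (h : frobNorm (A - B) < lambdaMin A) : B.PosDef := by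
  refine Matrix.PosDef.of_dotProduct_mulVec_pos ?_ fun v hv => ?_
  · rw [Matrix.IsHermitian, Matrix.conjTranspose_eq_transpose_of_trivial]; exact hB
  · have hvv : 0 < v ⬝ᵥ v := by
      rw [(by simp [dotProduct, sq] : v ⬝ᵥ v = ∑ i, v i ^ 2)]
      obtain ⟨i, hi⟩ := Function.ne_iff.1 hv
      exact Finset.sum_pos' (fun _ _ => by positivity)
        ⟨i, Finset.mem_univ _, by have : v i ≠ 0 := hi; positivity⟩
    -- A real infimum lies below its members only if the family is bounded below; `-frobNorm A` is
    -- such a bound for the Rayleigh quotients.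
    have h1 : lambdaMin A ≤ ((A *ᵥ v) ⬝ᵥ v) / (v ⬝ᵥ v) := by
      refine ciInf_le (f := fun z : {z : Fin N → ℝ // z ≠ 0} => ((A *ᵥ z.1) ⬝ᵥ z.1) / (z.1 ⬝ᵥ z.1))
        ⟨-frobNorm A, ?_⟩ ⟨v, hv⟩
      rintro _ ⟨⟨z, hz⟩, rfl⟩
      have h2 := (abs_le.1 (abs_mulVec_dotProduct_le A z)).1
      have hzz : 0 ≤ z ⬝ᵥ z := by
        rw [(by simp [dotProduct, sq] : z ⬝ᵥ z = ∑ i, z i ^ 2)]; positivity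
      rcases hzz.eq_or_lt with h0 | h0
      · simp only [← h0, div_zero]
        linarith [frobNorm_nonneg A]
      · simp only
        rw [le_div_iff₀ h0]
        linarith
    rw [le_div_iff₀ hvv] at h1
    have h2 := (abs_le.1 (abs_mulVec_dotProduct_le (A - B) v)).2
    rw [Matrix.sub_mulVec, sub_dotProduct] at h2
    rw [star_trivial, dotProduct_comm]
    have h3 := mul_lt_mul_of_pos_right h hvv
    linarith

end Norms

/-! ### Entries of the matrix -/

section Entries

variable {d N p Cleaf : ℕ} {x : Fin N → Pt d} {κ : Finset (Fin N) → Fin d} {η : ℝ}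
  {ρ : Pt d → Pt d → ℝ}

/-- All other summands vanish, since no other leaf block contains `(i, j)`. -/
lemma h2Matrix_apply_far {b : Finset (Fin N) × Finset (Fin N)} (hb : b ∈ far x κ Cleaf η)
    {i j : Fin N} (hi : i ∈ b.1) (hj : j ∈ b.2) :
    h2Matrix x κ Cleaf η ρ p i j = ∑ n : Fin d → Fin p, ∑ m : Fin d → Fin p,
      boxBasis (bbox x b.1) n (x i) * ρ (boxNode (bbox x b.1) n) (boxNode (bbox x b.2) m) *
        boxBasis (bbox x b.2) m (x j) := by
  obtain ⟨h1, h2, h3⟩ := mem_far.1 hb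
  have hnear : ∑ b' ∈ near x κ Cleaf η,
      (if i ∈ b'.1 ∧ j ∈ b'.2 then ρ (x i) (x j) else 0) = 0 := by
    refine Finset.sum_eq_zero fun b' hb' => ?_
    obtain ⟨h1', h2', h3'⟩ := mem_near.1 hb'
    refine if_neg fun h => h3' ?_
    rw [leafBlock_unique h1' h2' h1 h2 (ij := (i, j)) h ⟨hi, hj⟩]
    exact h3
  rw [h2Matrix, Matrix.of_apply, hnear, add_zero, Finset.sum_eq_single_of_mem b hb,
    if_pos ⟨hi, hj⟩]
  · rfl
  · intro b' hb' hne
    obtain ⟨h1', h2', -⟩ := mem_far.1 hb'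
    exact if_neg fun h => hne (leafBlock_unique h1' h2' h1 h2 (ij := (i, j)) h ⟨hi, hj⟩)

lemma h2Matrix_apply_near {b : Finset (Fin N) × Finset (Fin N)} (hb : b ∈ near x κ Cleaf η)
    {i j : Fin N} (hi : i ∈ b.1) (hj : j ∈ b.2) :
    h2Matrix x κ Cleaf η ρ p i j = ρ (x i) (x j) := by
  obtain ⟨h1, h2, h3⟩ := mem_near.1 hb
  rw [h2Matrix, Matrix.of_apply, Finset.sum_eq_zero, zero_add, Finset.sum_eq_single_of_mem b hb,
    if_pos ⟨hi, hj⟩]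
  · intro b' hb' hne
    obtain ⟨h1', h2', -⟩ := mem_near.1 hb'
    exact if_neg fun h => hne (leafBlock_unique h1' h2' h1 h2 (ij := (i, j)) h ⟨hi, hj⟩)
  · intro b' hb'
    obtain ⟨h1', h2', h3'⟩ := mem_far.1 hb'
    refine if_neg fun h => h3 ?_
    rw [← leafBlock_unique h1' h2' h1 h2 (ij := (i, j)) h ⟨hi, hj⟩]
    exact h3'

lemma exists_far_or_near (hx : Function.Injective x) (hκ : LongestEdge x κ) (hC : 2 ≤ Cleaf)
    (i j : Fin N) : ∃ b : Finset (Fin N) × Finset (Fin N),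
      (b ∈ far x κ Cleaf η ∨ b ∈ near x κ Cleaf η) ∧ i ∈ b.1 ∧ j ∈ b.2 := by
  obtain ⟨b, h1, h2, hi, hj⟩ := exists_leafBlock (η := η) hx hκ hC i j
  by_cases h : Admissible η (bbox x b.1) (bbox x b.2)
  · exact ⟨b, Or.inl (mem_far.2 ⟨h1, h2, h⟩), hi, hj⟩
  · exact ⟨b, Or.inr (mem_near.2 ⟨h1, h2, h⟩), hi, hj⟩

lemma IsBlock.swap {b : Finset (Fin N) × Finset (Fin N)} (h : IsBlock x κ Cleaf η b) :
    IsBlock x κ Cleaf η b.swap := by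
  induction h with
  | root => exact .root
  | son _ hs ih =>
    obtain ⟨h1, h2, h3, h4⟩ := mem_blockSons.1 hs
    exact .son ih (mem_blockSons.2 ⟨fun h => h1 (admissible_comm.1 h), fun h => h2 h.symm, h4, h3⟩)

lemma blockSons_swap_eq_empty {b : Finset (Fin N) × Finset (Fin N)}
    (h : blockSons x κ Cleaf η b = ∅) : blockSons x κ Cleaf η b.swap = ∅ :=
  blockSons_eq_empty.2 ((blockSons_eq_empty.1 h).imp admissible_comm.1 And.symm)

/-- Admissibility and the subdivision rule are symmetric, so the block tree is invariant under
exchanging the two clusters. The kernel is evaluated only in the bounding box of all points, where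
it is symmetric. -/
lemma h2Matrix_isSymm {E : Set (Pt d)} (hx : Function.Injective x) (hκ : LongestEdge x κ)
    (hC : 2 ≤ Cleaf) (hE : (bbox x Finset.univ).toSet ⊆ E)
    (hρ : ∀ y ∈ E, ∀ y' ∈ E, ρ y y' = ρ y' y) : (h2Matrix x κ Cleaf η ρ p).IsSymm := by
  refine Matrix.IsSymm.ext fun i j => ?_
  obtain ⟨b, hb, hi, hj⟩ := exists_far_or_near (η := η) hx hκ hC i j
  rcases hb with hb | hb
  · obtain ⟨h1, h2, h3⟩ := mem_far.1 hb
    have hb' : b.swap ∈ far x κ Cleaf η :=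
      mem_far.2 ⟨h1.swap, blockSons_swap_eq_empty h2, admissible_comm.1 h3⟩
    rw [h2Matrix_apply_far hb hi hj, h2Matrix_apply_far hb' (i := j) (j := i) hj hi,
      Finset.sum_comm]
    refine Finset.sum_congr rfl fun n _ => Finset.sum_congr rfl fun m _ => ?_
    have hm1 := hE (bbox_toSet_subset ⟨i, hi⟩ (Finset.subset_univ _) (boxNode_bbox_mem b.1 n))
    have hm2 := hE (bbox_toSet_subset ⟨j, hj⟩ (Finset.subset_univ _) (boxNode_bbox_mem b.2 m))
    simp only [Prod.fst_swap, Prod.snd_swap]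
    rw [hρ _ hm1 _ hm2]
    ring
  · obtain ⟨h1, h2, h3⟩ := mem_near.1 hb
    have hb' : b.swap ∈ near x κ Cleaf η :=
      mem_near.2 ⟨h1.swap, blockSons_swap_eq_empty h2, fun h => h3 (admissible_comm.1 h)⟩
    rw [h2Matrix_apply_near hb hi hj, h2Matrix_apply_near hb' (i := j) (j := i) hj hi]
    exact hρ _ (hE (mem_bbox x (Finset.mem_univ _))) _ (hE (mem_bbox x (Finset.mem_univ _)))

lemma edge_le_diam (hκ : LongestEdge x κ) {X : Finset (Fin N)} (hX : X.Nonempty) (k : Fin d) :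
    (bbox x X).edge k ≤ (bbox x X).diam := by
  obtain ⟨i, hi, hil⟩ := exists_bbox_lo_eq x hX k
  obtain ⟨j, hj, hjh⟩ := exists_bbox_hi_eq x hX k
  have hbdd : Bornology.IsBounded (bbox x X).toSet :=
    Metric.isBounded_iff.2 ⟨d * len x κ X, fun y hy z hz => by
      rw [dist_eq_norm]
      exact norm_sub_le_mul (len_nonneg x κ X) fun k => abs_sub_le_len hκ hy hz k⟩
  calc (bbox x X).edge k = (x j - x i) k := by simp [Box.edge, hil, hjh]
    _ ≤ ‖x j - x i‖ := (le_abs_self _).trans (abs_coord_le_norm _ _)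
    _ = dist (x j) (x i) := (dist_eq_norm _ _).symm
    _ ≤ _ := Metric.dist_le_diam_of_mem hbdd (mem_bbox x hj) (mem_bbox x hi)

/-- The error of an entry. -/
lemma abs_covMatrix_sub_h2Matrix_le {E : Set (Pt d)} {c₁ c₂ Λ : ℝ} (hp : 1 ≤ p)
    (hx : Function.Injective x) (hκ : LongestEdge x κ) (hC : 2 ≤ Cleaf) (hη : 0 < η)
    (hc₁ : 0 ≤ c₁) (hc₂ : 0 < c₂) (hEo : IsOpen E) (hE : (bbox x Finset.univ).toSet ⊆ E)
    (hρ : AsympSmooth E c₁ c₂ ρ) (hΛ0 : 0 ≤ Λ)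
    (hΛ : ∀ t ∈ Set.Icc (-1 : ℝ) 1, ∑ k : Fin p, |chebBasis p k t| ≤ Λ) (i j : Fin N) :
    |(covMatrix x ρ - h2Matrix x κ Cleaf η ρ p) i j| ≤
      ((∑ r ∈ Finset.range d, Λ ^ r) * (1 + Λ ^ d)) * (2 * c₁ * (η / (4 * c₂)) ^ p) := by
  have h0 : 0 ≤ ((∑ r ∈ Finset.range d, Λ ^ r) * (1 + Λ ^ d)) * (2 * c₁ * (η / (4 * c₂)) ^ p) := by
    positivity
  rw [Matrix.sub_apply]
  obtain ⟨b, hb, hi, hj⟩ := exists_far_or_near (η := η) hx hκ hC i j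
  rcases hb with hb | hb
  · obtain ⟨-, -, hadm⟩ := mem_far.1 hb
    rw [h2Matrix_apply_far hb hi hj]
    have he1 : ∀ k, (bbox x b.1).edge k ≤ η * (bbox x b.1).dist (bbox x b.2) := fun k =>
      (edge_le_diam hκ ⟨i, hi⟩ k).trans ((le_max_left _ _).trans hadm)
    have he2 : ∀ k, (bbox x b.2).edge k ≤ η * (bbox x b.1).dist (bbox x b.2) := fun k =>
      (edge_le_diam hκ ⟨j, hj⟩ k).trans ((le_max_right _ _).trans hadm)
    -- At distance zero, admissibility forces both boxes to be single points; a singleton paired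
    -- with itself is such a block. All nodes then coincide with the points, and interpolation is
    -- exact although the kernel need not be smooth there.
    rcases (Box.dist_nonneg (bbox x b.1) (bbox x b.2)).eq_or_lt with hd | hd
    · have hnode : ∀ (X : Finset (Fin N)) (l : Fin N), l ∈ X → (∀ k, (bbox x X).edge k ≤ 0) →
          ∀ n : Fin d → Fin p, boxNode (bbox x X) n = x l := by
        intro X l hl he n
        ext k
        have hek := le_antisymm (he k) (bbox_edge_nonneg x X k)
        rw [Box.coord_eq_of_edge_eq_zero (mem_bbox x hl) k hek]
        simp [boxNode, hek]
      rw [← hd, mul_zero] at he1 he2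
      simp only [hnode b.1 i hi he1, hnode b.2 j hj he2]
      simp only [← Finset.mul_sum, sum_boxBasis hp, mul_one]
      rw [← Finset.sum_mul, sum_boxBasis hp, one_mul, covMatrix, Matrix.of_apply, sub_self,
        abs_zero]
      exact h0
    · exact hρ.abs_sub_boxInterp_le hp hEo hc₁ hc₂ hd hΛ (bbox_lo_le_hi x b.1)
        (bbox_lo_le_hi x b.2) ((bbox_toSet_subset ⟨i, hi⟩ (Finset.subset_univ _)).trans hE)
        ((bbox_toSet_subset ⟨j, hj⟩ (Finset.subset_univ _)).trans hE)
        (fun y hy z hz => Box.dist_le hy hz) he1 he2 (mem_bbox x hi) (mem_bbox x hj)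
  · rw [h2Matrix_apply_near hb hi hj, covMatrix, Matrix.of_apply, sub_self, abs_zero]
    exact h0

/-- The two factors of the entry bound are at most `d Λ ^ (d - 1)` and `2 Λ ^ d`, which gives the
exponent `2d - 1`. -/
lemma frobNorm_covMatrix_sub_h2Matrix_le {E : Set (Pt d)} {c₁ c₂ : ℝ} (hd : 0 < d) (hp : 1 ≤ p)
    (hx : Function.Injective x) (hκ : LongestEdge x κ) (hC : 2 ≤ Cleaf) (hη : 0 < η)
    (hc₁ : 0 ≤ c₁) (hc₂ : 0 < c₂) (hEo : IsOpen E) (hE : (bbox x Finset.univ).toSet ⊆ E)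
    (hρ : AsympSmooth E c₁ c₂ ρ) :
    frobNorm (covMatrix x ρ - h2Matrix x κ Cleaf η ρ p) ≤
      (4 * d * c₁ * 20 ^ (2 * d - 1)) * N * (Real.log p + 1) ^ (2 * d - 1) *
        (η / (4 * c₂)) ^ p := by
  set Λ : ℝ := 20 * (Real.log p + 1) with hΛdef
  have hlog : 0 ≤ Real.log p := Real.log_natCast_nonneg p
  have hΛ1 : 1 ≤ Λ := by linarith
  have hent := abs_covMatrix_sub_h2Matrix_le (p := p) (κ := κ) hp hx hκ hC hη hc₁ hc₂ hEo hE hρ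
    (by linarith) (fun t ht => sum_abs_chebBasis_le hp ht)
  have hfr := frobNorm_le_of_forall_abs_le (by positivity) hent
  refine hfr.trans ?_
  have h1 : ∑ r ∈ Finset.range d, Λ ^ r ≤ d * Λ ^ (d - 1) := by
    calc ∑ r ∈ Finset.range d, Λ ^ r ≤ ∑ _r ∈ Finset.range d, Λ ^ (d - 1) :=
          Finset.sum_le_sum fun r hr => pow_le_pow_right₀ hΛ1
            (by have := Finset.mem_range.1 hr; omega)
      _ = _ := by simp
  have h2 : 1 + Λ ^ d ≤ 2 * Λ ^ d := by
    have := one_le_pow₀ hΛ1 (n := d)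
    linarith
  have h3 : (∑ r ∈ Finset.range d, Λ ^ r) * (1 + Λ ^ d) ≤ 2 * d * Λ ^ (2 * d - 1) := by
    calc _ ≤ (d * Λ ^ (d - 1)) * (2 * Λ ^ d) := mul_le_mul h1 h2 (by positivity) (by positivity)
      _ = 2 * d * Λ ^ (2 * d - 1) := by
          rw [show 2 * d - 1 = (d - 1) + d by omega, pow_add]; ring
  calc (N : ℝ) * (((∑ r ∈ Finset.range d, Λ ^ r) * (1 + Λ ^ d)) * (2 * c₁ * (η / (4 * c₂)) ^ p))
      ≤ N * ((2 * d * Λ ^ (2 * d - 1)) * (2 * c₁ * (η / (4 * c₂)) ^ p)) := by gcongr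
    _ = _ := by rw [hΛdef, mul_pow]; ring

end Entries

/-! ### Storage -/

section Storage

variable {d N p Cleaf : ℕ} {x : Fin N → Pt d} {κ : Finset (Fin N) → Fin d} {η : ℝ}

-- Leaves hold at most `Cleaf` points, a cluster has at most two sons, and near-field blocks pair
-- two leaves.
open Classical in
lemma storage_le : storage x κ Cleaf η p ≤
    (Finset.univ.filter fun X : Finset (Fin N) => IsCluster x κ Cleaf X).card * Cleaf * p ^ d +
    ((Finset.univ.filter fun X : Finset (Fin N) => IsCluster x κ Cleaf X).card * 2 *
      (p ^ d * p ^ d) + ((far x κ Cleaf η).card * (p ^ d * p ^ d) +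
      (near x κ Cleaf η).card * (Cleaf * Cleaf))) := by
  set 𝒞 := Finset.univ.filter fun X : Finset (Fin N) => IsCluster x κ Cleaf X with h𝒞
  have hcl : ∀ {X}, X ∈ 𝒞 ↔ IsCluster x κ Cleaf X := by simp [h𝒞]
  set S₁ : Finset (Σ _ : Finset (Fin N), Fin N) :=
    (𝒞.filter fun X => sons x κ Cleaf X = ∅).sigma fun X => X with hS₁
  set S₂ : Finset (Σ _ : Finset (Fin N), Finset (Fin N)) := 𝒞.sigma fun X => sons x κ Cleaf X
    with hS₂
  set S₃ : Finset (Σ _ : Finset (Fin N) × Finset (Fin N), Fin N × Fin N) :=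
    (near x κ Cleaf η).sigma fun b => b.1 ×ˢ b.2 with hS₃
  have hc₁ : S₁.card ≤ 𝒞.card * Cleaf := by
    rw [hS₁, Finset.card_sigma]
    refine (Finset.sum_le_card_nsmul _ _ Cleaf fun X hX =>
      sons_eq_empty.1 (Finset.mem_filter.1 hX).2).trans ?_
    exact Nat.mul_le_mul_right _ (Finset.card_filter_le _ _)
  have hc₂ : S₂.card ≤ 𝒞.card * 2 := by
    rw [hS₂, Finset.card_sigma]
    exact Finset.sum_le_card_nsmul _ _ _ fun X _ => card_sons_le X
  have hc₃ : S₃.card ≤ (near x κ Cleaf η).card * (Cleaf * Cleaf) := by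
    rw [hS₃, Finset.card_sigma]
    refine Finset.sum_le_card_nsmul _ _ _ fun b hb => ?_
    obtain ⟨-, hl, hna⟩ := mem_near.1 hb
    obtain ⟨h1, h2⟩ := (blockSons_eq_empty.1 hl).resolve_left hna
    rw [Finset.card_product]
    exact Nat.mul_le_mul (sons_eq_empty.1 h1) (sons_eq_empty.1 h2)
  let f : MemUnit x κ Cleaf η p → (S₁ × (Fin d → Fin p)) ⊕
      (S₂ × (Fin d → Fin p) × (Fin d → Fin p)) ⊕
      (far x κ Cleaf η × (Fin d → Fin p) × (Fin d → Fin p)) ⊕ S₃ := fun u => match u with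
    | .leaf X hX hl i hi n => Sum.inl (⟨⟨X, i⟩, Finset.mem_sigma.2
        ⟨Finset.mem_filter.2 ⟨hcl.2 hX, hl⟩, hi⟩⟩, n)
    | .transfer X X' hX hs m n => Sum.inr (Sum.inl (⟨⟨X, X'⟩, Finset.mem_sigma.2
        ⟨hcl.2 hX, hs⟩⟩, m, n))
    | .coupling X Y hf n m => Sum.inr (Sum.inr (Sum.inl (⟨(X, Y), hf⟩, n, m)))
    | .nearfield X Y hn i j hi hj => Sum.inr (Sum.inr (Sum.inr ⟨⟨(X, Y), (i, j)⟩,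
        Finset.mem_sigma.2 ⟨hn, Finset.mem_product.2 ⟨hi, hj⟩⟩⟩))
  have hf : Function.Injective f := by
    intro u v h
    cases u <;> cases v <;> simp_all [f]
  have hle := Nat.card_le_card_of_injective f hf
  rw [Nat.card_eq_fintype_card (α := _ ⊕ _)] at hle
  simp only [Fintype.card_sum, Fintype.card_prod, Fintype.card_coe, Fintype.card_fun,
    Fintype.card_fin] at hle
  refine hle.trans ?_
  gcongr

end Storage

/-! ### Complexity -/

section Complexity

variable {d N p Cleaf : ℕ} {x : Fin N → Pt d} {κ : Finset (Fin N) → Fin d} {η Cu : ℝ}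
  {D : Set (Pt d)}

lemma QuasiUniform.pos (hD : IsLipschitzDomain D) (hq : QuasiUniform D Cu x) : 0 < N := by
  obtain ⟨y, hy⟩ := hD.isConnected.nonempty
  obtain ⟨i, -⟩ := hq.fill y hy
  exact i.pos

/-- Some coordinate difference is at least the Euclidean distance divided by `d`, which explains
`s`. The summand `Cu⁻¹ / d` in `A` ensures `s ≤ A`. -/
lemma QuasiUniform.geometry (hd : 0 < d) (hD : IsLipschitzDomain D) (hCu : 0 < Cu)
    (hq : QuasiUniform D Cu x) (hκ : LongestEdge x κ) (hC : 2 ≤ Cleaf) :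
    Geometry x κ Cleaf (Metric.diam D + Cu⁻¹ / d) (Cu⁻¹ / d * (N : ℝ) ^ (-(1 / (d : ℝ)))) := by
  have hN := hq.pos hD
  have hd' : (0 : ℝ) < d := by exact_mod_cast hd
  have hN' : (1 : ℝ) ≤ N := by exact_mod_cast hN
  have hne : (Finset.univ : Finset (Fin N)).Nonempty := ⟨⟨0, hN⟩, Finset.mem_univ _⟩
  refine ⟨hd, hN, hκ, hC, ?_, by positivity, ?_, ?_⟩
  · obtain ⟨i, -, hil⟩ := exists_bbox_lo_eq x hne (κ Finset.univ)
    obtain ⟨j, -, hjh⟩ := exists_bbox_hi_eq x hne (κ Finset.univ)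
    have h1 : len x κ Finset.univ ≤ Metric.diam D := by
      calc len x κ Finset.univ = (x j - x i) (κ Finset.univ) := by simp [len, Box.edge, hil, hjh]
        _ ≤ ‖x j - x i‖ := (le_abs_self _).trans (abs_coord_le_norm _ _)
        _ = dist (x j) (x i) := (dist_eq_norm _ _).symm
        _ ≤ _ := Metric.dist_le_diam_of_mem hD.isBounded (hq.mem j) (hq.mem i)
    have : 0 ≤ Cu⁻¹ / d := by positivity
    linarith
  · have h1 : (N : ℝ) ^ (-(1 / (d : ℝ))) ≤ 1 :=
      Real.rpow_le_one_of_one_le_of_nonpos hN' (by simp)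
    have h2 : 0 ≤ Cu⁻¹ / d := by positivity
    have h3 : 0 ≤ Metric.diam D := Metric.diam_nonneg
    nlinarith
  · intro i j hij
    have : Nonempty (Fin d) := ⟨⟨0, hd⟩⟩
    obtain ⟨k, hk⟩ := Finite.exists_max fun k => |x i k - x j k|
    refine ⟨k, ?_⟩
    have h1 := (hq.separated i j hij).trans (norm_sub_le_mul (abs_nonneg _) hk)
    rw [div_mul_eq_mul_div, div_le_iff₀ hd']
    linarith

/-- Here the packing ratio `(A / s) ^ d` becomes linear in `N`. -/
lemma div_mul_rpow_pow (hd : 0 < d) (hN : 0 < N) (A σ : ℝ) :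
    (A / (σ * (N : ℝ) ^ (-(1 / (d : ℝ))))) ^ d = (A / σ) ^ d * N := by
  have hd' : (d : ℝ) ≠ 0 := by exact_mod_cast hd.ne'
  have hN' : (0 : ℝ) < N := by exact_mod_cast hN
  have h1 : ((N : ℝ) ^ (-(1 / (d : ℝ)))) ^ d = (N : ℝ)⁻¹ := by
    rw [← Real.rpow_natCast, ← Real.rpow_mul hN'.le, neg_mul, one_div, inv_mul_cancel₀ hd',
      Real.rpow_neg_one]
  rw [div_pow, mul_pow, h1, div_pow]
  field_simp

end Complexity

end H2Matrix

/-! ### Choice of the constant and proof of the proposition -/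

open H2Matrix
theorem proposition3p2 (d : ℕ) (hd : 0 < d) (D : Set (Pt d)) (hD : IsLipschitzDomain D)
    (Cu : ℝ) (hCu : 0 < Cu) (Cleaf : ℕ) (hleaf : 2 ≤ Cleaf) (η : ℝ) (hη : 0 < η)
    (c₁ : ℝ) (hc₁ : 0 < c₁) :
    ∃ CH : ℝ, 0 < CH ∧
      ∀ (N : ℕ) (x : Fin N → Pt d), QuasiUniform D Cu x →
      ∀ κ : Finset (Fin N) → Fin d, LongestEdge x κ →
      ∀ p : ℕ, 1 ≤ p →
        -- storage
        (storage x κ Cleaf η p : ℝ) < CH * (p : ℝ) ^ (2 * d) * N ∧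
        -- matrix-vector multiplication, from the stored numbers, by one program for all kernels
        (∃ P : Program (Fin N ⊕ MemUnit x κ Cleaf η p) (Fin N),
          (P.cost : ℝ) < CH * (p : ℝ) ^ (2 * d) * N ∧
          ∀ (ρ : Pt d → Pt d → ℝ) (z : Fin N → ℝ),
            P.run (Sum.elim z (memory x κ Cleaf η ρ p)) = h2Matrix x κ Cleaf η ρ p *ᵥ z) ∧
        -- symmetry, approximation, positive definiteness
        ∀ (E : Set (Pt d)) (c₂ : ℝ) (ρ : Pt d → Pt d → ℝ),
          IsOpen E → D ⊆ E → (bbox x Finset.univ).toSet ⊆ E → 0 < c₂ →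
          AsympSmooth E c₁ c₂ ρ → (∀ y ∈ E, ∀ y' ∈ E, ρ y y' = ρ y' y) →
            (h2Matrix x κ Cleaf η ρ p).IsSymm ∧
            specNorm (covMatrix x ρ - h2Matrix x κ Cleaf η ρ p) ≤
              frobNorm (covMatrix x ρ - h2Matrix x κ Cleaf η ρ p) ∧
            frobNorm (covMatrix x ρ - h2Matrix x κ Cleaf η ρ p) ≤
              CH * N * (Real.log p + 1) ^ (2 * d - 1) * (η / (4 * c₂)) ^ p ∧
            (CH * N * (Real.log p + 1) ^ (2 * d - 1) * (η / (4 * c₂)) ^ p <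
                lambdaMin (covMatrix x ρ) →
              (h2Matrix x κ Cleaf η ρ p).PosDef) := by
  classical
  set A : ℝ := Metric.diam D + Cu⁻¹ / d with hA
  -- `G * N` is the packing ratio; `a * N` and `b * N` below bound the numbers of clusters and of
  -- inadmissible blocks.
  set G : ℝ := (A / (Cu⁻¹ / d)) ^ d with hG
  have hG0 : 0 ≤ G := by
    have : 0 ≤ Metric.diam D := Metric.diam_nonneg
    positivity
  set a : ℝ := (2 * d * 16 ^ d + 3 ^ d) * G with ha
  have ha0 : 0 ≤ a := by positivity
  set b : ℝ := blockConst d η * G with hb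
  have hb0 : 0 ≤ b := by
    have : 0 ≤ blockConst d η := by unfold blockConst; positivity
    positivity
  set e : ℝ := 4 * d * c₁ * 20 ^ (2 * d - 1) with he
  have he0 : 0 ≤ e := by positivity
  -- `e` is the error constant. The bracket collects the coefficients of the program's cost, which
  -- also dominate the storage, and the last `1` makes the inequalities strict.
  set CH : ℝ := e + (1 + a * (2 * Cleaf + 7) + 2 * (1 + 4 * b) + 3 + 2 * (Cleaf * Cleaf * b)) + 1
    with hCH
  refine ⟨CH, by positivity, fun N x hq κ hκ p hp => ?_⟩
  have hN := hq.pos hD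
  have hN' : (1 : ℝ) ≤ N := by exact_mod_cast hN
  have hgeo := hq.geometry hd hD hCu hκ hleaf
  have hinj := hgeo.injective
  have hnC := hgeo.card_clusters_le
  have hnI := hgeo.card_inadmissibleBlocks_le hη
  rw [div_mul_rpow_pow hd hN, ← mul_assoc] at hnC hnI
  rw [← hA, ← hG, ← ha] at hnC
  rw [← hA, ← hG, ← hb] at hnI
  set nC := (Finset.univ.filter fun X : Finset (Fin N) => IsCluster x κ Cleaf X).card with hnCdef
  have hnN : ((near x κ Cleaf η).card : ℝ) ≤ b * N :=
    le_trans (Nat.cast_le.2 (Finset.card_le_card near_subset)) hnI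
  have hnF : ((far x κ Cleaf η).card : ℝ) ≤ (1 + 4 * b) * N := by
    have h1 : ((far x κ Cleaf η).card : ℝ) ≤ 1 + 4 * (inadmissibleBlocks x κ Cleaf η).card := by
      exact_mod_cast card_far_le
    linarith
  set u : ℝ := (p : ℝ) ^ d with hu
  have hu1 : 1 ≤ u := one_le_pow₀ (by exact_mod_cast hp)
  have hpu : (p : ℝ) ^ (2 * d) = u * u := by rw [two_mul, pow_add]
  have huu : u ≤ u * u := le_mul_of_one_le_left (by positivity) hu1
  have huu1 : 1 ≤ u * u := hu1.trans huu
  have hNuu : (N : ℝ) ≤ u * u * N := le_mul_of_one_le_left (by positivity) huu1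
  have hpos : 0 < u * u * N := by positivity
  have hCl : (0 : ℝ) ≤ Cleaf := by positivity
  have t1 : (nC : ℝ) * Cleaf * u ≤ a * Cleaf * (u * u * N) := by
    calc (nC : ℝ) * Cleaf * u ≤ (a * N) * Cleaf * (u * u) := by gcongr
      _ = _ := by ring
  have t2 : (nC : ℝ) * (u * u) ≤ a * (u * u * N) := by
    calc (nC : ℝ) * (u * u) ≤ (a * N) * (u * u) := by gcongr
      _ = _ := by ring
  have t2' : (nC : ℝ) * u ≤ a * (u * u * N) :=
    le_trans (mul_le_mul_of_nonneg_left huu (by positivity)) t2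
  have t3 : ((far x κ Cleaf η).card : ℝ) * (u * u) ≤ (1 + 4 * b) * (u * u * N) := by
    calc _ ≤ ((1 + 4 * b) * N) * (u * u) := by gcongr
      _ = _ := by ring
  have t4 : ((near x κ Cleaf η).card : ℝ) * (Cleaf * Cleaf) ≤ Cleaf * Cleaf * b * (u * u * N) := by
    calc _ ≤ (b * (u * u * N)) * (Cleaf * Cleaf) := by
          refine mul_le_mul_of_nonneg_right (hnN.trans ?_) (by positivity)
          exact mul_le_mul_of_nonneg_left hNuu hb0
      _ = _ := by ring
  have t5 : (N : ℝ) * u ≤ u * u * N := by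
    calc (N : ℝ) * u ≤ N * (u * u) := by gcongr
      _ = _ := by ring
  have hCHW : CH * (u * u) * N = e * (u * u * N) + (u * u * N) + a * Cleaf * (u * u * N) * 2 +
      7 * (a * (u * u * N)) + 2 * ((1 + 4 * b) * (u * u * N)) + 3 * (u * u * N) +
      2 * (Cleaf * Cleaf * b * (u * u * N)) + u * u * N := by
    rw [hCH]; ring
  have q0 : 0 ≤ e * (u * u * N) := by positivity
  have q1 : 0 ≤ a * Cleaf * (u * u * N) := by positivity
  have q2 : 0 ≤ a * (u * u * N) := by positivity
  have q3 : 0 ≤ (1 + 4 * b) * (u * u * N) := by positivity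
  have q4 : 0 ≤ Cleaf * Cleaf * b * (u * u * N) := by positivity
  refine ⟨?_, ?_, ?_⟩
  · have h1 : (storage x κ Cleaf η p : ℝ) ≤ nC * Cleaf * u + (nC * 2 * (u * u) +
        ((far x κ Cleaf η).card * (u * u) + (near x κ Cleaf η).card * (Cleaf * Cleaf))) := by
      rw [hu]; exact_mod_cast storage_le
    rw [hpu, hCHW]
    linarith
  · obtain ⟨P, hcost, hrun⟩ := exists_program (η := η) hp hN hinj hκ hleaf
    refine ⟨P, ?_, hrun⟩
    have h1 : (P.cost : ℝ) ≤ 1 + nC * (u * (2 * Cleaf + 4 * u)) +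
        2 * (u * u) * (far x κ Cleaf η).card + nC * (u * (2 * u + 1)) +
        (N * (2 * u + 1) + 2 * (Cleaf * Cleaf * (near x κ Cleaf η).card)) := by
      rw [hu]; exact_mod_cast hcost
    have h2 : (P.cost : ℝ) ≤ 1 + 2 * (nC * Cleaf * u) + 6 * (nC * (u * u)) + nC * u +
        2 * ((far x κ Cleaf η).card * (u * u)) + 2 * (N * u) + N +
        2 * ((near x κ Cleaf η).card * (Cleaf * Cleaf)) := h1.trans (le_of_eq (by ring))
    rw [hpu, hCHW]
    linarith
  · intro E c₂ ρ hEo _ hE hc₂ hρ hsymm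
    have hfr : frobNorm (covMatrix x ρ - h2Matrix x κ Cleaf η ρ p) ≤
        CH * N * (Real.log p + 1) ^ (2 * d - 1) * (η / (4 * c₂)) ^ p := by
      refine (frobNorm_covMatrix_sub_h2Matrix_le hd hp hinj hκ hleaf hη hc₁.le hc₂ hEo hE hρ).trans
        ?_
      have hlog : 0 ≤ Real.log p := Real.log_natCast_nonneg p
      have heCH : e ≤ CH := by
        rw [hCH, add_assoc]
        exact le_add_of_nonneg_right (by positivity)
      gcongr
    have hs := h2Matrix_isSymm (p := p) (η := η) hinj hκ hleaf hE hsymm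
    exact ⟨hs, specNorm_le_frobNorm _, hfr, fun h => posDef_of_frobNorm_sub_lt hs (hfr.trans_lt h)⟩
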